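/- Let $k$ be a field and let $\mathcal D$ be a triangulated ($\mathbb Z$-graded, cohomologically unital, $k$-linear) $A_\infty$-category, i.e. an $A_\infty$-category with shifts and cones. Write $\operatorname{Hom}^n(X,Y)=H^n(\hom(X,Y))$. For a family of objects, $\langle\ldots\rangle$ denotes the full triangulated subcategory generated by it. Let $m\ge 1$ and let $E_1,\ldots,E_{m+1}$ be an exceptional collection in $\mathcal D$: $\operatorname{Hom}^*(E_i,E_i)=k$ in degree $0$ and $\operatorname{Hom}^*(E_j,E_i)=0$ for $i<j$. Put $\mathcal C=\langle E_1,\ldots,E_m\rangle$; assume (as holds automatically when all $\operatorname{Hom}^*(X,Y)$ have finite total dimension) that the left and right adjoint functors $\lambda,\rho:\mathcal D\to\mathcal C$ to the inclusion, the Serre functor $S_{\mathcal C}$ of $\mathcal C$, and the left mutations below exist. Here, for a triangulated subcategory $\mathcal B$, the left mutation $L_{\mathcal B}(X)$ of $X$ is defined by an exact triangle $B\to X\to L_{\mathcal B}(X)\to B[1]$ with $B\in\mathcal B$ and $\operatorname{Hom}^*(\mathcal B,L_{\mathcal B}(X))=0$; $L_{E_1}=L_{\langle E_1\rangle}$. For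 objects $X_0,\ldots,X_m$, let $\operatorname{end}_{\to}(X_0,\ldots,X_m)$ be the directed $A_\infty$-category with the ordered objects $0,\ldots,m$, morphism spaces $\hom(X_i,X_j)$ for $i<j$, $k\cdot\mathrm{id}$ for $i=j$ (strict units), $0$ for $i>j$, and the operations of $\mathcal D$. Then, for every integer $d$, the following conditions are equivalent. (i) $\operatorname{Hom}^n(E_1,E_{m+1})=0$ for $n\ne d$, $\operatorname{Hom}^d(E_1,E_{m+1})\cong k$, and for all $1<i<m+1$ and all $j\in\mathbb Z$ the composition $\operatorname{Hom}^j(E_i,E_{m+1})\otimes\operatorname{Hom}^{d-j}(E_1,E_i)\to\operatorname{Hom}^d(E_1,E_{m+1})\cong k$ is a perfect pairing. (i') $\operatorname{Hom}^n(E_1,E_{m+1})=0$ for $n\ne d$, $\operatorname{Hom}^d(E_1,E_{m+1})\cong k$, and for every $C\in\mathcal C$ the composition $\operatorname{Hom}^d(C,E_{m+1})\otimes\operatorname{Hom}^0(E_1,C)\to\operatorname{Hom}^d(E_1,E_{m+1})\cong k$ is a perfect pairing. (ii) $\operatorname{Hom}^n(E_1,E_{m+1})=0$ for $n\ne d$,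 $\operatorname{Hom}^d(E_1,E_{m+1})\cong k$, and $\operatorname{Hom}^*(L_{E_1}E_i,E_{m+1})=0$ for all $1<i<m+1$. (iii) There is an isomorphism $\rho(E_{m+1})[d]\simeq S_{\mathcal C}(E_1)$. (iv) There is an isomorphism $\lambda(L_{\mathcal C}(E_{m+1}))[d-1]\simeq S_{\mathcal C}(E_1)$. (v) For every exceptional collection $(E'_1,\ldots,E'_m)$ generating $\mathcal C$, there is an equivalence of directed $A_\infty$-categories (an $A_\infty$-quasi-isomorphism preserving the order of the objects) $\operatorname{end}_{\to}(S_{\mathcal C}(E_1),E'_1,\ldots,E'_m)\simeq\operatorname{end}_{\to}(L_{\mathcal C}(E_{m+1})[d-1],E'_1,\ldots,E'_m)$ that is the identity on $\operatorname{end}_{\to}(E'_1,\ldots,E'_m)$. -/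

import Mathlib

open CategoryTheory

set_option linter.checkUnivs false

universe w u v

namespace AInf

/-! ### Strings of composable homogeneous morphisms -/

/-- A string `a₁, …, a_s` of composable homogeneous elements `aᵢ ∈ hom(X_{i-1}, X_i)^{dᵢ}`,
written in the order in which the morphisms are composed (`a₁` is applied first). -/
inductive Chain {Obj : Type u} (hom : Obj → Obj → ℤ → Type v) : Obj → Obj → Type (max u v)
  | nil (X : Obj) : Chain hom X X
  | cons {X Y Z : Obj} (d : ℤ) (a : hom X Y d) (c : Chain hom Y Z) : Chain hom X Z

namespace Chain

variable {Obj : Type u} {hom : Obj → Obj → ℤ → Type v}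

/-- The string consisting of one element. -/
def single {X Y : Obj} (d : ℤ) (a : hom X Y d) : Chain hom X Y := cons d a (nil Y)

/-- The string consisting of two elements. -/
def pair {X Y Z : Obj} (d e : ℤ) (a : hom X Y d) (b : hom Y Z e) : Chain hom X Z :=
  cons d a (cons e b (nil Z))

/-- The string consisting of three elements. -/
def triple {X Y Z W : Obj} (d e f : ℤ) (a : hom X Y d) (b : hom Y Z e) (c : hom Z W f) :
    Chain hom X W :=
  cons d a (cons e b (cons f c (nil W)))

/-- Concatenation of strings. -/
def append : {X Y Z : Obj} → Chain hom X Y → Chain hom Y Z → Chain hom X Z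
  | _, _, _, nil _, c => c
  | _, _, _, cons d a p, c => cons d a (p.append c)

/-- The number of elements of a string. -/
def length : {X Y : Obj} → Chain hom X Y → ℕ
  | _, _, nil _ => 0
  | _, _, cons _ _ c => c.length + 1

/-- The total reduced degree `∑ (|aᵢ| - 1)` of a string. -/
def rdeg : {X Y : Obj} → Chain hom X Y → ℤ
  | _, _, nil _ => 0
  | _, _, cons d _ c => (d - 1) + c.rdeg

/-- All the ways to cut a string into two (possibly empty) consecutive strings. -/
def splits : {X Y : Obj} → Chain hom X Y → List (Σ Z : Obj, Chain hom X Z × Chain hom Z Y)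
  | _, _, nil X => [⟨X, nil X, nil X⟩]
  | X, _, cons d a c =>
      ⟨X, nil X, cons d a c⟩ :: c.splits.map fun s => ⟨s.1, cons d a s.2.1, s.2.2⟩

/-- For operations `μ` of reduced degree `1`, the list of all strings
`p, μ(q), r` for all the ways to write the given string as `p, q, r`, each one together with the
sign `(-1)^{rdeg p}`.  (The cuts with `q` empty give a zero entry as soon as `μ` vanishes on empty
strings.) -/
def insertions (μ : ∀ {X Y : Obj}, Chain hom X Y → ∀ n : ℤ, hom X Y n) {X Y : Obj}
    (c : Chain hom X Y) : List (ℤˣ × Chain hom X Y) :=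
  c.splits.flatMap fun s => s.2.2.splits.map fun t =>
    (s.2.1.rdeg.negOnePow,
      s.2.1.append (cons (t.2.1.rdeg + 2) (μ t.2.1 (t.2.1.rdeg + 2)) t.2.2))

/-- Apply maps of graded morphism spaces to each element of a string. -/
def map {Obj' : Type*} {hom' : Obj' → Obj' → ℤ → Type*} (φ : Obj → Obj')
    (f : ∀ {X Y : Obj} {n : ℤ}, hom X Y n → hom' (φ X) (φ Y) n) :
    {X Y : Obj} → Chain hom X Y → Chain hom' (φ X) (φ Y)
  | _, _, nil X => nil (φ X)
  | _, _, cons d a c => cons d (f a) (c.map φ f)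

section map

variable {Obj' : Type*} {hom' : Obj' → Obj' → ℤ → Type*} (φ : Obj → Obj')
  (f : ∀ {X Y : Obj} {n : ℤ}, hom X Y n → hom' (φ X) (φ Y) n)

lemma map_append : ∀ {X Y Z : Obj} (p : Chain hom X Y) (c : Chain hom Y Z),
    (p.append c).map φ f = (p.map φ f).append (c.map φ f)
  | _, _, _, nil _, _ => rfl
  | _, _, _, cons d a p, c => congrArg (cons d (f a)) (map_append p c)

lemma rdeg_map : ∀ {X Y : Obj} (c : Chain hom X Y), (c.map φ f).rdeg = c.rdeg
  | _, _, nil _ => rfl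
  | _, _, cons d _ c => congrArg (d - 1 + ·) (rdeg_map c)

lemma splits_map : ∀ {X Y : Obj} (c : Chain hom X Y), (c.map φ f).splits =
    c.splits.map fun s => ⟨φ s.1, s.2.1.map φ f, s.2.2.map φ f⟩
  | _, _, nil _ => rfl
  | _, _, cons d a c => by
      simp only [map, splits, splits_map c, List.map_cons, List.map_map, Function.comp_def]

lemma insertions_map (μ : ∀ {X Y : Obj}, Chain hom X Y → ∀ n : ℤ, hom X Y n)
    (μ' : ∀ {X Y : Obj'}, Chain hom' X Y → ∀ n : ℤ, hom' X Y n)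
    (h : ∀ {X Y : Obj} (c : Chain hom X Y) (n : ℤ), f (μ c n) = μ' (c.map φ f) n)
    {X Y : Obj} (c : Chain hom X Y) :
    (c.map φ f).insertions μ' = (c.insertions μ).map fun s => (s.1, s.2.map φ f) := by
  have e : ∀ {X Y Z : Obj} (q : Chain hom X Y) (r : Chain hom' (φ Y) (φ Z)),
      cons ((q.map φ f).rdeg + 2) (μ' (q.map φ f) ((q.map φ f).rdeg + 2)) r =
        cons (q.rdeg + 2) (μ' (q.map φ f) (q.rdeg + 2)) r := fun q r => by rw [rdeg_map]
  simp only [insertions, splits_map, List.flatMap_map, List.map_flatMap, List.map_map,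
    Function.comp_def, e, rdeg_map, map_append, map, h]

end map

lemma append_assoc : ∀ {X Y Z W : Obj} (p : Chain hom X Y) (q : Chain hom Y Z)
    (r : Chain hom Z W), (p.append q).append r = p.append (q.append r)
  | _, _, _, _, nil _, _, _ => rfl
  | _, _, _, _, cons d a p, q, r => congrArg (cons d a) (append_assoc p q r)

/-- For operations `F` of reduced degree `0`, the list of all strings
`F(q₁), …, F(q_r)`, for all the ways to write the string `acc, c` as `q₁, …, q_r` such that
`q₁` contains `acc` and `q₂, …, q_r` are not empty. -/
def blocks {Obj' : Type*} {hom' : Obj' → Obj' → ℤ → Type*} (φ : Obj → Obj')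
    (F : ∀ {X Y : Obj}, Chain hom X Y → ∀ n : ℤ, hom' (φ X) (φ Y) n) :
    {X Y Z : Obj} → Chain hom X Y → Chain hom Y Z → List (Chain hom' (φ X) (φ Z))
  | _, _, _, acc, nil _ => [single (acc.rdeg + 1) (F acc (acc.rdeg + 1))]
  | _, _, _, acc, cons d a c =>
      blocks φ F (acc.append (single d a)) c ++
        (blocks φ F (single d a) c).map (cons (acc.rdeg + 1) (F acc (acc.rdeg + 1)))

end Chain

/-! ### `A∞`-categories -/

/-- A (not necessarily unital) `ℤ`-graded `A∞`-category over a field `k`.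
For a string `c = (a₁, …, a_s)` the element `m c n` is the component in degree `n` of
`μ^s(a_s, …, a_1)`; this element is homogeneous of degree `∑ |aᵢ| + 2 - s`, and is zero for `s = 0`
(no curvature).  The `A∞`-relations are
`∑ (-1)^{|a₁| + … + |a_r| - r} μ(a_s, …, μ(a_{r+t}, …, a_{r+1}), a_r, …, a_1) = 0`. -/
structure AInfPrecategory (k : Type w) [Field k] where
  Obj : Type u
  hom : Obj → Obj → ℤ → Type v
  [addCommGroup : ∀ X Y n, AddCommGroup (hom X Y n)]
  [module : ∀ X Y n, Module k (hom X Y n)]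
  m : ∀ {X Y : Obj}, Chain hom X Y → ∀ n : ℤ, hom X Y n
  m_nil : ∀ (X : Obj) (n : ℤ), m (Chain.nil X) n = 0
  m_degree : ∀ {X Y : Obj} (c : Chain hom X Y) (n : ℤ), n ≠ c.rdeg + 2 → m c n = 0
  m_add : ∀ {X Y Z W : Obj} (p : Chain hom X Y) (d : ℤ) (a b : hom Y Z d) (q : Chain hom Z W)
    (n : ℤ), m (p.append (.cons d (a + b) q)) n =
      m (p.append (.cons d a q)) n + m (p.append (.cons d b q)) n
  m_smul : ∀ {X Y Z W : Obj} (p : Chain hom X Y) (d : ℤ) (t : k) (a : hom Y Z d)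
    (q : Chain hom Z W) (n : ℤ), m (p.append (.cons d (t • a) q)) n = t • m (p.append (.cons d a q)) n
  relation : ∀ {X Y : Obj} (c : Chain hom X Y) (n : ℤ),
    ((c.insertions m).map fun s => s.1 • m s.2 n).sum = 0

namespace AInfPrecategory

attribute [instance] AInfPrecategory.addCommGroup AInfPrecategory.module

variable {k : Type w} [Field k] (A : AInfPrecategory.{w, u, v} k)

/-- The operation `μ¹`, from degree `n` to degree `n'` (it is zero unless `n' = n + 1`). -/
def m1 (X Y : A.Obj) (n n' : ℤ) : A.hom X Y n →ₗ[k] A.hom X Y n' where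
  toFun a := A.m (.single n a) n'
  map_add' a b := A.m_add (.nil X) n a b (.nil Y) n'
  map_smul' t a := A.m_smul (.nil X) n t a (.nil Y) n'

/-- The operation `(a, b) ↦ μ²(b, a)`, with values in degree `l`
(it is zero unless `l = i + j`). -/
def m2 (X Y Z : A.Obj) (i j l : ℤ) : A.hom X Y i →ₗ[k] A.hom Y Z j →ₗ[k] A.hom X Z l :=
  LinearMap.mk₂ k (fun a b => A.m (.pair i j a b) l)
    (fun a a' b => A.m_add (.nil X) i a a' (.single j b) l)
    (fun t a b => A.m_smul (.nil X) i t a (.single j b) l)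
    (fun a b b' => A.m_add (.single i a) j b b' (.nil Z) l)
    (fun t a b => A.m_smul (.single i a) j t b (.nil Z) l)

lemma m_cons_zero {X Y Z W : A.Obj} (p : Chain A.hom X Y) (d : ℤ) (q : Chain A.hom Z W) (n : ℤ) :
    A.m (p.append (.cons d (0 : A.hom Y Z d) q)) n = 0 := by
  have h := A.m_smul p d (0 : k) (0 : A.hom Y Z d) q n
  rwa [zero_smul, zero_smul] at h

lemma m_zero₀ {X Y Z : A.Obj} (d : ℤ) (q : Chain A.hom Y Z) (n : ℤ) :
    A.m (.cons d (0 : A.hom X Y d) q) n = 0 :=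
  A.m_cons_zero (.nil X) d q n

lemma m_zero₁ {X Y Z W : A.Obj} (d e : ℤ) (a : A.hom X Y d) (q : Chain A.hom Z W) (n : ℤ) :
    A.m (.cons d a (.cons e (0 : A.hom Y Z e) q)) n = 0 :=
  A.m_cons_zero (.single d a) e q n

lemma m_zero₂ {X Y Z W V : A.Obj} (d e f : ℤ) (a : A.hom X Y d) (b : A.hom Y Z e)
    (q : Chain A.hom W V) (n : ℤ) :
    A.m (.cons d a (.cons e b (.cons f (0 : A.hom Z W f) q))) n = 0 :=
  A.m_cons_zero (.pair d e a b) f q n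

lemma m_zero₃ {X Y Z W V U : A.Obj} (d e f g : ℤ) (a : A.hom X Y d) (b : A.hom Y Z e)
    (c : A.hom Z W f) (q : Chain A.hom V U) (n : ℤ) :
    A.m (.cons d a (.cons e b (.cons f c (.cons g (0 : A.hom W V g) q)))) n = 0 :=
  A.m_cons_zero (.triple d e f a b c) g q n

lemma m1_eq_zero {X Y : A.Obj} {n n' : ℤ} (h : n' ≠ n + 1) (a : A.hom X Y n) :
    A.m1 X Y n n' a = 0 :=
  A.m_degree _ _ (by simp only [Chain.single, Chain.rdeg]; omega)

lemma m2_eq_zero {X Y Z : A.Obj} {i j l : ℤ} (h : l ≠ i + j) (a : A.hom X Y i) (b : A.hom Y Z j) :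
    A.m2 X Y Z i j l a b = 0 :=
  A.m_degree _ _ (by simp only [Chain.pair, Chain.rdeg]; omega)

/-- The `A∞`-relation for one element: `μ¹` is a differential. -/
lemma m1_m1 (X Y : A.Obj) (n n' n'' : ℤ) (a : A.hom X Y n) :
    A.m1 X Y n' n'' (A.m1 X Y n n' a) = 0 := by
  by_cases h : n' = n + 1
  · subst h
    have h := A.relation (.single n a) n''
    simp only [Chain.insertions, Chain.splits, Chain.single, Chain.append, Chain.rdeg, A.m_nil,
      List.map_cons, List.map_nil, List.flatMap_cons, List.flatMap_nil, List.cons_append,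
      List.nil_append, List.sum_cons, List.sum_nil, m_zero₀, m_zero₁, smul_zero, zero_add, add_zero,
      Int.negOnePow_zero, one_smul] at h
    rw [show n - 1 + 0 + 2 = n + 1 by ring] at h
    exact h
  · rw [A.m1_eq_zero h, map_zero]

/-- The `A∞`-relation for two elements: the Leibniz rule. -/
lemma m1_m2 (X Y Z : A.Obj) (i j l l' : ℤ) (hl : l = i + j) (a : A.hom X Y i) (b : A.hom Y Z j) :
    A.m1 X Z l l' (A.m2 X Y Z i j l a b) + A.m2 X Y Z (i + 1) j l' (A.m1 X Y i (i + 1) a) b +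
      (i - 1).negOnePow • A.m2 X Y Z i (j + 1) l' a (A.m1 Y Z j (j + 1) b) = 0 := by
  have h := A.relation (.pair i j a b) l'
  simp only [Chain.insertions, Chain.splits, Chain.pair, Chain.append, Chain.rdeg, A.m_nil,
      List.map_cons, List.map_nil, List.flatMap_cons, List.flatMap_nil, List.cons_append,
      List.nil_append, List.sum_cons, List.sum_nil, m_zero₀, m_zero₁, m_zero₂, smul_zero, zero_add,
      add_zero, Int.negOnePow_zero, one_smul] at h
  rw [show i - 1 + 0 + 2 = i + 1 by ring, show j - 1 + 0 + 2 = j + 1 by ring,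
    show i - 1 + (j - 1 + 0) + 2 = l by rw [hl]; ring, ← add_assoc,
    add_comm (A.m (Chain.cons (i + 1) _ _) l')] at h
  exact h

/-- The `A∞`-relation for three elements, when these are closed: `μ²` is associative up to signs
and up to a boundary. -/
lemma m2_m2 (X Y Z W : A.Obj) (i j l p q r : ℤ) (hp : p = i + j) (hq : q = j + l)
    (a : A.hom X Y i) (b : A.hom Y Z j) (c : A.hom Z W l) (ha : A.m1 X Y i (i + 1) a = 0)
    (hb : A.m1 Y Z j (j + 1) b = 0) (hc : A.m1 Z W l (l + 1) c = 0) :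
    A.m1 X W (i + j + l - 1) r (A.m (.triple i j l a b c) (i + j + l - 1)) +
      A.m2 X Z W p l r (A.m2 X Y Z i j p a b) c +
      (i - 1).negOnePow • A.m2 X Y W i q r a (A.m2 Y Z W j l q b c) = 0 := by
  have h := A.relation (.triple i j l a b c) r
  simp only [Chain.insertions, Chain.splits, Chain.triple, Chain.append, Chain.rdeg, A.m_nil,
      List.map_cons, List.map_nil, List.flatMap_cons, List.flatMap_nil, List.cons_append,
      List.nil_append, List.sum_cons, List.sum_nil, m_zero₀, m_zero₁, m_zero₂, m_zero₃, smul_zero,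
      zero_add, add_zero, Int.negOnePow_zero, one_smul] at h
  rw [show i - 1 + 0 + 2 = i + 1 by ring, show j - 1 + 0 + 2 = j + 1 by ring,
    show l - 1 + 0 + 2 = l + 1 by ring, show i - 1 + (j - 1 + 0) + 2 = p by rw [hp]; ring,
    show j - 1 + (l - 1 + 0) + 2 = q by rw [hq]; ring,
    show i - 1 + (j - 1 + (l - 1 + 0)) + 2 = i + j + l - 1 by ring] at h
  change A.m (Chain.single i a) (i + 1) = 0 at ha
  change A.m (Chain.single j b) (j + 1) = 0 at hb
  change A.m (Chain.single l c) (l + 1) = 0 at hc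
  simp only [Chain.single] at ha hb hc
  rw [ha, hb, hc] at h
  simp only [m_zero₀, m_zero₁, m_zero₂, smul_zero, zero_add, add_zero] at h
  rw [← add_assoc, add_comm (A.m (Chain.cons p _ _) r)] at h
  exact h

/-! ### The cohomology category -/

/-- The closed elements of degree `n`. -/
def cocycles (X Y : A.Obj) (n : ℤ) : Submodule k (A.hom X Y n) :=
  LinearMap.ker (A.m1 X Y n (n + 1))

/-- The exact elements of degree `n`, inside of the closed ones. -/
def coboundaries (X Y : A.Obj) (n : ℤ) : Submodule k (A.cocycles X Y n) :=
  (LinearMap.range (A.m1 X Y (n - 1) n)).comap (A.cocycles X Y n).subtype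

/-- `Hom^n(X, Y)`: the cohomology in degree `n` of the complex `hom(X, Y)`. -/
abbrev H (X Y : A.Obj) (n : ℤ) : Type v := A.cocycles X Y n ⧸ A.coboundaries X Y n

lemma cocycle_m1 {X Y : A.Obj} {n : ℤ} (a : A.cocycles X Y n) (n' : ℤ) :
    A.m1 X Y n n' a.1 = 0 := by
  by_cases h : n' = n + 1
  · subst h; exact a.2
  · exact A.m1_eq_zero h _

lemma m2_mem_cocycles (X Y Z : A.Obj) (i j l : ℤ) (a : A.cocycles X Y i) (b : A.cocycles Y Z j) :
    A.m2 X Y Z i j l a.1 b.1 ∈ A.cocycles X Z l := by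
  by_cases hl : l = i + j
  · have h := A.m1_m2 X Y Z i j l (l + 1) hl a.1 b.1
    rw [A.cocycle_m1 a, A.cocycle_m1 b, map_zero, map_zero, LinearMap.zero_apply, smul_zero,
      add_zero, add_zero] at h
    exact h
  · rw [A.m2_eq_zero hl]
    exact zero_mem _

/-- The product `(a, b) ↦ b ∘ a = (-1)^{|a|} μ²(b, a)` of closed elements. -/
def compCocycles (X Y Z : A.Obj) (i j l : ℤ) :
    A.cocycles X Y i →ₗ[k] A.cocycles Y Z j →ₗ[k] A.cocycles X Z l :=
  LinearMap.mk₂ k (fun a b => i.negOnePow • ⟨A.m2 X Y Z i j l a.1 b.1, A.m2_mem_cocycles X Y Z i j l a b⟩)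
    (fun a a' b => by rw [← smul_add]; congr 1; ext; simp)
    (fun t a b => by rw [smul_comm]; congr 1; ext; simp)
    (fun a b b' => by rw [← smul_add]; congr 1; ext; simp)
    (fun t a b => by rw [smul_comm]; congr 1; ext; simp)

lemma units_smul_mem {M : Type*} [AddCommGroup M] [Module k M] (S : Submodule k M) (e : ℤˣ) {x : M}
    (hx : x ∈ S) : e • x ∈ S := by
  rcases Int.units_eq_one_or e with rfl | rfl
  · simpa using hx
  · simpa using hx

lemma compCocycles_left_mem (X Y Z : A.Obj) (i j l : ℤ) (a : A.cocycles X Y i)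
    (ha : a ∈ A.coboundaries X Y i) (b : A.cocycles Y Z j) :
    A.compCocycles X Y Z i j l a b ∈ A.coboundaries X Z l := by
  refine units_smul_mem _ _ ?_
  obtain ⟨x, hx⟩ := ha
  change A.m1 X Y (i - 1) i x = a.1 at hx
  change A.m2 X Y Z i j l a.1 b.1 ∈ LinearMap.range (A.m1 X Z (l - 1) l)
  by_cases hl : l = i + j
  · have h := A.m1_m2 X Y Z (i - 1) j (l - 1) l (by omega) x b.1
    rw [A.cocycle_m1 b, map_zero, smul_zero, add_zero, show i - 1 + 1 = i by ring, hx] at h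
    exact ⟨-A.m2 X Y Z (i - 1) j (l - 1) x b.1, by rw [map_neg]; exact neg_eq_of_add_eq_zero_right h⟩
  · rw [A.m2_eq_zero hl]
    exact zero_mem _

lemma compCocycles_right_mem (X Y Z : A.Obj) (i j l : ℤ) (a : A.cocycles X Y i)
    (b : A.cocycles Y Z j) (hb : b ∈ A.coboundaries Y Z j) :
    A.compCocycles X Y Z i j l a b ∈ A.coboundaries X Z l := by
  refine units_smul_mem _ _ ?_
  obtain ⟨x, hx⟩ := hb
  change A.m1 Y Z (j - 1) j x = b.1 at hx
  change A.m2 X Y Z i j l a.1 b.1 ∈ LinearMap.range (A.m1 X Z (l - 1) l)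
  by_cases hl : l = i + j
  · have h := A.m1_m2 X Y Z i (j - 1) (l - 1) l (by omega) a.1 x
    rw [A.cocycle_m1 a, map_zero, LinearMap.zero_apply, add_zero, show j - 1 + 1 = j by ring,
      hx] at h
    have h' : (i - 1).negOnePow • A.m2 X Y Z i j l a.1 b.1 ∈
        LinearMap.range (A.m1 X Z (l - 1) l) :=
      ⟨-A.m2 X Y Z i (j - 1) (l - 1) a.1 x, by
        rw [map_neg]; exact neg_eq_of_add_eq_zero_right h⟩
    have h'' := units_smul_mem _ (i - 1).negOnePow h'
    rwa [smul_smul, Int.units_mul_self, one_smul] at h''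
  · rw [A.m2_eq_zero hl]
    exact zero_mem _

/-- The composition `Hom^i(X, Y) × Hom^j(Y, Z) → Hom^l(X, Z)`, `(a, b) ↦ b ∘ a`, where `l = i + j`
(and `0` for other values of `l`). -/
def comp (X Y Z : A.Obj) (i j l : ℤ) : A.H X Y i →ₗ[k] A.H Y Z j →ₗ[k] A.H X Z l :=
  (A.coboundaries X Y i).liftQ
    { toFun := fun a => (A.coboundaries Y Z j).mapQ (A.coboundaries X Z l)
        (A.compCocycles X Y Z i j l a) fun b hb => A.compCocycles_right_mem X Y Z i j l a b hb
      map_add' := fun a a' => by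
        ext b
        simp [map_add]
      map_smul' := fun t a => by
        ext b
        simp [map_smul] }
    (fun a ha => by
      ext b
      simpa [Submodule.Quotient.mk_eq_zero] using A.compCocycles_left_mem X Y Z i j l a ha b)

lemma comp_assoc (X Y Z W : A.Obj) (i j l p q r : ℤ) (hp : p = i + j) (hq : q = j + l)
    (a : A.H X Y i) (b : A.H Y Z j) (c : A.H Z W l) :
    A.comp X Z W p l r (A.comp X Y Z i j p a b) c =
      A.comp X Y W i q r a (A.comp Y Z W j l q b c) := by
  obtain ⟨a, rfl⟩ := Submodule.Quotient.mk_surjective _ a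
  obtain ⟨b, rfl⟩ := Submodule.Quotient.mk_surjective _ b
  obtain ⟨c, rfl⟩ := Submodule.Quotient.mk_surjective _ c
  refine (Submodule.Quotient.eq _).2 ?_
  change p.negOnePow • A.m2 X Z W p l r (i.negOnePow • A.m2 X Y Z i j p a.1 b.1) c.1 -
    i.negOnePow • A.m2 X Y W i q r a.1 (j.negOnePow • A.m2 Y Z W j l q b.1 c.1) ∈
      LinearMap.range (A.m1 X W (r - 1) r)
  by_cases hr : r = i + j + l
  · have h := A.m2_m2 X Y Z W i j l p q r hp hq a.1 b.1 c.1 a.2 b.2 c.2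
    rw [show r - 1 = i + j + l - 1 by omega, hp, Int.negOnePow_add]
    rw [hp, show (i - 1).negOnePow = -i.negOnePow by
      rw [Int.negOnePow_sub, Int.negOnePow_one, mul_neg, mul_one]] at h
    have hT : A.m1 X W (i + j + l - 1) r (A.m (.triple i j l a.1 b.1 c.1) (i + j + l - 1)) ∈
      LinearMap.range (A.m1 X W (i + j + l - 1) r) := ⟨_, rfl⟩
    rw [add_assoc] at h
    rw [eq_neg_of_add_eq_zero_left h] at hT
    have hT' := units_smul_mem _ (-j.negOnePow) hT
    convert hT' using 1
    rcases Int.units_eq_one_or i.negOnePow with hi | hi <;>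
      rcases Int.units_eq_one_or j.negOnePow with hj | hj <;>
      simp [hi, hj, Units.smul_def] <;> abel
  · rw [A.m2_eq_zero (by omega), A.m2_eq_zero (by omega)]
    simp

end AInfPrecategory

/-- An `A∞`-category: every object has a unit in cohomology. -/
structure AInfCategory (k : Type w) [Field k] extends AInfPrecategory.{w, u, v} k where
  exists_unit : ∀ X : Obj, ∃ e : toAInfPrecategory.H X X 0,
    (∀ (Y : Obj) (n : ℤ) (a : toAInfPrecategory.H X Y n),
      toAInfPrecategory.comp X X Y 0 n n e a = a) ∧
    (∀ (Y : Obj) (n : ℤ) (a : toAInfPrecategory.H Y X n),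
      toAInfPrecategory.comp Y X X n 0 n a e = a)

namespace AInfCategory

variable {k : Type w} [Field k] (A : AInfCategory.{w, u, v} k)

/-- The identity of `X` in the cohomology category. -/
noncomputable def one (X : A.Obj) : A.H X X 0 := (A.exists_unit X).choose

/-- The objects of `A`, as the objects of the category `H⁰(A)`. -/
def H0 : Type u := A.Obj

/-- The category `H⁰(A)`, in which `X ⟶ Y` is `Hom⁰(X, Y)`. -/
noncomputable instance : Category.{v} A.H0 where
  Hom X Y := A.H (X : A.Obj) (Y : A.Obj) 0
  id X := A.one X
  comp {X Y Z} f g := A.comp (X : A.Obj) (Y : A.Obj) (Z : A.Obj) 0 0 0 f g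
  id_comp {X Y} f := (A.exists_unit X).choose_spec.1 Y 0 f
  comp_id {X Y} f := (A.exists_unit Y).choose_spec.2 X 0 f
  assoc f g h := A.comp_assoc _ _ _ _ 0 0 0 0 0 0 rfl rfl f g h

noncomputable instance : Preadditive A.H0 where
  homGroup X Y := inferInstanceAs (AddCommGroup (A.H (X : A.Obj) (Y : A.Obj) 0))
  add_comp _ _ _ f f' g := LinearMap.map_add₂ (A.comp _ _ _ 0 0 0) f f' g
  comp_add _ _ _ f g g' := (A.comp _ _ _ 0 0 0 f).map_add g g'

noncomputable instance : Linear k A.H0 where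
  homModule X Y := inferInstanceAs (Module k (A.H (X : A.Obj) (Y : A.Obj) 0))
  smul_comp _ _ _ t f g := LinearMap.map_smul₂ (A.comp _ _ _ 0 0 0) t f g
  comp_smul _ _ _ f t g := (A.comp _ _ _ 0 0 0 f).map_smul t g

/-- `Y` is isomorphic to the shift `X[n]`: there is an invertible element of `Hom^{-n}(X, Y)`. -/
def IsShift (n : ℤ) (X Y : A.Obj) : Prop :=
  ∃ (a : A.H X Y (-n)) (b : A.H Y X n),
    A.comp X Y X (-n) n 0 a b = A.one X ∧ A.comp Y X Y n (-n) 0 b a = A.one Y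

/-- The data of a twisted complex `X → Y → Z` given by elements `f ∈ hom¹(X, Y)`,
`g ∈ hom¹(Y, Z)`, `h ∈ hom¹(X, Z)`, that is a zero object: the `A∞`-Maurer--Cartan equation holds
and, for every object `W`, the two complexes `hom(W, T)` and `hom(T, W)` are acyclic (each one of
the two acyclicity conditions follows from the other one).
Equivalently, there is an exact triangle `X[-1] → Y → Z[1] → X` whose first two maps are `f` and
`g`, and `Z[1]` is a mapping cone of `f : X[-1] → Y`. -/
structure IsExact {X Y Z : A.Obj} (f : A.hom X Y 1) (g : A.hom Y Z 1) (h : A.hom X Z 1) : Prop where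
  closed_f : A.m (.single 1 f) 2 = 0
  closed_g : A.m (.single 1 g) 2 = 0
  closed_h : A.m (.single 1 h) 2 + A.m (.pair 1 1 f g) 2 = 0
  acyclic_left : ∀ (W : A.Obj) (n : ℤ) (a : A.hom W X n) (b : A.hom W Y n) (c : A.hom W Z n),
    A.m (.single n a) (n + 1) = 0 →
    A.m (.single n b) (n + 1) + A.m (.pair n 1 a f) (n + 1) = 0 →
    A.m (.single n c) (n + 1) + A.m (.pair n 1 b g) (n + 1) + A.m (.pair n 1 a h) (n + 1) +
      A.m (.triple n 1 1 a f g) (n + 1) = 0 →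
    ∃ (a' : A.hom W X (n - 1)) (b' : A.hom W Y (n - 1)) (c' : A.hom W Z (n - 1)),
      A.m (.single (n - 1) a') n = a ∧
      A.m (.single (n - 1) b') n + A.m (.pair (n - 1) 1 a' f) n = b ∧
      A.m (.single (n - 1) c') n + A.m (.pair (n - 1) 1 b' g) n + A.m (.pair (n - 1) 1 a' h) n +
        A.m (.triple (n - 1) 1 1 a' f g) n = c
  acyclic_right : ∀ (W : A.Obj) (n : ℤ) (a : A.hom X W n) (b : A.hom Y W n) (c : A.hom Z W n),
    A.m (.single n c) (n + 1) = 0 →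
    A.m (.single n b) (n + 1) + A.m (.pair 1 n g c) (n + 1) = 0 →
    A.m (.single n a) (n + 1) + A.m (.pair 1 n f b) (n + 1) + A.m (.pair 1 n h c) (n + 1) +
      A.m (.triple 1 1 n f g c) (n + 1) = 0 →
    ∃ (a' : A.hom X W (n - 1)) (b' : A.hom Y W (n - 1)) (c' : A.hom Z W (n - 1)),
      A.m (.single (n - 1) c') n = c ∧
      A.m (.single (n - 1) b') n + A.m (.pair 1 (n - 1) g c') n = b ∧
      A.m (.single (n - 1) a') n + A.m (.pair 1 (n - 1) f b') n + A.m (.pair 1 (n - 1) h c') n +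
        A.m (.triple 1 1 (n - 1) f g c') n = a

/-- There is an exact triangle `X → Y → Z → X[1]`. -/
def ExactTriangle (X Y Z : A.Obj) : Prop :=
  ∃ (X' Z' : A.Obj) (f : A.hom X' Y 1) (g : A.hom Y Z' 1) (h : A.hom X' Z' 1),
    A.IsShift 1 X X' ∧ A.IsShift (-1) Z Z' ∧ A.IsExact f g h

end AInfCategory

/-- A triangulated `A∞`-category: an `A∞`-category with shifts and cones.  (Every closed element of
`hom⁰(X, Y)` amounts to a closed element of `hom¹(X[1], Y)`.) -/
structure TriangulatedAInfCategory (k : Type w) [Field k] extends AInfCategory.{w, u, v} k where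
  shift : Obj → ℤ → Obj
  isShift_shift : ∀ (X : Obj) (n : ℤ), toAInfCategory.IsShift n X (shift X n)
  exists_cone : ∀ {X Y : Obj} (f : hom X Y 1), m (.single 1 f) 2 = 0 →
    ∃ (Z : Obj) (g : hom Y Z 1) (h : hom X Z 1), toAInfCategory.IsExact f g h

namespace TriangulatedAInfCategory

variable {k : Type w} [Field k] (D : TriangulatedAInfCategory.{w, u, v} k)

/-- The full triangulated subcategory `⟨E i⟩` generated by a family of objects: the smallest class
of objects that contains the family, is closed under isomorphisms and shifts, and satisfies the
two-out-of-three property with respect to exact triangles. -/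
inductive Generated {ι : Type*} (E : ι → D.Obj) : ObjectProperty D.H0
  | of (i : ι) : Generated E (E i)
  | shift (n : ℤ) (X Y : D.Obj) : D.IsShift n X Y → Generated E X → Generated E Y
  | tri₁ (X Y Z : D.Obj) : D.ExactTriangle X Y Z → Generated E Y → Generated E Z → Generated E X
  | tri₂ (X Y Z : D.Obj) : D.ExactTriangle X Y Z → Generated E X → Generated E Z → Generated E Y
  | tri₃ (X Y Z : D.Obj) : D.ExactTriangle X Y Z → Generated E X → Generated E Y → Generated E Z

/-- An exceptional collection `E 0, …, E (n - 1)`: `Hom^*(E i, E i) = k` in degree `0`, and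
`Hom^*(E j, E i) = 0` for `i < j`. -/
structure IsExceptionalCollection {n : ℕ} (E : Fin n → D.Obj) : Prop where
  finrank_self : ∀ i, Module.finrank k (D.H (E i) (E i) 0) = 1
  self_eq_zero : ∀ i (d : ℤ), d ≠ 0 → Subsingleton (D.H (E i) (E i) d)
  eq_zero : ∀ i j (d : ℤ), i < j → Subsingleton (D.H (E j) (E i) d)

/-- `L` is the left mutation `L_C(X)` of an object `X` through a subcategory `C`: there is an exact
triangle `C' → X → L → C'[1]` with `C'` in `C` and with `L` in the right orthogonal `C^⊥`. -/
def IsLeftMutation (C : ObjectProperty D.H0) (X L : D.Obj) : Prop :=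
  (∃ C' : D.Obj, C C' ∧ D.ExactTriangle C' X L) ∧
    ∀ C' : D.Obj, C C' → ∀ n : ℤ, Subsingleton (D.H C' L n)

end TriangulatedAInfCategory

/-- A Serre functor on a `k`-linear category `C` with finite-dimensional spaces of morphisms:
an autoequivalence `S` with isomorphisms `Hom(Y, S X) ≅ Hom(X, Y)^∨`, natural in `X` and `Y`. -/
structure SerreFunctor (k : Type w) [Field k] (C : Type u) [Category.{v} C] [Preadditive C]
    [Linear k C] where
  finite_hom : ∀ X Y : C, Module.Finite k (X ⟶ Y)
  S : C ⥤ C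
  isEquivalence : S.IsEquivalence
  equiv : ∀ X Y : C, (Y ⟶ S.obj X) ≃ₗ[k] Module.Dual k (X ⟶ Y)
  naturality : ∀ {X X' Y Y' : C} (a : X' ⟶ X) (b : Y ⟶ Y') (g : Y' ⟶ S.obj X') (f : X ⟶ Y),
    equiv X Y (b ≫ g ≫ S.map a) f = equiv X' Y' g (a ≫ f ≫ b)

/-! ### `A∞`-functors and directed `A∞`-categories -/

/-- An `A∞`-functor `A → B` with a given action `φ` on objects.
For a string `c = (a₁, …, a_s)` the element `F c n` is the component in degree `n` of
`F^s(a_s, …, a_1)`, which is homogeneous of degree `∑ |aᵢ| + 1 - s`; the equations are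
`∑ μ(F(a_s, …), …, F(…, a_1)) = ∑ (-1)^{|a₁| + … + |a_r| - r} F(a_s, …, μ(…), a_r, …, a_1)`. -/
structure AInfFunctor {k : Type w} [Field k] (A B : AInfPrecategory.{w, u, v} k)
    (φ : A.Obj → B.Obj) where
  F : ∀ {X Y : A.Obj}, Chain A.hom X Y → ∀ n : ℤ, B.hom (φ X) (φ Y) n
  F_nil : ∀ (X : A.Obj) (n : ℤ), F (Chain.nil X) n = 0
  F_degree : ∀ {X Y : A.Obj} (c : Chain A.hom X Y) (n : ℤ), n ≠ c.rdeg + 1 → F c n = 0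
  F_add : ∀ {X Y Z W : A.Obj} (p : Chain A.hom X Y) (d : ℤ) (a b : A.hom Y Z d)
    (q : Chain A.hom Z W) (n : ℤ), F (p.append (.cons d (a + b) q)) n =
      F (p.append (.cons d a q)) n + F (p.append (.cons d b q)) n
  F_smul : ∀ {X Y Z W : A.Obj} (p : Chain A.hom X Y) (d : ℤ) (t : k) (a : A.hom Y Z d)
    (q : Chain A.hom Z W) (n : ℤ), F (p.append (.cons d (t • a) q)) n =
      t • F (p.append (.cons d a q)) n
  relation : ∀ {X Y : A.Obj} (c : Chain A.hom X Y) (n : ℤ),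
    ((Chain.blocks φ F (Chain.nil X) c).map fun s => B.m s n).sum =
      ((c.insertions A.m).map fun s => s.1 • F s.2 n).sum

/-- The linear part `F¹` induces isomorphisms on the cohomology of the morphism complexes. -/
def AInfFunctor.IsQuasiIso {k : Type w} [Field k] {A B : AInfPrecategory.{w, u, v} k}
    {φ : A.Obj → B.Obj} (F : AInfFunctor A B φ) : Prop :=
  ∀ (X Y : A.Obj) (n : ℤ),
    (∀ a : A.hom X Y n, A.m1 X Y n (n + 1) a = 0 →
      (∃ b, F.F (.single n a) n = B.m1 (φ X) (φ Y) (n - 1) n b) → ∃ a', a = A.m1 X Y (n - 1) n a') ∧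
    (∀ b : B.hom (φ X) (φ Y) n, B.m1 (φ X) (φ Y) n (n + 1) b = 0 →
      ∃ (a : A.hom X Y n) (b' : B.hom (φ X) (φ Y) (n - 1)), A.m1 X Y n (n + 1) a = 0 ∧
        b = F.F (.single n a) n + B.m1 (φ X) (φ Y) (n - 1) n b')

namespace AInfPrecategory

variable {k : Type w} [Field k] (A : AInfPrecategory.{w, u, v} k)

/-- `hom(X i, X j)` if `i < j`, and zero otherwise. -/
def upper {N : ℕ} (X : Fin N → A.Obj) (i j : Fin N) (n : ℤ) : Submodule k (A.hom (X i) (X j) n) where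
  carrier := {a | ¬ i < j → a = 0}
  add_mem' ha hb h := by rw [ha h, hb h, add_zero]
  zero_mem' _ := rfl
  smul_mem' t a ha h := by rw [ha h, smul_zero]

lemma m_map_upper_aux {N : ℕ} (X : Fin N → A.Obj) : ∀ {i j : Fin N}
    (c : Chain (fun i j n => A.upper X i j n) i j), ¬ i < j → 0 < c.length →
    ∀ {Y : A.Obj} (p : Chain A.hom Y (X i)) (n : ℤ),
      A.m (p.append (c.map X fun a => a.1)) n = 0
  | _, _, .nil _, _, h, _, _, _ => absurd h (lt_irrefl 0)
  | i, j, .cons (Y := l) d a c, hij, _, _, p, n => by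
      by_cases hil : i < l
      · have hlj : ¬ l < j := fun h => hij (hil.trans h)
        have hc : 0 < c.length := by
          cases c with
          | nil => exact absurd hil hij
          | cons d' a' c' => exact Nat.succ_pos _
        have := m_map_upper_aux X c hlj hc (p.append (.single d a.1)) n
        rwa [Chain.append_assoc] at this
      · have ha : a.1 = 0 := a.2 hil
        simp only [Chain.map, ha]
        exact A.m_cons_zero p d _ n

lemma m_map_upper {N : ℕ} (X : Fin N → A.Obj) {i j : Fin N}
    (c : Chain (fun i j n => A.upper X i j n) i j) (n : ℤ) :
    A.m (c.map X fun a => a.1) n ∈ A.upper X i j n := by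
  intro hij
  cases hc : c with
  | nil => exact A.m_nil _ _
  | cons d a c' =>
    exact A.m_map_upper_aux X (.cons d a c') hij (Nat.succ_pos _) (.nil _) n

/-- The directed `A∞`-category `end→(X 0, …, X (N - 1))` of a sequence of objects of an
`A∞`-category.  The morphism spaces from `i` to `j` of a directed `A∞`-category are arbitrary for
`i < j`, are spanned by a strict unit for `i = j`, and are zero for `i > j`.  As strict units
carry no information (`μ¹` and `μ^s` with `s > 2` vanish on them, and `μ²` with a unit is the
identity up to the usual sign), a directed `A∞`-category is recorded by its morphism spaces
for `i < j`, with the `A∞`-operations on these; here these spaces are `hom(X i, X j)` and the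
operations are those of the ambient category.  Similarly, strictly unital `A∞`-functors of
directed `A∞`-categories that are the identity on objects are the same as (non-unital)
`A∞`-functors between these strictly directed parts. -/
def directed {N : ℕ} (X : Fin N → A.Obj) : AInfPrecategory.{w, 0, v} k where
  Obj := Fin N
  hom i j n := A.upper X i j n
  m c n := ⟨A.m (c.map X fun a => a.1) n, A.m_map_upper X c n⟩
  m_nil i n := Subtype.ext (A.m_nil (X i) n)
  m_degree c n h := Subtype.ext (A.m_degree _ n (by rwa [Chain.rdeg_map]))
  m_add p d a b q n := Subtype.ext (by
    simp only [Chain.map_append, Chain.map]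
    exact A.m_add _ d a.1 b.1 _ n)
  m_smul p d t a q n := Subtype.ext (by
    simp only [Chain.map_append, Chain.map]
    exact A.m_smul _ d t a.1 _ n)
  relation {i j} c n := Subtype.ext (by
    have h := A.relation (c.map X fun a => a.1) n
    have e := Chain.insertions_map (hom := fun i j n => A.upper X i j n) (hom' := A.hom) X
      (fun a => a.1) (fun c n => ⟨A.m (c.map X fun a => a.1) n, A.m_map_upper X c n⟩) A.m
      (fun _ _ => rfl) c
    rw [e, List.map_map] at h
    rw [← Submodule.coe_subtype, map_list_sum, List.map_map]
    refine Eq.trans ?_ h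
    congr 2)

/-- There is an equivalence of directed `A∞`-categories
`end→(S, E 0, …, E (m - 1)) ≃ end→(T, E 0, …, E (m - 1))` that is the identity on
`end→(E 0, …, E (m - 1))`: an `A∞`-quasi-isomorphism, identical on objects, whose restriction to
the last `m` objects has the identity as linear part and has no higher components. -/
def DirectedEquivExtendingId {m : ℕ} (S T : A.Obj) (E : Fin m → A.Obj) : Prop :=
  ∃ F : AInfFunctor (A.directed (Fin.cons S E : Fin (m + 1) → A.Obj))
      (A.directed (Fin.cons T E : Fin (m + 1) → A.Obj)) (fun i => i),
    F.IsQuasiIso ∧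
    (∀ (i j : Fin m) (n : ℤ)
      (a : (A.directed (Fin.cons S E : Fin (m + 1) → A.Obj)).hom i.succ j.succ n),
      ((F.F (.single n a) n).1 : A.hom (E i) (E j) n) = a.1) ∧
    (∀ (i j : Fin m)
      (c : Chain (A.directed (Fin.cons S E : Fin (m + 1) → A.Obj)).hom i.succ j.succ) (n : ℤ),
      2 ≤ c.length → ((F.F c n).1 : A.hom (E i) (E j) n) = 0)

end AInfPrecategory
end AInf

/-!
All six conditions are translated into statements about one element of a morphism space.

*The first four conditions.*  Write `P` for the first object, `Q` for the last one, and `S` for the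
Serre dual `S_C(P)`.  The counit of the right adjoint gives `ω ∈ Hom^d(R, Q)`, with `R = ρ(Q)[d]` in
`C`, such that composing with `ω` is an isomorphism `Hom*(W, R) → Hom*(W, Q)` for all `W` in `C`.  A
linear form `φ` on `Hom^d(P, Q)` gives a linear form on `Hom⁰(P, R)`, and thus, by Serre duality, an
element `θ ∈ Hom⁰(R, S)`.  The pairing of `Hom*(P, W)` and `Hom*(W, Q)` given by `φ` is perfect
if and only if composing with `θ` is bijective on `Hom*(W, -)` (`IsSerreDual.postBij_iff_isPerfPair`).
The objects `W` for which this holds form a triangulated subcategory, so it suffices to test generators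
of `C`, and in that case `θ` is an isomorphism `R ≅ S`.  For `W = P` the pairing is perfect as soon as
`Hom*(P, Q)` is one-dimensional and concentrated in degree `d` (`IsSerreDual.postBij_self`).  As the
cone of `X → L_P(X)` is generated by `P`, the same argument compares the pairing for `X` with the one for
`L_P(X)`, where it is perfect if and only if `Hom*(L_P(X), Q) = 0`
(`IsSerreDual.isPerfPair_iff_leftMutation`).

*The fifth condition.*  As `Q` is left orthogonal to `C`, in the triangle `C' → Q → L_C(Q)` the object
`C'` is both `ρ(Q)` and `λ(L_C(Q))[-1]` (`isShift_rightAdjoint_leftAdjoint`).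

*The last condition.*  An isomorphism `λ(T) ≅ S`, with `T = L_C(Q)[d - 1]`, is the same as an element
of `Hom⁰(T, S)` that induces isomorphisms `Hom*(S, W) → Hom*(T, W)` for all `W` in `C`.  If `f` is a
closed representative of it, then the operations `(a₁, …, a_s) ↦ μ(a_s, …, a₁, f)`, on strings that
start at `S`, and the identity on the last `m` objects form an `A∞`-functor of the directed
categories (`precompFunctor`); no signs are needed, and the functor equations are the `A∞`-relations
for the strings `f, a₁, …, a_s`.  Conversely, the condition is applied to one particular collection,
namely the mutated one, `S, L_P(E₂), …, L_P(E_m)`.  In it, `S` itself is the first object, hence the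
unit of `S` is a morphism from the first to the second object of the directed category, and its image
under the linear part of the functor is the element of `Hom⁰(T, S)` that is looked for
(`exists_preBij_of_directedEquivExtendingId`).

That `S, L_P(E₂), …, L_P(E_m)` is an exceptional collection follows from Serre duality.  That it
generates `C` (`generated_update_eq`) is proved by killing morphisms: an object `Y` of `C` is replaced
by the cones of nonzero elements of `Hom*(W, Y)` or of `Hom*(Y, W)`, for an exceptional object `W`,
until there are none.  This terminates because these spaces are finite-dimensional in each degree, by
the existence of the Serre functor, and vanish in almost all degrees (`Generated.boundedHom`).
-/

namespace AInf

namespace AInfPrecategory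

variable {k : Type w} [Field k] (A : AInfPrecategory.{w, u, v} k)

/-! ### Cohomology classes and their representatives -/

/-- The operation `(a, b, c) ↦ μ³(c, b, a)`, with values in degree `n`. -/
def m3 (X Y Z W : A.Obj) (i j l n : ℤ) :
    A.hom X Y i →ₗ[k] A.hom Y Z j →ₗ[k] A.hom Z W l →ₗ[k] A.hom X W n :=
  LinearMap.mk₂ k
    (fun a b =>
      { toFun := fun c => A.m (.triple i j l a b c) n
        map_add' := fun c c' => A.m_add (.pair i j a b) l c c' (.nil W) n
        map_smul' := fun t c => A.m_smul (.pair i j a b) l t c (.nil W) n })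
    (fun a a' b => LinearMap.ext fun c => A.m_add (.nil X) i a a' (.pair j l b c) n)
    (fun t a b => LinearMap.ext fun c => A.m_smul (.nil X) i t a (.pair j l b c) n)
    (fun a b b' => LinearMap.ext fun c => A.m_add (.single i a) j b b' (.single l c) n)
    (fun t a b => LinearMap.ext fun c => A.m_smul (.single i a) j t b (.single l c) n)

variable {A}

lemma mem_cocycles {X Y : A.Obj} {n n' : ℤ} (h : n' = n + 1) {a : A.hom X Y n}
    (ha : A.m1 X Y n n' a = 0) : a ∈ A.cocycles X Y n := by
  subst h; exact ha

lemma m1_of_mem {X Y : A.Obj} {n : ℤ} {a : A.hom X Y n} (ha : a ∈ A.cocycles X Y n) (n' : ℤ) :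
    A.m1 X Y n n' a = 0 :=
  A.cocycle_m1 ⟨a, ha⟩ n'

lemma m2_mem {X Y Z : A.Obj} {i j : ℤ} (l : ℤ) {a : A.hom X Y i} {b : A.hom Y Z j}
    (ha : a ∈ A.cocycles X Y i) (hb : b ∈ A.cocycles Y Z j) :
    A.m2 X Y Z i j l a b ∈ A.cocycles X Z l :=
  A.m2_mem_cocycles X Y Z i j l ⟨a, ha⟩ ⟨b, hb⟩

/-- The class in cohomology of a closed element. -/
def cls {X Y : A.Obj} {n : ℤ} (a : A.hom X Y n) (ha : a ∈ A.cocycles X Y n) : A.H X Y n :=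
  Submodule.Quotient.mk ⟨a, ha⟩

lemma exists_cls {X Y : A.Obj} {n : ℤ} (x : A.H X Y n) :
    ∃ (a : A.hom X Y n) (ha : a ∈ A.cocycles X Y n), cls a ha = x := by
  obtain ⟨⟨a, ha⟩, rfl⟩ := Submodule.Quotient.mk_surjective _ x
  exact ⟨a, ha, rfl⟩

lemma cls_eq_zero_iff {X Y : A.Obj} {p n : ℤ} (h : n = p + 1) {a : A.hom X Y n}
    {ha : a ∈ A.cocycles X Y n} : cls a ha = 0 ↔ ∃ x, A.m1 X Y p n x = a := by
  obtain rfl : p = n - 1 := by omega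
  exact Submodule.Quotient.mk_eq_zero _

lemma cls_eq_cls_iff {X Y : A.Obj} {p n : ℤ} (h : n = p + 1) {a b : A.hom X Y n}
    {ha : a ∈ A.cocycles X Y n} {hb : b ∈ A.cocycles X Y n} :
    cls a ha = cls b hb ↔ ∃ x, A.m1 X Y p n x = a - b := by
  rw [← sub_eq_zero]
  exact cls_eq_zero_iff (ha := Submodule.sub_mem _ ha hb) h

lemma cls_smul {X Y : A.Obj} {n : ℤ} (t : k) {a : A.hom X Y n} (ha : a ∈ A.cocycles X Y n) :
    cls (t • a) (Submodule.smul_mem _ t ha) = t • cls a ha := rfl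

lemma comp_cls {X Y Z : A.Obj} {i j l : ℤ} {a : A.hom X Y i} {b : A.hom Y Z j}
    (ha : a ∈ A.cocycles X Y i) (hb : b ∈ A.cocycles Y Z j) :
    A.comp X Y Z i j l (cls a ha) (cls b hb) =
      i.negOnePow • cls (A.m2 X Y Z i j l a b) (m2_mem l ha hb) := rfl

lemma comp_cls_eq_zero_iff {X Y Z : A.Obj} {i j l p : ℤ} (h : l = p + 1) {a : A.hom X Y i}
    {b : A.hom Y Z j} (ha : a ∈ A.cocycles X Y i) (hb : b ∈ A.cocycles Y Z j) :
    A.comp X Y Z i j l (cls a ha) (cls b hb) = 0 ↔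
      ∃ x, A.m1 X Z p l x = A.m2 X Y Z i j l a b := by
  rw [comp_cls, smul_eq_zero_iff_eq]
  exact cls_eq_zero_iff h

/-- Composition in cohomology is, up to a sign, the operation `μ²` on representatives. -/
lemma exists_unit_comp_cls {X Y Z : A.Obj} (i j l : ℤ) :
    ∃ s : k, s * s = 1 ∧ ∀ (a : A.hom X Y i) (b : A.hom Y Z j) (ha : a ∈ A.cocycles X Y i)
      (hb : b ∈ A.cocycles Y Z j),
      A.comp X Y Z i j l (cls a ha) (cls b hb) =
        s • cls (A.m2 X Y Z i j l a b) (m2_mem l ha hb) := by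
  rcases Int.units_eq_one_or i.negOnePow with h | h
  · exact ⟨1, by simp, fun a b ha hb => by rw [comp_cls, h, one_smul, one_smul]⟩
  · exact ⟨-1, by simp, fun a b ha hb => by
      rw [comp_cls, h, Units.neg_smul, neg_smul, one_smul, one_smul]⟩

end AInfPrecategory

namespace AInfCategory

open AInfPrecategory

variable {k : Type w} [Field k] {A : AInfCategory.{w, u, v} k}

/-! ### Invertible elements of the graded cohomology category -/

lemma one_comp {X Y : A.Obj} {n : ℤ} (a : A.H X Y n) : A.comp X X Y 0 n n (A.one X) a = a :=
  (A.exists_unit X).choose_spec.1 Y n a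

lemma comp_one {X Y : A.Obj} {n : ℤ} (a : A.H X Y n) : A.comp X Y Y n 0 n a (A.one Y) = a :=
  (A.exists_unit Y).choose_spec.2 X n a

/-- `a` and `b` are inverse to each other in the graded cohomology category. -/
structure IsInvPair {X Y : A.Obj} {i j : ℤ} (a : A.H X Y i) (b : A.H Y X j) : Prop where
  deg : i + j = 0
  hom_inv : A.comp X Y X i j 0 a b = A.one X
  inv_hom : A.comp Y X Y j i 0 b a = A.one Y

namespace IsInvPair

variable {X Y W : A.Obj} {i j : ℤ} {a : A.H X Y i} {b : A.H Y X j}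

lemma symm (h : IsInvPair a b) : IsInvPair b a :=
  ⟨by rw [add_comm, h.deg], h.inv_hom, h.hom_inv⟩

lemma isShift (h : IsInvPair a b) : A.IsShift j X Y := by
  obtain rfl : i = -j := by have := h.deg; omega
  exact ⟨a, b, h.hom_inv, h.inv_hom⟩

lemma comp_comp_left (h : IsInvPair a b) {p l : ℤ} (hl : p + i = l) (x : A.H W X p) :
    A.comp W Y X l j p (A.comp W X Y p i l x a) b = x := by
  rw [A.comp_assoc _ _ _ _ p i j l 0 p hl.symm h.deg.symm, h.hom_inv, comp_one]

lemma comp_comp_right (h : IsInvPair a b) {p l : ℤ} (hl : j + p = l) (x : A.H X W p) :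
    A.comp X Y W i l p a (A.comp Y X W j p l b x) = x := by
  rw [← A.comp_assoc _ _ _ _ i j p 0 l p h.deg.symm hl.symm, h.hom_inv, one_comp]

/-- Composition with an invertible element, after a given element. -/
lemma bijective_comp_right (h : IsInvPair a b) (W : A.Obj) {p l : ℤ} (hl : p + i = l) :
    Function.Bijective fun x : A.H W X p => A.comp W X Y p i l x a :=
  have hd := h.deg
  Function.bijective_iff_has_inverse.2 ⟨fun y => A.comp W Y X l j p y b,
    fun x => h.comp_comp_left hl x, fun y => h.symm.comp_comp_left (by omega) y⟩

/-- Composition with an invertible element, before a given element. -/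
lemma bijective_comp_left (h : IsInvPair a b) (W : A.Obj) {p l : ℤ} (hl : i + p = l) :
    Function.Bijective fun y : A.H Y W p => A.comp X Y W i p l a y :=
  have hd := h.deg
  Function.bijective_iff_has_inverse.2 ⟨fun x => A.comp Y X W j l p b x,
    fun y => h.symm.comp_comp_right hl y, fun x => h.comp_comp_right (by omega) x⟩

lemma trans {Z : A.Obj} {i' j' : ℤ} {a' : A.H Y Z i'} {b' : A.H Z Y j'} (h : IsInvPair a b)
    (h' : IsInvPair a' b') {p q : ℤ} (hp : i + i' = p) (hq : j' + j = q) :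
    IsInvPair (A.comp X Y Z i i' p a a') (A.comp Z Y X j' j q b' b) := by
  have hd := h.deg
  have hd' := h'.deg
  refine ⟨by omega, ?_, ?_⟩
  · rw [A.comp_assoc _ _ _ _ i i' q p j 0 hp.symm (by omega), h'.comp_comp_right hq, h.hom_inv]
  · rw [A.comp_assoc _ _ _ _ j' j p q i' 0 hq.symm (by omega), h.symm.comp_comp_right hp,
      h'.inv_hom]

end IsInvPair

/-- An element which is invertible from both sides is invertible. -/
lemma exists_isInvPair_of_bijective {X Y : A.Obj} {i j : ℤ} (hij : i + j = 0) (a : A.H X Y i)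
    (hX : Function.Injective fun x : A.H X X 0 => A.comp X X Y 0 i i x a)
    (hY : Function.Surjective fun x : A.H Y X j => A.comp Y X Y j i 0 x a) :
    ∃ b : A.H Y X j, IsInvPair a b := by
  obtain ⟨b, hb⟩ := hY (A.one Y)
  refine ⟨b, hij, hX ?_, hb⟩
  change A.comp X X Y 0 i i _ a = A.comp X X Y 0 i i _ a
  rw [A.comp_assoc _ _ _ _ i j i 0 0 i hij.symm (by omega), one_comp]
  exact (congrArg _ hb).trans (comp_one a)

lemma IsShift.exists_isInvPair {n : ℤ} {X Y : A.Obj} (h : A.IsShift n X Y) :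
    ∃ (a : A.H X Y (-n)) (b : A.H Y X n), IsInvPair a b :=
  let ⟨a, b, h₁, h₂⟩ := h
  ⟨a, b, neg_add_cancel n, h₁, h₂⟩

lemma isInvPair_one (X : A.Obj) : IsInvPair (A.one X) (A.one X) :=
  ⟨rfl, one_comp _, one_comp _⟩

lemma IsShift.symm {n : ℤ} {X Y : A.Obj} (h : A.IsShift n X Y) : A.IsShift (-n) Y X :=
  let ⟨_, _, h⟩ := h.exists_isInvPair
  h.symm.isShift

lemma IsShift.trans {n n' l : ℤ} {X Y Z : A.Obj} (h : A.IsShift n X Y) (h' : A.IsShift n' Y Z)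
    (hl : n + n' = l) : A.IsShift l X Z :=
  let ⟨_, _, h⟩ := h.exists_isInvPair
  let ⟨_, _, h'⟩ := h'.exists_isInvPair
  (h.trans h' rfl (by omega : n' + n = l)).isShift

lemma IsShift.subsingleton_left {n : ℤ} {X Y : A.Obj} (h : A.IsShift n X Y) {W : A.Obj} {p l : ℤ}
    (hl : p + n = l) (hX : Subsingleton (A.H X W p)) : Subsingleton (A.H Y W l) :=
  let ⟨_, _, h⟩ := h.exists_isInvPair
  (h.symm.bijective_comp_left W (by omega : n + p = l)).surjective.subsingleton

lemma IsShift.subsingleton_right {n : ℤ} {X Y : A.Obj} (h : A.IsShift n X Y) {W : A.Obj} {p l : ℤ}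
    (hl : p - n = l) (hX : Subsingleton (A.H W X p)) : Subsingleton (A.H W Y l) :=
  let ⟨_, _, h⟩ := h.exists_isInvPair
  (h.bijective_comp_right W (by omega : p + -n = l)).surjective.subsingleton

/-- An object whose unit vanishes is a zero object. -/
lemma one_eq_zero_iff {X : A.Obj} : A.one X = 0 ↔ ∀ (W : A.Obj) (n : ℤ), Subsingleton (A.H X W n) := by
  refine ⟨fun h W n => subsingleton_of_forall_eq 0 fun x => ?_, fun h => ?_⟩
  · rw [← one_comp x, h, map_zero, LinearMap.zero_apply]
  · have := h X 0
    exact Subsingleton.elim _ _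

lemma one_ne_zero_of_finrank {X : A.Obj} (h : Module.finrank k (A.H X X 0) = 1) : A.one X ≠ 0 :=
  fun e => by
    have := one_eq_zero_iff.1 e X 0
    rw [Module.finrank_zero_of_subsingleton] at h
    exact zero_ne_one h

end AInfCategory

/-! ### The `A∞`-relations for short strings -/

namespace AInfPrecategory

variable {k : Type w} [Field k] (A : AInfPrecategory.{w, u, v} k)

/-- The `A∞`-relation for two elements, with the degrees of the intermediate terms as variables. -/
lemma rel_two (X Y Z : A.Obj) {i j i' j' l : ℤ} (l' : ℤ) (hi : i' = i + 1) (hj : j' = j + 1)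
    (hl : l = i + j) (a : A.hom X Y i) (b : A.hom Y Z j) :
    A.m1 X Z l l' (A.m2 X Y Z i j l a b) + A.m2 X Y Z i' j l' (A.m1 X Y i i' a) b +
      (i - 1).negOnePow • A.m2 X Y Z i j' l' a (A.m1 Y Z j j' b) = 0 := by
  subst hi hj
  exact A.m1_m2 X Y Z i j l l' hl a b

/-- The `A∞`-relation for three elements, which need not be closed. -/
lemma rel_three (X Y Z W : A.Obj) {i j l i' j' l' p q r : ℤ} (r' : ℤ) (hi : i' = i + 1)
    (hj : j' = j + 1) (hl : l' = l + 1) (hp : p = i + j) (hq : q = j + l) (hr : r = i + j + l - 1)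
    (a : A.hom X Y i) (b : A.hom Y Z j) (c : A.hom Z W l) :
    A.m1 X W r r' (A.m3 X Y Z W i j l r a b c) +
      A.m2 X Z W p l r' (A.m2 X Y Z i j p a b) c +
      (i - 1).negOnePow • A.m2 X Y W i q r' a (A.m2 Y Z W j l q b c) +
      A.m3 X Y Z W i' j l r' (A.m1 X Y i i' a) b c +
      (i - 1).negOnePow • A.m3 X Y Z W i j' l r' a (A.m1 Y Z j j' b) c +
      (i - 1 + (j - 1)).negOnePow • A.m3 X Y Z W i j l' r' a b (A.m1 Z W l l' c) = 0 := by
  subst hi hj hl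
  have h := A.relation (.triple i j l a b c) r'
  simp only [Chain.insertions, Chain.splits, Chain.triple, Chain.append, Chain.rdeg, A.m_nil,
      List.map_cons, List.map_nil, List.flatMap_cons, List.flatMap_nil, List.cons_append,
      List.nil_append, List.sum_cons, List.sum_nil, m_zero₀, m_zero₁, m_zero₂, m_zero₃, smul_zero,
      zero_add, add_zero, Int.negOnePow_zero, one_smul] at h
  rw [show i - 1 + 0 + 2 = i + 1 by ring, show j - 1 + 0 + 2 = j + 1 by ring,
    show l - 1 + 0 + 2 = l + 1 by ring, show i - 1 + (j - 1 + 0) + 2 = p by rw [hp]; ring,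
    show j - 1 + (l - 1 + 0) + 2 = q by rw [hq]; ring,
    show i - 1 + (j - 1 + (l - 1 + 0)) + 2 = r by rw [hr]; ring] at h
  rw [← h]
  simp only [m1, m2, m3, LinearMap.mk₂_apply, LinearMap.coe_mk, AddHom.coe_mk, Chain.single,
    Chain.pair, Chain.triple]
  abel

/-- The `A∞`-relation for four closed elements, the first two of which have degree `1`. -/
lemma rel_four (X Y Z W V : A.Obj) {l t p q r s r₁ : ℤ} (r' : ℤ) (hp : p = 1 + l) (hq : q = l + t)
    (hr₁ : r₁ = 1 + l + t - 1) (hs : s = 1 + 1 + l - 1) (hr : r = l + t)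
    (a : A.hom X Y 1) (b : A.hom Y Z 1) (c : A.hom Z W l) (d : A.hom W V t)
    (ha : a ∈ A.cocycles X Y 1) (hb : b ∈ A.cocycles Y Z 1) (hc : c ∈ A.cocycles Z W l)
    (hd : d ∈ A.cocycles W V t) :
    A.m1 X V r r' (A.m (.cons 1 a (.triple 1 l t b c d)) r) +
      A.m2 X W V s t r' (A.m3 X Y Z W 1 1 l s a b c) d +
      A.m2 X Y V 1 r₁ r' a (A.m3 Y Z W V 1 l t r₁ b c d) +
      A.m3 X Z W V 2 l t r' (A.m2 X Y Z 1 1 2 a b) c d +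
      A.m3 X Y W V 1 p t r' a (A.m2 Y Z W 1 l p b c) d +
      A.m3 X Y Z V 1 1 q r' a b (A.m2 Z W V l t q c d) = 0 := by
  have h := A.relation (.cons 1 a (.triple 1 l t b c d)) r'
  have z4 : ∀ {X₁ X₂ X₃ X₄ X₅ X₆ X₇ : A.Obj} (d e f g i : ℤ) (a : A.hom X₁ X₂ d)
      (b : A.hom X₂ X₃ e) (c : A.hom X₃ X₄ f) (d' : A.hom X₄ X₅ g) (q : Chain A.hom X₆ X₇) (n : ℤ),
      A.m (.cons d a (.cons e b (.cons f c (.cons g d' (.cons i (0 : A.hom X₅ X₆ i) q))))) n = 0 :=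
    fun d e f g i a b c d' q n =>
      A.m_cons_zero (.cons d a (.cons e b (.cons f c (.single g d')))) i q n
  simp only [Chain.insertions, Chain.splits, Chain.triple, Chain.append, Chain.rdeg, A.m_nil,
      List.map_cons, List.map_nil, List.flatMap_cons, List.flatMap_nil, List.cons_append,
      List.nil_append, List.sum_cons, List.sum_nil, m_zero₀, m_zero₁, m_zero₂, m_zero₃, z4,
      smul_zero, zero_add, add_zero, Int.negOnePow_zero, one_smul] at h
  have ha' : ∀ n, A.m (.cons 1 a (.nil Y)) n = 0 := m1_of_mem ha
  have hb' : ∀ n, A.m (.cons 1 b (.nil Z)) n = 0 := m1_of_mem hb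
  have hc' : ∀ n, A.m (.cons l c (.nil W)) n = 0 := m1_of_mem hc
  have hd' : ∀ n, A.m (.cons t d (.nil V)) n = 0 := m1_of_mem hd
  simp only [ha', hb', hc', hd', m_zero₀, m_zero₁, m_zero₂, m_zero₃, smul_zero, zero_add,
    add_zero] at h
  rw [show (1 : ℤ) - 1 + (1 - 1 + 0) + 2 = 2 by ring,
    show 1 - 1 + (1 - 1 + (l - 1 + 0)) + 2 = s by omega,
    show 1 - 1 + (1 - 1 + (l - 1 + (t - 1 + 0))) + 2 = r by omega,
    show 1 - 1 + (l - 1 + 0) + 2 = p by omega,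
    show 1 - 1 + (l - 1 + (t - 1 + 0)) + 2 = r₁ by omega,
    show l - 1 + (t - 1 + 0) + 2 = q by omega] at h
  rw [← h]
  simp only [m1, m2, m3, LinearMap.mk₂_apply, LinearMap.coe_mk, AddHom.coe_mk, Chain.single,
    Chain.pair, Chain.triple]
  rw [show (1 : ℤ) - 1 + (1 - 1) = 0 by ring, Int.negOnePow_zero, one_smul, sub_self,
    Int.negOnePow_zero, one_smul, one_smul]
  abel

end AInfPrecategory

namespace AInfCategory

open AInfPrecategory

variable {k : Type w} [Field k] {A : AInfCategory.{w, u, v} k}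

namespace IsExact

variable {X Y Z : A.Obj} {f : A.hom X Y 1} {g : A.hom Y Z 1} {h : A.hom X Z 1}
  (hx : A.IsExact f g h)

include hx

lemma left_mem : f ∈ A.cocycles X Y 1 := hx.closed_f

lemma right_mem : g ∈ A.cocycles Y Z 1 := hx.closed_g

lemma m1_third : A.m1 X Z 1 2 h + A.m2 X Y Z 1 1 2 f g = 0 := hx.closed_h

/-- The complex of morphisms from `W` to the twisted complex given by `f`, `g`, `h` is acyclic. -/
lemma exists_left {W : A.Obj} {p n q : ℤ} (hn : n = p + 1) (hq : q = n + 1) (a : A.hom W X n)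
    (b : A.hom W Y n) (c : A.hom W Z n) (ha : A.m1 W X n q a = 0)
    (hb : A.m1 W Y n q b + A.m2 W X Y n 1 q a f = 0)
    (hc : A.m1 W Z n q c + A.m2 W Y Z n 1 q b g + A.m2 W X Z n 1 q a h +
      A.m3 W X Y Z n 1 1 q a f g = 0) :
    ∃ (a' : A.hom W X p) (b' : A.hom W Y p) (c' : A.hom W Z p),
      A.m1 W X p n a' = a ∧ A.m1 W Y p n b' + A.m2 W X Y p 1 n a' f = b ∧
      A.m1 W Z p n c' + A.m2 W Y Z p 1 n b' g + A.m2 W X Z p 1 n a' h +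
        A.m3 W X Y Z p 1 1 n a' f g = c := by
  obtain rfl : p = n - 1 := by omega
  subst hq
  exact hx.acyclic_left W n a b c ha hb hc

/-- The complex of morphisms from the twisted complex given by `f`, `g`, `h` to `W` is acyclic. -/
lemma exists_right {W : A.Obj} {p n q : ℤ} (hn : n = p + 1) (hq : q = n + 1) (a : A.hom X W n)
    (b : A.hom Y W n) (c : A.hom Z W n) (hc : A.m1 Z W n q c = 0)
    (hb : A.m1 Y W n q b + A.m2 Y Z W 1 n q g c = 0)
    (ha : A.m1 X W n q a + A.m2 X Y W 1 n q f b + A.m2 X Z W 1 n q h c +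
      A.m3 X Y Z W 1 1 n q f g c = 0) :
    ∃ (a' : A.hom X W p) (b' : A.hom Y W p) (c' : A.hom Z W p),
      A.m1 Z W p n c' = c ∧ A.m1 Y W p n b' + A.m2 Y Z W 1 p n g c' = b ∧
      A.m1 X W p n a' + A.m2 X Y W 1 p n f b' + A.m2 X Z W 1 p n h c' +
        A.m3 X Y Z W 1 1 p n f g c' = a := by
  obtain rfl : p = n - 1 := by omega
  subst hq
  exact hx.acyclic_right W n a b c hc hb ha

/-! ### Exactness of the covariant functors `Hom^*(W, -)` -/

lemma comp_eq_zero (l : ℤ) : A.comp X Y Z 1 1 l (cls f hx.left_mem) (cls g hx.right_mem) = 0 := by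
  by_cases hl : l = 2
  · subst hl
    refine (comp_cls_eq_zero_iff (p := 1) (by omega) _ _).2 ⟨-h, ?_⟩
    rw [map_neg]
    exact neg_eq_of_add_eq_zero_right hx.m1_third
  · rw [comp_cls, smul_eq_zero_iff_eq]
    refine (cls_eq_zero_iff (p := l - 1) (by omega)).2 ⟨0, ?_⟩
    rw [map_zero, A.m2_eq_zero (by omega)]

/-- Exactness of `Hom^*(W, -)` at the middle term. -/
lemma exists_comp_left_eq {W : A.Obj} {p n q : ℤ} (hn : n = p + 1) (hq : q = n + 1) (b : A.H W Y n)
    (hb : A.comp W Y Z n 1 q b (cls g hx.right_mem) = 0) :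
    ∃ a : A.H W X p, A.comp W X Y p 1 n a (cls f hx.left_mem) = b := by
  obtain ⟨b, hb', rfl⟩ := exists_cls b
  obtain ⟨c, hc⟩ := (comp_cls_eq_zero_iff hq _ _).1 hb
  obtain ⟨a', b', c', h₁, h₂, -⟩ := hx.exists_left hn hq 0 b (-c) (map_zero _)
    (by rw [m1_of_mem hb']; simp) (by rw [map_neg, hc]; simp)
  obtain ⟨s, hs, e⟩ := exists_unit_comp_cls (A := A.toAInfPrecategory) (X := W) (Y := X) (Z := Y) p 1 n
  have ha' : a' ∈ A.cocycles W X p := mem_cocycles hn h₁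
  refine ⟨s • cls a' ha', ?_⟩
  rw [map_smul, LinearMap.smul_apply, e, smul_smul, hs, one_smul, cls_eq_cls_iff hn]
  exact ⟨-b', by rw [map_neg, ← h₂]; abel⟩

/-- If `f` induces an injection on `Hom^*(W, -)`, then `g` induces a surjection. -/
lemma exists_comp_right_eq {W : A.Obj} {p n : ℤ} (hn : n = p + 1)
    (hf : ∀ a : A.H W X p, A.comp W X Y p 1 n a (cls f hx.left_mem) = 0 → a = 0) (c : A.H W Z n) :
    ∃ b : A.H W Y p, A.comp W Y Z p 1 n b (cls g hx.right_mem) = c := by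
  obtain ⟨c, hc, rfl⟩ := exists_cls c
  obtain ⟨a', b', c', h₁, h₂, h₃⟩ := hx.exists_left hn rfl 0 0 c (map_zero _) (by simp)
    (by rw [m1_of_mem hc]; simp)
  have ha' : a' ∈ A.cocycles W X p := mem_cocycles hn h₁
  have h0 := hf (cls a' ha') ((comp_cls_eq_zero_iff hn _ _).2
    ⟨-b', by rw [map_neg]; exact neg_eq_of_add_eq_zero_right h₂⟩)
  obtain ⟨x, rfl⟩ := (cls_eq_zero_iff (p := p - 1) (by omega)).1 h0
  have r₁ := A.rel_two W X Y (i := p - 1) (i' := p) (l := p) n (by omega) rfl (by omega) x f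
  have r₂ := A.rel_two W X Z (i := p - 1) (i' := p) (l := p) n (by omega) (show (2 : ℤ) = 1 + 1 from rfl) (by omega) x h
  have r₃ := A.rel_three W X Y Z (i := p - 1) (i' := p) (p := p) (q := 2) (r := p) n (by omega)
    rfl rfl (by omega) rfl (by omega) x f g
  rw [m1_of_mem hx.left_mem, map_zero, smul_zero, add_zero] at r₁
  rw [m1_of_mem hx.left_mem, m1_of_mem hx.right_mem, map_zero, map_zero, LinearMap.zero_apply,
    smul_zero, smul_zero, add_zero, add_zero] at r₃
  have hh : A.m2 X Y Z 1 1 2 f g = - A.m1 X Z 1 2 h := eq_neg_of_add_eq_zero_right hx.m1_third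
  rw [hh, map_neg, smul_neg] at r₃
  have hb'' : b' - A.m2 W X Y (p - 1) 1 p x f ∈ A.cocycles W Y p := by
    refine mem_cocycles hn ?_
    rw [map_sub, eq_neg_of_add_eq_zero_left h₂, eq_neg_of_add_eq_zero_left r₁]
    abel
  obtain ⟨s, hs, e⟩ := exists_unit_comp_cls (A := A.toAInfPrecategory) (X := W) (Y := Y) (Z := Z) p 1 n
  refine ⟨s • cls _ hb'', ?_⟩
  rw [map_smul, LinearMap.smul_apply, e, smul_smul, hs, one_smul, cls_eq_cls_iff hn]
  refine ⟨-c' + A.m2 W X Z (p - 1) 1 p x h + A.m3 W X Y Z (p - 1) 1 1 p x f g, ?_⟩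
  rw [map_add, map_add, map_neg, map_sub, LinearMap.sub_apply, ← h₃]
  linear_combination (norm := abel) r₂ + r₃

/-- If `Hom^*(W, Z)` vanishes, then `f` induces an injection on `Hom^*(W, -)`. -/
lemma eq_zero_of_comp_left_eq_zero {W : A.Obj} {n q : ℤ} (hq : q = n + 1)
    (hZ : Subsingleton (A.H W Z q)) (a : A.H W X n)
    (ha : A.comp W X Y n 1 q a (cls f hx.left_mem) = 0) : a = 0 := by
  obtain ⟨a, ha', rfl⟩ := exists_cls a
  obtain ⟨b, hb⟩ := (comp_cls_eq_zero_iff hq _ _).1 ha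
  have r₁ := A.rel_two W Y Z (i := n) (i' := q) (l := q) (q + 1) hq rfl hq b g
  have r₂ := A.rel_two W X Z (i := n) (i' := q) (l := q) (q + 1) hq (show (2 : ℤ) = 1 + 1 from rfl) hq a h
  have r₃ := A.rel_three W X Y Z (i := n) (i' := q) (p := q) (q := 2) (r := q) (q + 1) hq
    rfl rfl hq rfl (by omega) a f g
  rw [m1_of_mem hx.right_mem, map_zero, smul_zero, add_zero, hb] at r₁
  rw [m1_of_mem hx.left_mem, m1_of_mem hx.right_mem, m1_of_mem ha'] at r₃
  simp only [map_zero, LinearMap.zero_apply, smul_zero, add_zero] at r₃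
  rw [m1_of_mem ha', map_zero, LinearMap.zero_apply, add_zero] at r₂
  have hh : A.m2 X Y Z 1 1 2 f g = - A.m1 X Z 1 2 h := eq_neg_of_add_eq_zero_right hx.m1_third
  rw [hh, map_neg, smul_neg] at r₃
  have hγ : - A.m2 W Y Z n 1 q b g + A.m2 W X Z n 1 q a h + A.m3 W X Y Z n 1 1 q a f g ∈
      A.cocycles W Z q := by
    refine mem_cocycles rfl ?_
    rw [map_add, map_add, map_neg]
    linear_combination (norm := abel) r₂ + r₃ - r₁
  obtain ⟨c, hc⟩ := (cls_eq_zero_iff (ha := hγ) hq).1 (hZ.elim _ _)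
  obtain ⟨a', -, -, h₁, -⟩ := hx.exists_left (p := n - 1) (by omega) hq a (-b) (-c)
    (m1_of_mem ha' _) (by rw [map_neg, hb]; abel)
    (by rw [map_neg, hc, map_neg, LinearMap.neg_apply]; abel)
  exact (cls_eq_zero_iff (p := n - 1) (by omega)).2 ⟨a', h₁⟩

end IsExact

end AInfCategory

namespace AInfCategory

open AInfPrecategory

variable {k : Type w} [Field k] {A : AInfCategory.{w, u, v} k}

namespace IsExact

variable {X Y Z : A.Obj} {f : A.hom X Y 1} {g : A.hom Y Z 1} {h : A.hom X Z 1}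
  (hx : A.IsExact f g h)

include hx

/-! ### Exactness of the contravariant functors `Hom^*(-, W)` -/

/-- Exactness of `Hom^*(-, W)` at the middle term. -/
lemma exists_comp_right_eq' {W : A.Obj} {p n q : ℤ} (hn : n = p + 1) (hq : q = n + 1)
    (b : A.H Y W n) (hb : A.comp X Y W 1 n q (cls f hx.left_mem) b = 0) :
    ∃ c : A.H Z W p, A.comp Y Z W 1 p n (cls g hx.right_mem) c = b := by
  obtain ⟨b, hb', rfl⟩ := exists_cls b
  obtain ⟨a, ha⟩ := (comp_cls_eq_zero_iff hq _ _).1 hb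
  obtain ⟨a', b', c', h₁, h₂, -⟩ := hx.exists_right hn hq (-a) b 0 (map_zero _)
    (by rw [m1_of_mem hb']; simp) (by rw [map_neg, ha]; simp)
  obtain ⟨s, hs, e⟩ := exists_unit_comp_cls (A := A.toAInfPrecategory) (X := Y) (Y := Z) (Z := W) 1 p n
  have hc' : c' ∈ A.cocycles Z W p := mem_cocycles hn h₁
  refine ⟨s • cls c' hc', ?_⟩
  rw [map_smul, e, smul_smul, hs, one_smul, cls_eq_cls_iff hn]
  exact ⟨-b', by rw [map_neg, ← h₂]; abel⟩

/-- The connecting element of an exact triangle, on representatives: the twisted complex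
`X → Y → Z` being acyclic, the unit of `X` is the boundary of an element `(a₀, b₀, k₀)` of
`hom(X, X) ⊕ hom(Y, X) ⊕ hom(Z, X)`, and the product of this element with a closed element `p`
has boundary `-p`, after a modification of its first component. -/
lemma exists_connecting_cocycle : ∃ k₀ ∈ A.cocycles Z X (-1),
    (∃ b₀, A.m1 Y X (-1) 0 b₀ + A.m2 Y Z X 1 (-1) 0 g k₀ = 0) ∧
    ∀ {W : A.Obj} {t n : ℤ}, n = t + 1 → ∀ p ∈ A.cocycles X W n,
      ∃ (va : A.hom X W t) (vb : A.hom Y W t),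
        A.m1 Y W t n vb + A.m2 Y Z W 1 t n g (A.m2 Z X W (-1) n t k₀ p) = 0 ∧
        A.m1 X W t n va + A.m2 X Y W 1 t n f vb + A.m2 X Z W 1 t n h (A.m2 Z X W (-1) n t k₀ p) +
          A.m3 X Y Z W 1 1 t n f g (A.m2 Z X W (-1) n t k₀ p) = -p := by
  obtain ⟨e, he, he'⟩ := exists_cls (A.one X)
  obtain ⟨a₀, b₀, k₀, h₁, h₂, h₃⟩ := hx.exists_right (p := -1) (q := 1) (by omega) (by omega) e 0 0
    (map_zero _) (by simp) (by rw [m1_of_mem he]; simp)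
  have hk : k₀ ∈ A.cocycles Z X (-1) := mem_cocycles (by omega) h₁
  have hf := hx.left_mem
  have hg := hx.right_mem
  refine ⟨k₀, hk, ⟨b₀, h₂⟩, ?_⟩
  intro W t n hn p hp
  -- the product with the unit `e` is the identity up to a boundary
  obtain ⟨y, hy⟩ : ∃ y, A.m1 X W t n y = A.m2 X X W 0 n n e p - p := by
    refine (cls_eq_cls_iff hn (ha := m2_mem n he hp) (hb := hp)).1 ?_
    have := one_comp (cls p hp)
    rwa [← he', comp_cls, Int.negOnePow_zero, one_smul] at this
  have r₁ := A.rel_two Y X W (i := -1) (i' := 0) (l := t) n (by omega) rfl (by omega) b₀ p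
  have r₂ := A.rel_three Y Z X W (i := 1) (j' := 0) (p := 0) (q := t) (r := t) n rfl (by omega) rfl
    (by omega) (by omega) (by omega) g k₀ p
  have r₃ := A.rel_two X X W (i := -1) (i' := 0) (l := t) n (by omega) rfl (by omega) a₀ p
  have r₄ := A.rel_three X Y X W (i := 1) (j' := 0) (p := 0) (q := t) (r := t) n rfl (by omega) rfl
    (by omega) (by omega) (by omega) f b₀ p
  have r₅ := A.rel_three X Z X W (i := 1) (i' := 2) (j' := 0) (p := 0) (q := t) (r := t) n rfl
    (by omega) rfl (by omega) (by omega) (by omega) h k₀ p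
  have r₆ := A.rel_four X Y Z X W (p := 0) (q := t) (r := t) (s := 0) (r₁ := t) n (by omega)
    (by omega) (by omega) (by omega) (by omega) f g k₀ p hf hg hk hp
  simp only [m1_of_mem hp, m1_of_mem hk, m1_of_mem hf, m1_of_mem hg, map_zero, sub_self,
    LinearMap.zero_apply, smul_zero, add_zero, Int.negOnePow_zero, one_smul] at r₁ r₂ r₃ r₄ r₅ r₆
  have hh : A.m2 X Y Z 1 1 2 f g = - A.m1 X Z 1 2 h := eq_neg_of_add_eq_zero_right hx.m1_third
  have hb₀ : A.m1 Y X (-1) 0 b₀ = - A.m2 Y Z X 1 (-1) 0 g k₀ := eq_neg_of_add_eq_zero_left h₂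
  have ha₀ : A.m1 X X (-1) 0 a₀ = e - A.m2 X Y X 1 (-1) 0 f b₀ - A.m2 X Z X 1 (-1) 0 h k₀ -
      A.m3 X Y Z X 1 1 (-1) 0 f g k₀ := by rw [← h₃]; abel
  rw [hb₀, map_neg, LinearMap.neg_apply] at r₁
  rw [hb₀, map_neg, LinearMap.neg_apply] at r₄
  rw [ha₀, map_sub, map_sub, map_sub, LinearMap.sub_apply, LinearMap.sub_apply,
    LinearMap.sub_apply] at r₃
  rw [hh, map_neg, LinearMap.neg_apply, LinearMap.neg_apply] at r₆
  refine ⟨A.m2 X X W (-1) n t a₀ p + A.m3 X Y X W 1 (-1) n t f b₀ p +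
    A.m3 X Z X W 1 (-1) n t h k₀ p + A.m (.cons 1 f (.triple 1 (-1) n g k₀ p)) t + y,
    A.m2 Y X W (-1) n t b₀ p + A.m3 Y Z X W 1 (-1) n t g k₀ p, ?_, ?_⟩
  · rw [map_add]
    linear_combination (norm := abel) r₁ + r₂
  · simp only [map_add, hy]
    linear_combination (norm := abel) r₃ + r₄ + r₅ + r₆

/-- The connecting element `κ` of an exact triangle, and the exactness of the long exact sequences
`… → Hom^*(Z, W) → Hom^*(Y, W) → Hom^*(X, W) → …` next to the maps induced by `κ`. -/
lemma exists_connecting : ∃ κ : A.H Z X (-1),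
    A.comp Y Z X 1 (-1) 0 (cls g hx.right_mem) κ = 0 ∧
    A.comp Z X Y (-1) 1 0 κ (cls f hx.left_mem) = 0 ∧
    (∀ {W : A.Obj} {p n : ℤ}, n = p + 1 → ∀ a : A.H X W n, A.comp Z X W (-1) n p κ a = 0 →
      ∃ b : A.H Y W p, A.comp X Y W 1 p n (cls f hx.left_mem) b = a) ∧
    (∀ {W : A.Obj} {n q : ℤ}, q = n + 1 → ∀ c : A.H Z W n,
      A.comp Y Z W 1 n q (cls g hx.right_mem) c = 0 →
      ∃ a : A.H X W q, A.comp Z X W (-1) q n κ a = c) := by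
  obtain ⟨k₀, hk, ⟨b₀, hb₀⟩, hv⟩ := hx.exists_connecting_cocycle
  have hf := hx.left_mem
  have hg := hx.right_mem
  -- the connecting homomorphism in terms of lifts to the twisted complex
  have key : ∀ {W : A.Obj} {p n q : ℤ}, n = p + 1 → q = n + 1 → ∀ (α : A.hom X W q) (b : A.hom Y W n)
      (c : A.hom Z W n), α ∈ A.cocycles X W q → A.m1 Z W n q c = 0 →
      A.m1 Y W n q b + A.m2 Y Z W 1 n q g c = 0 →
      A.m2 X Y W 1 n q f b + A.m2 X Z W 1 n q h c + A.m3 X Y Z W 1 1 n q f g c = α →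
      ∃ x, A.m1 Z W p n x = A.m2 Z X W (-1) q n k₀ α + c := by
    intro W p n q hp hq α b c hα hc hb hα'
    obtain ⟨va, vb, h₁, h₂⟩ := hv hq α hα
    obtain ⟨-, -, x, hx', -⟩ := hx.exists_right hp hq va (vb + b)
      (A.m2 Z X W (-1) q n k₀ α + c)
      (by rw [map_add, hc, m1_of_mem (m2_mem n hk hα), add_zero])
      (by rw [map_add, map_add]; linear_combination (norm := abel) h₁ + hb)
      (by simp only [map_add]; linear_combination (norm := abel) h₂ + hα')
    exact ⟨x, hx'⟩
  refine ⟨cls k₀ hk, ?_, ?_, ?_, ?_⟩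
  · refine (comp_cls_eq_zero_iff (p := -1) (by omega) _ _).2 ⟨-b₀, ?_⟩
    rw [map_neg]
    exact neg_eq_of_add_eq_zero_right hb₀
  · obtain ⟨e, he, he'⟩ := exists_cls (A.one Y)
    have hfe := m2_mem (A := A.toAInfPrecategory) 1 hf he
    have h₁ := comp_one (cls f hf)
    rw [← he', comp_cls] at h₁
    obtain ⟨x, hx'⟩ := key (p := -1) (n := 0) (q := 1) (by omega) (by omega) _ e 0 hfe (map_zero _)
      (by rw [m1_of_mem he]; simp) (by simp)
    rw [← h₁, Units.smul_def, map_zsmul, ← Units.smul_def, smul_eq_zero_iff_eq]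
    exact (comp_cls_eq_zero_iff (p := -1) (by omega) _ _).2 ⟨x, by simpa using hx'⟩
  · intro W p n hn a ha
    obtain ⟨a, ha', rfl⟩ := exists_cls a
    obtain ⟨y, hy⟩ := (comp_cls_eq_zero_iff (p := p - 1) (by omega) _ _).1 ha
    obtain ⟨va, vb, h₁, h₂⟩ := hv hn a ha'
    rw [← hy] at h₁ h₂
    have r₁ := A.rel_two Y Z W (i := 1) (j := p - 1) (j' := p) (l := p) n rfl (by omega)
      (by omega) g y
    have r₂ := A.rel_two X Z W (i := 1) (i' := 2) (j := p - 1) (j' := p) (l := p) n rfl (by omega)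
      (by omega) h y
    have r₃ := A.rel_three X Y Z W (i := 1) (p := 2) (l' := p) (q := p) (r := p) n rfl rfl
      (by omega) rfl (by omega) (by omega) f g y
    simp only [m1_of_mem hf, m1_of_mem hg, map_zero, sub_self, add_zero,
      LinearMap.zero_apply, smul_zero, Int.negOnePow_zero, one_smul] at r₁ r₂ r₃
    have hh : A.m2 X Y Z 1 1 2 f g = - A.m1 X Z 1 2 h := eq_neg_of_add_eq_zero_right hx.m1_third
    rw [hh, map_neg, LinearMap.neg_apply] at r₃
    have hb : vb - A.m2 Y Z W 1 (p - 1) p g y ∈ A.cocycles Y W p := by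
      refine mem_cocycles hn ?_
      rw [map_sub]
      linear_combination (norm := abel) h₁ - r₁
    obtain ⟨s, hs, e⟩ := exists_unit_comp_cls (A := A.toAInfPrecategory) (X := X) (Y := Y) (Z := W) 1 p n
    refine ⟨(-s) • cls _ hb, ?_⟩
    rw [map_smul, e, smul_smul, neg_mul, hs, ← cls_smul, cls_eq_cls_iff hn]
    refine ⟨va - A.m2 X Z W 1 (p - 1) p h y - A.m3 X Y Z W 1 1 (p - 1) p f g y, ?_⟩
    rw [neg_one_smul]
    simp only [map_sub]
    linear_combination (norm := abel) h₂ - r₂ - r₃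
  · intro W n q hq c hc
    obtain ⟨c, hc', rfl⟩ := exists_cls c
    obtain ⟨b, hb⟩ := (comp_cls_eq_zero_iff hq _ _).1 hc
    have r₁ := A.rel_two X Y W (i := 1) (j' := q) (l := q) (q + 1) rfl hq (by omega) f b
    have r₂ := A.rel_two X Z W (i := 1) (i' := 2) (j' := q) (l := q) (q + 1) rfl hq (by omega) h c
    have r₃ := A.rel_three X Y Z W (i := 1) (p := 2) (l' := q) (q := q) (r := q) (q + 1) rfl rfl
      hq rfl (by omega) (by omega) f g c
    simp only [m1_of_mem hf, m1_of_mem hg, m1_of_mem hc', map_zero, sub_self, add_zero,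
      LinearMap.zero_apply, smul_zero, Int.negOnePow_zero, one_smul] at r₁ r₂ r₃
    have hh : A.m2 X Y Z 1 1 2 f g = - A.m1 X Z 1 2 h := eq_neg_of_add_eq_zero_right hx.m1_third
    rw [hh, map_neg, LinearMap.neg_apply] at r₃
    rw [hb] at r₁
    have hα : A.m2 X Y W 1 n q f (-b) + A.m2 X Z W 1 n q h c + A.m3 X Y Z W 1 1 n q f g c ∈
        A.cocycles X W q := by
      refine mem_cocycles rfl ?_
      simp only [map_add, map_neg]
      linear_combination (norm := abel) r₂ + r₃ - r₁
    obtain ⟨x, hx'⟩ := key (p := n - 1) (by omega) hq _ (-b) c hα (m1_of_mem hc' _) (by rw [map_neg, hb]; abel) rfl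
    obtain ⟨s, hs, e⟩ := exists_unit_comp_cls (A := A.toAInfPrecategory) (X := Z) (Y := X) (Z := W) (-1) q n
    refine ⟨(-s) • cls _ hα, ?_⟩
    rw [map_smul, e, smul_smul, neg_mul, hs, ← cls_smul, cls_eq_cls_iff (p := n - 1) (by omega)]
    refine ⟨-x, ?_⟩
    rw [map_neg, hx', neg_one_smul]
    abel

end IsExact

end AInfCategory

namespace AInfCategory

open AInfPrecategory

variable {k : Type w} [Field k] {A : AInfCategory.{w, u, v} k}

/-! ### Mapping cones and isomorphisms -/

/-- Composition with `x` is an isomorphism `Hom^*(W, X) → Hom^{* + i}(W, Y)`. -/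
def PostBij {X Y : A.Obj} {i : ℤ} (x : A.H X Y i) (W : A.Obj) : Prop :=
  ∀ ⦃p n : ℤ⦄, p + i = n → Function.Bijective fun a : A.H W X p => A.comp W X Y p i n a x

/-- Composition with `x` is an isomorphism `Hom^*(Y, W) → Hom^{* + i}(X, W)`. -/
def PreBij {X Y : A.Obj} {i : ℤ} (x : A.H X Y i) (W : A.Obj) : Prop :=
  ∀ ⦃p n : ℤ⦄, i + p = n → Function.Bijective fun a : A.H Y W p => A.comp X Y W i p n x a

lemma injective_comp_right_iff {W X Y : A.Obj} {p i n : ℤ} {x : A.H X Y i} :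
    (Function.Injective fun a : A.H W X p => A.comp W X Y p i n a x) ↔
      ∀ a : A.H W X p, A.comp W X Y p i n a x = 0 → a = 0 :=
  injective_iff_map_eq_zero ((A.comp W X Y p i n).flip x)

lemma injective_comp_left_iff {W X Y : A.Obj} {p i n : ℤ} {x : A.H X Y i} :
    (Function.Injective fun a : A.H Y W p => A.comp X Y W i p n x a) ↔
      ∀ a : A.H Y W p, A.comp X Y W i p n x a = 0 → a = 0 :=
  injective_iff_map_eq_zero (A.comp X Y W i p n x)

namespace IsExact

variable {X Y Z : A.Obj} {f : A.hom X Y 1} {g : A.hom Y Z 1} {h : A.hom X Z 1}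
  (hx : A.IsExact f g h)

include hx

lemma subsingleton_third {W : A.Obj} {p n : ℤ} (hn : n = p + 1) (hX : Subsingleton (A.H W X p))
    (hY : Subsingleton (A.H W Y p)) : Subsingleton (A.H W Z n) :=
  subsingleton_of_forall_eq 0 fun c => by
    obtain ⟨b, rfl⟩ := hx.exists_comp_right_eq hn (fun a _ => hX.elim _ _) c
    rw [hY.elim b 0, map_zero, LinearMap.zero_apply]

lemma subsingleton_first {W : A.Obj} {n q : ℤ} (hq : q = n + 1) (hY : Subsingleton (A.H W Y q))
    (hZ : Subsingleton (A.H W Z q)) : Subsingleton (A.H W X n) :=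
  subsingleton_of_forall_eq 0 fun a => hx.eq_zero_of_comp_left_eq_zero hq hZ a (hY.elim _ _)

lemma subsingleton_second {W : A.Obj} {p n q : ℤ} (hn : n = p + 1) (hq : q = n + 1)
    (hX : Subsingleton (A.H W X p)) (hZ : Subsingleton (A.H W Z q)) : Subsingleton (A.H W Y n) :=
  subsingleton_of_forall_eq 0 fun b => by
    obtain ⟨a, rfl⟩ := hx.exists_comp_left_eq hn hq b (hZ.elim _ _)
    rw [hX.elim a 0, map_zero, LinearMap.zero_apply]

lemma subsingleton_third' {W : A.Obj} {n q : ℤ} (hq : q = n + 1) (hX : Subsingleton (A.H X W q))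
    (hY : Subsingleton (A.H Y W q)) : Subsingleton (A.H Z W n) :=
  subsingleton_of_forall_eq 0 fun c => by
    obtain ⟨κ, -, -, -, hκ⟩ := hx.exists_connecting
    obtain ⟨a, rfl⟩ := hκ hq c (hY.elim _ _)
    rw [hX.elim a 0, map_zero]

lemma subsingleton_first' {W : A.Obj} {p n : ℤ} (hn : n = p + 1) (hY : Subsingleton (A.H Y W p))
    (hZ : Subsingleton (A.H Z W p)) : Subsingleton (A.H X W n) :=
  subsingleton_of_forall_eq 0 fun a => by
    obtain ⟨κ, -, -, hκ, -⟩ := hx.exists_connecting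
    obtain ⟨b, rfl⟩ := hκ hn a (hZ.elim _ _)
    rw [hY.elim b 0, map_zero]

lemma subsingleton_second' {W : A.Obj} {p n q : ℤ} (hn : n = p + 1) (hq : q = n + 1)
    (hX : Subsingleton (A.H X W q)) (hZ : Subsingleton (A.H Z W p)) : Subsingleton (A.H Y W n) :=
  subsingleton_of_forall_eq 0 fun b => by
    obtain ⟨c, rfl⟩ := hx.exists_comp_right_eq' hn hq b (hX.elim _ _)
    rw [hZ.elim c 0, map_zero]

lemma postBij_iff {W : A.Obj} :
    PostBij (cls f hx.left_mem) W ↔ ∀ n, Subsingleton (A.H W Z n) := by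
  refine ⟨fun hb n => subsingleton_of_forall_eq 0 fun c => ?_, fun hZ p n hn => ⟨?_, fun b => ?_⟩⟩
  · obtain ⟨b, rfl⟩ := hx.exists_comp_right_eq (p := n - 1) (by omega)
      (injective_comp_right_iff.1 (hb (by omega)).1) c
    obtain ⟨a, rfl⟩ := (hb (p := n - 2) (n := n - 1) (by omega)).2 b
    change A.comp W Y Z (n - 1) 1 n (A.comp W X Y (n - 2) 1 (n - 1) a _) _ = 0
    rw [A.comp_assoc _ _ _ _ (n - 2) 1 1 (n - 1) 2 n (by omega) (by omega), hx.comp_eq_zero,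
      map_zero]
  · exact injective_comp_right_iff.2 (hx.eq_zero_of_comp_left_eq_zero hn.symm (hZ n))
  · exact hx.exists_comp_left_eq hn.symm rfl b ((hZ _).elim _ _)

lemma preBij_iff {W : A.Obj} :
    PreBij (cls f hx.left_mem) W ↔ ∀ n, Subsingleton (A.H Z W n) := by
  obtain ⟨κ, h₁, h₂, h₃, h₄⟩ := hx.exists_connecting
  refine ⟨fun hb n => subsingleton_of_forall_eq 0 fun c => ?_, fun hZ p n hn => ⟨?_, fun a => ?_⟩⟩
  · have hc : A.comp Y Z W 1 n (n + 1) (cls g hx.right_mem) c = 0 := by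
      refine injective_comp_left_iff.1 (hb (n := n + 2) (by omega)).1 _ ?_
      rw [← A.comp_assoc _ _ _ _ 1 1 n 2 (n + 1) (n + 2) (by omega) (by omega), hx.comp_eq_zero,
        map_zero, LinearMap.zero_apply]
    obtain ⟨a, rfl⟩ := h₄ rfl c hc
    obtain ⟨b, rfl⟩ := (hb (p := n) (n := n + 1) (by omega)).2 a
    change A.comp Z X W (-1) (n + 1) n κ (A.comp X Y W 1 n (n + 1) _ b) = 0
    rw [← A.comp_assoc _ _ _ _ (-1) 1 n 0 (n + 1) n (by omega) (by omega), h₂, map_zero,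
        LinearMap.zero_apply]
  · refine injective_comp_left_iff.2 fun b hb => ?_
    obtain ⟨c, rfl⟩ := hx.exists_comp_right_eq' (p := p - 1) (by omega) (show n = p + 1 by omega) b hb
    rw [(hZ _).elim c 0, map_zero]
  · exact h₃ (by omega) a ((hZ _).elim _ _)

end IsExact

lemma PostBij.comp_isInvPair_iff {X X' Y W : A.Obj} {i i' j l : ℤ} {a : A.H X X' i} {b : A.H X' X i'}
    (hab : IsInvPair a b) {x : A.H X' Y j} (hl : i + j = l) :
    PostBij (A.comp X X' Y i j l a x) W ↔ PostBij x W := by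
  have hd := hab.deg
  refine ⟨fun H p n hn => ?_, fun H p n hn => ?_⟩
  · refine (Function.Bijective.of_comp_iff _
      (hab.bijective_comp_right W (show p - i + i = p by omega))).1 ?_
    convert H (p := p - i) (n := n) (by omega) using 2 with y
    exact A.comp_assoc _ _ _ _ _ _ _ _ _ _ (by omega) hl.symm _ _ _
  · convert (H (p := p + i) (n := n) (by omega)).comp (hab.bijective_comp_right W rfl) using 2 with y
    exact (A.comp_assoc _ _ _ _ _ _ _ _ _ _ rfl hl.symm _ _ _).symm

lemma PreBij.comp_isInvPair_iff {X X' Y W : A.Obj} {i i' j l : ℤ} {a : A.H X X' i} {b : A.H X' X i'}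
    (hab : IsInvPair a b) {x : A.H X' Y j} (hl : i + j = l) :
    PreBij (A.comp X X' Y i j l a x) W ↔ PreBij x W := by
  have hd := hab.deg
  refine ⟨fun H p n hn => ?_, fun H p n hn => ?_⟩
  · refine (Function.Bijective.of_comp_iff' (hab.bijective_comp_left W (show i + n = i + n from rfl))
      _).1 ?_
    convert H (p := p) (n := i + n) (by omega) using 2 with y
    exact (A.comp_assoc _ _ _ _ _ _ _ _ _ _ hl.symm hn.symm _ _ _).symm
  · convert (hab.bijective_comp_left W (show i + (j + p) = n by omega)).comp (H rfl) using 2 with y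
    exact A.comp_assoc _ _ _ _ _ _ _ _ _ _ hl.symm rfl _ _ _

lemma IsInvPair.postBij {X Y W : A.Obj} {i j : ℤ} {a : A.H X Y i} {b : A.H Y X j}
    (h : IsInvPair a b) : PostBij a W := fun _ _ hn => h.bijective_comp_right W hn

lemma IsInvPair.preBij {X Y W : A.Obj} {i j : ℤ} {a : A.H X Y i} {b : A.H Y X j}
    (h : IsInvPair a b) : PreBij a W := fun _ _ hn => h.bijective_comp_left W hn

end AInfCategory

namespace TriangulatedAInfCategory

open AInfPrecategory AInfCategory

variable {k : Type w} [Field k] {D : TriangulatedAInfCategory.{w, u, v} k}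

/-! ### Generated subcategories -/

lemma exactTriangle_of_isExact {X Y Z : D.Obj} {f : D.hom X Y 1} {g : D.hom Y Z 1}
    {h : D.hom X Z 1} (hx : D.IsExact f g h) :
    D.ExactTriangle (D.shift X (-1)) Y (D.shift Z 1) :=
  ⟨X, Z, f, g, h, (D.isShift_shift X (-1)).symm, (D.isShift_shift Z 1).symm, hx⟩

namespace Generated

variable {ι : Type*} {E : ι → D.Obj}

lemma shift_iff {n : ℤ} {X Y : D.Obj} (h : D.IsShift n X Y) :
    D.Generated E X ↔ D.Generated E Y :=
  ⟨.shift n X Y h, .shift (-n) Y X h.symm⟩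

lemma third {X Y Z : D.Obj} {f : D.hom X Y 1} {g : D.hom Y Z 1} {h : D.hom X Z 1}
    (hx : D.IsExact f g h) (hX : D.Generated E X) (hY : D.Generated E Y) : D.Generated E Z :=
  (shift_iff (D.isShift_shift Z 1)).2 <| .tri₃ _ _ _ (exactTriangle_of_isExact hx)
    ((shift_iff (D.isShift_shift X (-1))).1 hX) hY

lemma second {X Y Z : D.Obj} {f : D.hom X Y 1} {g : D.hom Y Z 1} {h : D.hom X Z 1}
    (hx : D.IsExact f g h) (hX : D.Generated E X) (hZ : D.Generated E Z) : D.Generated E Y :=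
  .tri₂ _ _ _ (exactTriangle_of_isExact hx) ((shift_iff (D.isShift_shift X (-1))).1 hX)
    ((shift_iff (D.isShift_shift Z 1)).1 hZ)

lemma first {X Y Z : D.Obj} {f : D.hom X Y 1} {g : D.hom Y Z 1} {h : D.hom X Z 1}
    (hx : D.IsExact f g h) (hY : D.Generated E Y) (hZ : D.Generated E Z) : D.Generated E X :=
  (shift_iff (D.isShift_shift X (-1))).2 <| .tri₁ _ _ _ (exactTriangle_of_isExact hx) hY
    ((shift_iff (D.isShift_shift Z 1)).1 hZ)

/-- A class of objects that is closed under shifts and satisfies the two-out-of-three property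
contains a generated subcategory as soon as it contains the generators. -/
lemma induction {P : D.Obj → Prop} (of : ∀ i, P (E i))
    (shift : ∀ {n : ℤ} {X Y : D.Obj}, D.IsShift n X Y → P X → P Y)
    (tri : ∀ {X Y Z : D.Obj} {f : D.hom X Y 1} {g : D.hom Y Z 1} {h : D.hom X Z 1},
      D.IsExact f g h → (P Y → P Z → P X) ∧ (P X → P Z → P Y) ∧ (P X → P Y → P Z))
    {X : D.Obj} (hX : D.Generated E X) : P X := by
  induction hX with
  | of i => exact of i
  | shift n X Y h _ ih => exact shift h ih
  | tri₁ X Y Z hT _ _ hY hZ =>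
    obtain ⟨X', Z', f, g, h, hX', hZ', hx⟩ := hT
    exact shift hX'.symm ((tri hx).1 hY (shift hZ' hZ))
  | tri₂ X Y Z hT _ _ hX hZ =>
    obtain ⟨X', Z', f, g, h, hX', hZ', hx⟩ := hT
    exact (tri hx).2.1 (shift hX' hX) (shift hZ' hZ)
  | tri₃ X Y Z hT _ _ hX hY =>
    obtain ⟨X', Z', f, g, h, hX', hZ', hx⟩ := hT
    exact shift hZ'.symm ((tri hx).2.2 (shift hX' hX) hY)

lemma of_forall {ι' : Type*} {E' : ι' → D.Obj} (h : ∀ i, D.Generated E' (E i)) {X : D.Obj}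
    (hX : D.Generated E X) : D.Generated E' X :=
  induction (P := D.Generated E') h (fun h hX => .shift _ _ _ h hX)
    (fun hx => ⟨first hx, second hx, third hx⟩) hX

/-- The left orthogonal of an object is a triangulated subcategory. -/
lemma subsingleton_left {K : D.Obj} (h : ∀ i n, Subsingleton (D.H (E i) K n)) {X : D.Obj}
    (hX : D.Generated E X) (n : ℤ) : Subsingleton (D.H X K n) := by
  revert n
  refine induction (P := fun X => ∀ n, Subsingleton (D.H X K n)) h
    (fun {m X Y} hXY hX n => hXY.subsingleton_left (p := n - m) (by omega) (hX _))
    (fun hx => ⟨fun hY hZ n => hx.subsingleton_first' (p := n - 1) (by omega) (hY _) (hZ _),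
      fun hX hZ n => hx.subsingleton_second' (p := n - 1) (by omega) rfl (hX _) (hZ _),
      fun hX hY n => hx.subsingleton_third' rfl (hX _) (hY _)⟩) hX

/-- The right orthogonal of an object is a triangulated subcategory. -/
lemma subsingleton_right {K : D.Obj} (h : ∀ i n, Subsingleton (D.H K (E i) n)) {X : D.Obj}
    (hX : D.Generated E X) (n : ℤ) : Subsingleton (D.H K X n) := by
  revert n
  refine induction (P := fun X => ∀ n, Subsingleton (D.H K X n)) h
    (fun {m X Y} hXY hX n => hXY.subsingleton_right (p := n + m) (by omega) (hX _))
    (fun hx => ⟨fun hY hZ n => hx.subsingleton_first rfl (hY _) (hZ _),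
      fun hX hZ n => hx.subsingleton_second (p := n - 1) (by omega) rfl (hX _) (hZ _),
      fun hX hY n => hx.subsingleton_third (p := n - 1) (by omega) (hX _) (hY _)⟩) hX

end Generated

/-- Every element `x` of `Hom^i(X, Y)` is, up to a shift of `X`, the first map of an exact
triangle. -/
lemma exists_isExact {X Y : D.Obj} {i j : ℤ} (hij : j + 1 = i) (x : D.H X Y i) :
    ∃ (X' Z : D.Obj) (f : D.hom X' Y 1) (g : D.hom Y Z 1) (h : D.hom X' Z 1)
      (hx : D.IsExact f g h) (a : D.H X X' j) (b : D.H X' X (-j)), IsInvPair a b ∧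
      D.comp X X' Y j 1 i a (cls f hx.left_mem) = x := by
  obtain ⟨a, b, hab⟩ := (D.isShift_shift X (-j)).exists_isInvPair
  revert a
  rw [neg_neg]
  intro a hab
  obtain ⟨f, hf, hf'⟩ := exists_cls (D.comp _ X Y (-j) i 1 b x)
  obtain ⟨Z, g, h, hx⟩ := D.exists_cone f hf
  exact ⟨_, Z, f, g, h, hx, a, b, hab, by
    rw [hf', hab.comp_comp_right (by omega)]⟩

/-- A mapping cone of an element of `Hom^i(X, Y)`. -/
lemma exists_cone_of_class {X Y : D.Obj} {i : ℤ} (x : D.H X Y i) :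
    ∃ Z : D.Obj, (∀ W, PostBij x W ↔ ∀ n, Subsingleton (D.H W Z n)) ∧
      (∀ W, PreBij x W ↔ ∀ n, Subsingleton (D.H Z W n)) := by
  obtain ⟨X', Z, f, g, h, hx, a, b, hab, rfl⟩ := exists_isExact (j := i - 1) (by omega) x
  exact ⟨Z, fun W => (PostBij.comp_isInvPair_iff hab (by omega)).trans hx.postBij_iff,
    fun W => (PreBij.comp_isInvPair_iff hab (by omega)).trans hx.preBij_iff⟩

/-- If an element induces isomorphisms on `Hom^*(E i, -)` for the objects of a family, then also for
the objects of the triangulated subcategory generated by the family. -/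
lemma Generated.postBij {ι : Type*} {E : ι → D.Obj} {X Y : D.Obj} {i : ℤ} {x : D.H X Y i}
    (h : ∀ j, PostBij x (E j)) {W : D.Obj} (hW : D.Generated E W) : PostBij x W := by
  obtain ⟨Z, hZ, -⟩ := exists_cone_of_class x
  exact (hZ W).2 (hW.subsingleton_left fun j => (hZ _).1 (h j))

/-- If an element induces isomorphisms on `Hom^*(-, E i)` for the objects of a family, then also for
the objects of the triangulated subcategory generated by the family. -/
lemma Generated.preBij {ι : Type*} {E : ι → D.Obj} {X Y : D.Obj} {i : ℤ} {x : D.H X Y i}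
    (h : ∀ j, PreBij x (E j)) {W : D.Obj} (hW : D.Generated E W) : PreBij x W := by
  obtain ⟨Z, -, hZ⟩ := exists_cone_of_class x
  exact (hZ W).2 (hW.subsingleton_right fun j => (hZ _).1 (h j))

end TriangulatedAInfCategory

namespace AInfCategory

open AInfPrecategory

variable {k : Type w} [Field k] {A : AInfCategory.{w, u, v} k}

/-! ### Universal elements, adjoint functors and mutations -/

/-- Isomorphic objects of `H⁰(A)` are the same as shifts by `0` of each other. -/
lemma nonempty_iso_iff {X Y : A.Obj} : Nonempty (Iso (C := A.H0) X Y) ↔ A.IsShift 0 X Y := by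
  constructor
  · rintro ⟨e⟩
    have h : IsInvPair (X := X) (Y := Y) (i := 0) (j := 0) e.hom e.inv :=
      ⟨rfl, e.hom_inv_id, e.inv_hom_id⟩
    exact h.isShift
  · intro h
    obtain ⟨a, b, h⟩ := h.exists_isInvPair
    exact ⟨⟨(a : A.H X Y 0), b, h.hom_inv, h.inv_hom⟩⟩

lemma bijective_of_comm {α β γ δ : Type*} {F : α → β} {G : β → δ} {G' : α → γ} {F' : γ → δ}
    (hG : Function.Bijective G) (hF' : Function.Bijective F') (hG' : Function.Bijective G')
    (h : ∀ x, G (F x) = F' (G' x)) : Function.Bijective F :=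
  (Function.Bijective.of_comp_iff' hG F).1 ((funext h : G ∘ F = F' ∘ G') ▸ hF'.comp hG')

lemma PreBij.comp {X Y Z W : A.Obj} {i j l : ℤ} {x : A.H X Y i} {y : A.H Y Z j}
    (hx : PreBij x W) (hy : PreBij y W) (hl : i + j = l) : PreBij (A.comp X Y Z i j l x y) W := by
  intro p n hn
  convert (hx (show i + (j + p) = n by omega)).comp (hy rfl) using 2 with z
  exact A.comp_assoc _ _ _ _ _ _ _ _ _ _ hl.symm rfl _ _ _

lemma PostBij.comp {X Y Z W : A.Obj} {i j l : ℤ} {x : A.H X Y i} {y : A.H Y Z j}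
    (hx : PostBij x W) (hy : PostBij y W) (hl : i + j = l) : PostBij (A.comp X Y Z i j l x y) W := by
  intro p n hn
  convert (hy (show p + i + j = n by omega)).comp (hx rfl) using 2 with z
  exact (A.comp_assoc _ _ _ _ _ _ _ _ _ _ rfl hl.symm _ _ _).symm

/-- A final element among those with a fixed target is unique up to a unique isomorphism. -/
lemma isShift_of_postBij {X X' Y : A.Obj} {i i' l : ℤ} {x : A.H X Y i} {x' : A.H X' Y i'}
    (h₁ : PostBij x X) (h₂ : PostBij x X') (h₁' : PostBij x' X) (h₂' : PostBij x' X')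
    (hl : i' - i = l) : A.IsShift l X X' := by
  obtain ⟨a, ha⟩ := (h₁' (show (i - i') + i' = i by omega)).2 x
  obtain ⟨b, hb⟩ := (h₂ (show l + i = i' by omega)).2 x'
  refine IsInvPair.isShift (a := a) (b := b) ⟨by omega, (h₁ (zero_add i)).1 ?_,
    (h₂' (zero_add i')).1 ?_⟩
  · refine (A.comp_assoc X X' X Y (i - i') l i 0 i' i (by omega) (by omega) a b x).trans ?_
    exact (congrArg _ hb).trans (ha.trans (one_comp x).symm)
  · refine (A.comp_assoc X' X X' Y l (i - i') i' 0 i i' (by omega) (by omega) b a x').trans ?_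
    exact (congrArg _ ha).trans (hb.trans (one_comp x').symm)

/-- An initial element among those with a fixed source is unique up to a unique isomorphism. -/
lemma isShift_of_preBij {X X' Y : A.Obj} {i i' l : ℤ} {x : A.H Y X i} {x' : A.H Y X' i'}
    (h₁ : PreBij x X) (h₂ : PreBij x X') (h₁' : PreBij x' X) (h₂' : PreBij x' X')
    (hl : i - i' = l) : A.IsShift l X X' := by
  obtain ⟨a, ha⟩ := (h₂ (show i + (i' - i) = i' by omega)).2 x'
  obtain ⟨b, hb⟩ := (h₁' (show i' + l = i by omega)).2 x
  refine IsInvPair.isShift (a := a) (b := b) ⟨by omega, (h₁ (add_zero i)).1 ?_,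
    (h₂' (add_zero i')).1 ?_⟩
  · refine (A.comp_assoc Y X X' X i (i' - i) l i' 0 i (by omega) (by omega) x a b).symm.trans ?_
    exact (congrArg (fun z => A.comp Y X' X i' l i z b) ha).trans (hb.trans (comp_one x).symm)
  · refine (A.comp_assoc Y X' X X' i' l (i' - i) i 0 i' (by omega) (by omega) x' b a).symm.trans ?_
    exact (congrArg (fun z => A.comp Y X X' i (i' - i) i' z a) hb).trans (ha.trans (comp_one x').symm)

end AInfCategory

namespace TriangulatedAInfCategory

open AInfPrecategory AInfCategory

variable {k : Type w} [Field k] {D : TriangulatedAInfCategory.{w, u, v} k}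
  {C : ObjectProperty D.H0}

lemma isShift_shift_iff {X Y : D.Obj} {n : ℤ} : D.IsShift 0 (D.shift X n) Y ↔ D.IsShift n X Y :=
  ⟨fun h => (D.isShift_shift X n).trans h (by omega),
    fun h => (D.isShift_shift X n).symm.trans h (by omega)⟩

/-- For a class of objects closed under shifts, isomorphisms `Hom^0(W, X) ≅ Hom^i(W, Y)` are
sufficient for having isomorphisms in all degrees. -/
lemma postBij_of_degree_zero (hC : ∀ (n : ℤ) (X Y : D.Obj), D.IsShift n X Y → C X → C Y)
    {X Y : D.Obj} {i : ℤ} {x : D.H X Y i}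
    (h : ∀ W : D.Obj, C W → Function.Bijective fun a : D.H W X 0 => D.comp W X Y 0 i i a x)
    {W : D.Obj} (hW : C W) : PostBij x W := by
  intro p n hn
  obtain ⟨a, b, hab⟩ := (D.isShift_shift W (-p)).exists_isInvPair
  have h' := h _ (hC _ _ _ (D.isShift_shift W (-p)) hW)
  refine bijective_of_comm (hab.symm.bijective_comp_left Y (p := n) (l := i) (by omega)) h'
    (hab.symm.bijective_comp_left X (p := p) (l := 0) (by omega)) fun y => ?_
  exact (D.comp_assoc _ _ _ _ (-p) p i 0 n i (by omega) hn.symm _ _ _).symm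

/-- For a class of objects closed under shifts, isomorphisms `Hom^0(Y, W) ≅ Hom^i(X, W)` are
sufficient for having isomorphisms in all degrees. -/
lemma preBij_of_degree_zero (hC : ∀ (n : ℤ) (X Y : D.Obj), D.IsShift n X Y → C X → C Y)
    {X Y : D.Obj} {i : ℤ} {x : D.H X Y i}
    (h : ∀ W : D.Obj, C W → Function.Bijective fun a : D.H Y W 0 => D.comp X Y W i 0 i x a)
    {W : D.Obj} (hW : C W) : PreBij x W := by
  intro p n hn
  obtain ⟨a, b, hab⟩ := (D.isShift_shift W p).exists_isInvPair
  have h' := h _ (hC _ _ _ (D.isShift_shift W p) hW)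
  refine bijective_of_comm (hab.bijective_comp_right X (p := n) (l := i) (by omega)) h'
    (hab.bijective_comp_right Y (p := p) (l := 0) (by omega)) fun y => ?_
  exact D.comp_assoc _ _ _ _ i p (-p) n 0 i hn.symm (by omega) _ _ _

/-- The counit of a right adjoint of the inclusion is universal in all degrees. -/
lemma exists_postBij_rightAdjoint (hC : ∀ (n : ℤ) (X Y : D.Obj), D.IsShift n X Y → C X → C Y)
    {rho : D.H0 ⥤ C.FullSubcategory} (adj : C.ι ⊣ rho) (Y : D.Obj) :
    ∃ x : D.H (rho.obj Y).obj Y 0, ∀ W : D.Obj, C W → PostBij x W := by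
  refine ⟨adj.counit.app Y, fun W hW => postBij_of_degree_zero hC (fun W hW => ?_) hW⟩
  have h : Function.Bijective fun a : ((⟨W, hW⟩ : C.FullSubcategory) ⟶ rho.obj Y) =>
      C.ι.map a ≫ adj.counit.app Y := by
    have e : (fun a : ((⟨W, hW⟩ : C.FullSubcategory) ⟶ rho.obj Y) =>
        C.ι.map a ≫ adj.counit.app Y) = (adj.homEquiv ⟨W, hW⟩ Y).symm :=
      funext fun a => (adj.homEquiv_counit _ _ a).symm
    rw [e]
    exact Equiv.bijective _
  have h' : Function.Bijective (ObjectProperty.homMk (P := C) (X := ⟨W, hW⟩) (Y := rho.obj Y)) :=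
    ⟨fun a b e => congrArg (·.hom) e, ObjectProperty.homMk_surjective⟩
  exact h.comp h'

/-- The unit of a left adjoint of the inclusion is universal in all degrees. -/
lemma exists_preBij_leftAdjoint (hC : ∀ (n : ℤ) (X Y : D.Obj), D.IsShift n X Y → C X → C Y)
    {lam : D.H0 ⥤ C.FullSubcategory} (adj : lam ⊣ C.ι) (X : D.Obj) :
    ∃ x : D.H X (lam.obj X).obj 0, ∀ W : D.Obj, C W → PreBij x W := by
  refine ⟨adj.unit.app X, fun W hW => preBij_of_degree_zero hC (fun W hW => ?_) hW⟩
  have h : Function.Bijective fun a : (lam.obj X ⟶ (⟨W, hW⟩ : C.FullSubcategory)) =>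
      adj.unit.app X ≫ C.ι.map a := by
    have e : (fun a : (lam.obj X ⟶ (⟨W, hW⟩ : C.FullSubcategory)) =>
        adj.unit.app X ≫ C.ι.map a) = adj.homEquiv X ⟨W, hW⟩ :=
      funext fun a => (adj.homEquiv_unit _ _ a).symm
    rw [e]
    exact Equiv.bijective _
  have h' : Function.Bijective (ObjectProperty.homMk (P := C) (X := lam.obj X) (Y := ⟨W, hW⟩)) :=
    ⟨fun a b e => congrArg (·.hom) e, ObjectProperty.homMk_surjective⟩
  exact h.comp h'

/-- The connecting element of an exact triangle `X → Y → Z` with `Hom^*(Y, W) = 0`. -/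
lemma preBij_connecting {X Y Z : D.Obj} {f : D.hom X Y 1} {g : D.hom Y Z 1} {h : D.hom X Z 1}
    (hx : D.IsExact f g h) :
    ∃ κ : D.H Z X (-1), ∀ W : D.Obj, (∀ n, Subsingleton (D.H Y W n)) → PreBij κ W := by
  obtain ⟨κ, -, -, h₃, h₄⟩ := hx.exists_connecting
  refine ⟨κ, fun W hW p n hn => ⟨injective_comp_left_iff.2 fun a ha => ?_, fun c => ?_⟩⟩
  · obtain ⟨b, rfl⟩ := h₃ (show p = n + 1 by omega) a ha
    rw [(hW n).elim b 0, map_zero]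
  · exact h₄ (by omega) c ((hW _).elim _ _)

/-- If `X` is in the left orthogonal of `C`, then the right adjoint of the inclusion of `C`, applied
to `X`, agrees with the left adjoint applied to the left mutation of `X`, up to a shift. -/
lemma isShift_rightAdjoint_leftAdjoint
    (hC : ∀ (n : ℤ) (X Y : D.Obj), D.IsShift n X Y → C X → C Y)
    {lam rho : D.H0 ⥤ C.FullSubcategory} (adj_lam : lam ⊣ C.ι) (adj_rho : C.ι ⊣ rho)
    {X L : D.Obj} (hX : ∀ W : D.Obj, C W → ∀ n, Subsingleton (D.H X W n))
    (hL : D.IsLeftMutation C X L) : D.IsShift 1 (rho.obj X).obj (lam.obj L).obj := by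
  obtain ⟨⟨C', hC', X', Z', f, g, h, hX', hZ', hx⟩, hL'⟩ := hL
  obtain ⟨ε, hε⟩ := exists_postBij_rightAdjoint hC adj_rho X
  obtain ⟨η, hη⟩ := exists_preBij_leftAdjoint hC adj_lam L
  have hCX' : C X' := hC _ _ _ hX' hC'
  have hf : ∀ W : D.Obj, C W → PostBij (cls f hx.left_mem) W := fun W hW =>
    hx.postBij_iff.2 fun n => hZ'.subsingleton_right (p := n - 1) (by omega) (hL' W hW _)
  obtain ⟨κ, hκ⟩ := preBij_connecting hx
  obtain ⟨a, b, hab⟩ := hZ'.exists_isInvPair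
  have h₁ : D.IsShift 1 (rho.obj X).obj X' :=
    isShift_of_postBij (hε _ (rho.obj X).property) (hε _ hCX') (hf _ (rho.obj X).property)
      (hf _ hCX') (by omega)
  have hκ' : ∀ W : D.Obj, C W → PreBij (D.comp L Z' X' (- -1) (-1) 0 a κ) W := fun W hW =>
    PreBij.comp hab.preBij (hκ W (hX W hW)) (by omega)
  have h₂ : D.IsShift 0 X' (lam.obj L).obj :=
    isShift_of_preBij (hκ' _ hCX') (hκ' _ (lam.obj L).property) (hη _ hCX')
      (hη _ (lam.obj L).property) (by omega)
  exact h₁.trans h₂ (by omega)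

/-- An object `S` of `C` is the left adjoint of the inclusion of `C` applied to `L[n]` if and only if
there is an element of `Hom⁰(L[n], S)` that is universal. -/
lemma isShift_leftAdjoint_iff (hC : ∀ (n : ℤ) (X Y : D.Obj), D.IsShift n X Y → C X → C Y)
    {lam : D.H0 ⥤ C.FullSubcategory} (adj_lam : lam ⊣ C.ι) {L S : D.Obj} (hS : C S) (n : ℤ) :
    D.IsShift n (lam.obj L).obj S ↔
      ∃ t : D.H (D.shift L n) S 0, ∀ W : D.Obj, C W → PreBij t W := by
  obtain ⟨η, hη⟩ := exists_preBij_leftAdjoint hC adj_lam L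
  obtain ⟨a, b, hab⟩ := (D.isShift_shift L n).exists_isInvPair
  constructor
  · intro h
    obtain ⟨x, y, hxy⟩ := h.exists_isInvPair
    exact ⟨D.comp _ _ _ n (-n) 0 b (D.comp _ _ _ 0 (-n) (-n) η x), fun W hW =>
      hab.symm.preBij.comp ((hη W hW).comp hxy.preBij (by omega)) (by omega)⟩
  · rintro ⟨t, ht⟩
    have ht' : ∀ W : D.Obj, C W → PreBij (D.comp _ _ _ (-n) 0 (-n) a t) W := fun W hW =>
      hab.preBij.comp (ht W hW) (by omega)
    exact isShift_of_preBij (hη _ (lam.obj L).property) (hη _ hS) (ht' _ (lam.obj L).property)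
      (ht' _ hS) (by omega)

end TriangulatedAInfCategory

namespace TriangulatedAInfCategory

open AInfPrecategory AInfCategory

variable {k : Type w} [Field k] {D : TriangulatedAInfCategory.{w, u, v} k}
  {C : ObjectProperty D.H0}

/-! ### Serre duality and perfect pairings -/

/-- Perfectness of the composition pairing with values in `Hom^d(P, Q)` does not change when the
middle object is shifted. -/
lemma isPerfPair_of_isInvPair {P Q W W' : D.Obj} {s t i j i' j' d : ℤ} {a : D.H W W' s}
    {b : D.H W' W t} (hab : IsInvPair a b) (φ : D.H P Q d →ₗ[k] k) (hi : i + s = i')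
    (hj : s + j' = j) (_ : i + j = d)
    (h : ((D.comp P W Q i j d).compr₂ φ).IsPerfPair) :
    ((D.comp P W' Q i' j' d).compr₂ φ).IsPerfPair := by
  have hst := hab.deg
  let e₁ : D.H P W' i' ≃ₗ[k] D.H P W i := LinearEquiv.ofBijective ((D.comp P W' W i' t i).flip b)
    (hab.symm.bijective_comp_right P (by omega))
  let e₂ : D.H W' Q j' ≃ₗ[k] D.H W Q j := LinearEquiv.ofBijective (D.comp W W' Q s j' j a)
    (hab.bijective_comp_left Q (by omega))
  have e : (D.comp P W' Q i' j' d).compr₂ φ = ((D.comp P W Q i j d).compr₂ φ).compl₁₂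
      (e₁ : D.H P W' i' →ₗ[k] D.H P W i) (e₂ : D.H W' Q j' →ₗ[k] D.H W Q j) := by
    refine LinearMap.ext fun x => LinearMap.ext fun y => congrArg φ ?_
    change _ = D.comp P W Q i j d (D.comp P W' W i' t i x b) (D.comp W W' Q s j' j a y)
    rw [← D.comp_assoc P W W' Q i s j' i' j d hi.symm hj.symm, hab.symm.comp_comp_left (by omega)]
  rw [e]
  exact LinearMap.IsPerfPair.compl₁₂ _ e₁ e₂

section Serre

variable (serre : SerreFunctor k C.FullSubcategory)

/-- Morphisms in a full subcategory of `H⁰(D)` are elements of `Hom⁰`. -/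
noncomputable def fullHomEquiv (X Y : C.FullSubcategory) : (X ⟶ Y) ≃ₗ[k] D.H X.obj Y.obj 0 :=
  InducedCategory.homLinearEquiv (R := k) (C := D.H0)

lemma finite_hom (hC : ∀ (n : ℤ) (X Y : D.Obj), D.IsShift n X Y → C X → C Y)
    (serre : SerreFunctor k C.FullSubcategory) {X Y : D.Obj} (hX : C X) (hY : C Y) (n : ℤ) :
    Module.Finite k (D.H X Y n) := by
  have hY' := hC _ _ _ (D.isShift_shift Y n) hY
  obtain ⟨a, b, hab⟩ := (D.isShift_shift Y n).exists_isInvPair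
  have := serre.finite_hom ⟨X, hX⟩ ⟨_, hY'⟩
  have h : Module.Finite k (D.H X (D.shift Y n) 0) :=
    Module.Finite.equiv (fullHomEquiv (⟨X, hX⟩ : C.FullSubcategory) ⟨_, hY'⟩)
  exact Module.Finite.equiv (LinearEquiv.ofBijective ((D.comp X (D.shift Y n) Y 0 n n).flip b)
    (hab.symm.bijective_comp_right X (zero_add n)))

/-- The trace `Hom⁰(X, S X) → k` of a Serre functor `S`. -/
noncomputable def serreTrace (X : C.FullSubcategory) : D.H X.obj (serre.S.obj X).obj 0 →ₗ[k] k :=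
  (Module.Dual.eval k (X ⟶ X) (𝟙 X)).comp
    ((serre.equiv X X).toLinearMap.comp (fullHomEquiv X (serre.S.obj X)).symm.toLinearMap)

lemma serreTrace_comp {X Y : C.FullSubcategory} (f : D.H X.obj Y.obj 0)
    (g : D.H Y.obj (serre.S.obj X).obj 0) :
    serreTrace serre X (D.comp _ _ _ 0 0 0 f g) =
      serre.equiv X Y ((fullHomEquiv Y (serre.S.obj X)).symm g) ((fullHomEquiv X Y).symm f) := by
  have h := serre.naturality (𝟙 X) ((fullHomEquiv X Y).symm f)
    ((fullHomEquiv Y (serre.S.obj X)).symm g) (𝟙 X)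
  rw [serre.S.map_id, Category.comp_id, Category.id_comp, Category.id_comp] at h
  exact h

/-- `tr` is a functional on `Hom⁰(P, S)` which exhibits `S` as the value of a Serre functor at `P`:
the pairings `Hom^i(P, W) × Hom^{-i}(W, S) → Hom⁰(P, S) → k` are perfect for the objects `W` of
`C`. -/
def IsSerreDual (C : ObjectProperty D.H0) {P S : D.Obj} (tr : D.H P S 0 →ₗ[k] k) : Prop :=
  ∀ ⦃W : D.Obj⦄, C W → ∀ ⦃i j : ℤ⦄, i + j = 0 → ((D.comp P W S i j 0).compr₂ tr).IsPerfPair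

lemma isSerreDual_serreTrace (hC : ∀ (n : ℤ) (X Y : D.Obj), D.IsShift n X Y → C X → C Y)
    (X : C.FullSubcategory) : IsSerreDual C (serreTrace serre X) := by
  intro W hW i j hij
  have h0 : ∀ Y : C.FullSubcategory,
      ((D.comp X.obj Y.obj (serre.S.obj X).obj 0 0 0).compr₂ (serreTrace serre X)).IsPerfPair := by
    intro Y
    have := finite_hom hC serre X.property Y.property 0
    have e : ((D.comp X.obj Y.obj (serre.S.obj X).obj 0 0 0).compr₂ (serreTrace serre X)).flip =
        ((fullHomEquiv Y (serre.S.obj X)).symm.trans ((serre.equiv X Y).trans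
          (fullHomEquiv X Y).symm.dualMap)).toLinearMap :=
      LinearMap.ext fun g => LinearMap.ext fun f => serreTrace_comp serre f g
    refine LinearMap.IsPerfPair.flip (p := ((D.comp X.obj Y.obj (serre.S.obj X).obj 0 0 0).compr₂
      (serreTrace serre X)).flip) (.of_bijective _ ?_)
    rw [e]
    exact LinearEquiv.bijective _
  obtain ⟨a, b, hab⟩ := (D.isShift_shift W i).exists_isInvPair
  exact isPerfPair_of_isInvPair hab.symm _ (by omega) (by omega) rfl
    (h0 ⟨_, hC _ _ _ (D.isShift_shift W i) hW⟩)

end Serre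

namespace IsSerreDual

variable {P S : D.Obj} {tr : D.H P S 0 →ₗ[k] k} (hS : IsSerreDual C tr)

include hS

lemma subsingleton_iff {W : D.Obj} (hW : C W) {i j : ℤ} (hij : i + j = 0) :
    Subsingleton (D.H P W i) ↔ Subsingleton (D.H W S j) := by
  have h := hS hW hij
  constructor
  · intro _
    exact h.bijective_right.injective.subsingleton
  · intro _
    exact h.bijective_left.injective.subsingleton

lemma finrank_eq {W : D.Obj} (hW : C W) {i j : ℤ} (hij : i + j = 0) :
    Module.finrank k (D.H W S j) = Module.finrank k (D.H P W i) :=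
  (LinearEquiv.ofBijective _ (hS hW hij).bijective_right).finrank_eq.trans Subspace.dual_finrank_eq

/-- If `P` has only scalar endomorphisms in degree `0`, then `Hom⁰(P, S)`, being dual to `Hom⁰(P, P)`,
is one-dimensional, and the trace does not vanish on it. -/
lemma bijective_trace (hP : C P) (h : Module.finrank k (D.H P P 0) = 1) :
    Function.Bijective tr := by
  have h1 := hS.finrank_eq hP (add_zero 0)
  rw [h] at h1
  have hone : D.one P ≠ 0 := one_ne_zero_of_finrank h
  have hinj : Function.Injective tr := by
    refine (injective_iff_map_eq_zero _).2 fun b hb => ?_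
    refine (injective_iff_map_eq_zero _).1 (hS hP (add_zero 0)).bijective_right.injective b ?_
    refine LinearMap.ext fun x => ?_
    obtain ⟨c, rfl⟩ := (finrank_eq_one_iff_of_nonzero' _ hone).1 h x
    change tr (D.comp P P S 0 0 0 (c • D.one P) b) = 0
    rw [map_smul, LinearMap.smul_apply, one_comp, map_smul, hb, smul_zero]
  have := Module.finite_of_finrank_eq_succ h1
  exact ⟨hinj, (LinearMap.injective_iff_surjective_of_finrank_eq_finrank
    (by rw [h1, Module.finrank_self])).1 hinj⟩

/-- Let `ω` be an element of `Hom^d(R, Q)` inducing an isomorphism `Hom^*(W, R) ≅ Hom^{* + d}(W, Q)`,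
and let `φ` be a functional on `Hom^d(P, Q)`. By Serre duality the functional `φ(ω ∘ -)` on
`Hom⁰(P, R)` is given by an element `θ` of `Hom⁰(R, S)`. The pairing given by `φ` on
`Hom^i(P, W) × Hom^j(W, Q)` is perfect if and only if `θ` induces an isomorphism on
`Hom^{-i}(W, -)`. -/
lemma isPerfPair_iff {Q R W : D.Obj} (hW : C W) {d : ℤ} {ω : D.H R Q d} (hω : PostBij ω W)
    {φ : D.H P Q d →ₗ[k] k} {θ : D.H R S 0}
    (hθ : ∀ y : D.H P R 0, tr (D.comp P R S 0 0 0 y θ) = φ (D.comp P R Q 0 d d y ω))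
    {i j p : ℤ} (hij : i + j = d) (hp : i + p = 0) (hfin : Module.Finite k (D.H P W i)) :
    ((D.comp P W Q i j d).compr₂ φ).IsPerfPair ↔
      Function.Bijective fun x : D.H W R p => D.comp W R S p 0 p x θ := by
  have hS' := (hS hW hp).bijective_right
  have hω' := hω (show p + d = j by omega)
  have e : ∀ x : D.H W R p, ((D.comp P W Q i j d).compr₂ φ).flip (D.comp W R Q p d j x ω) =
      ((D.comp P W S i p 0).compr₂ tr).flip (D.comp W R S p 0 p x θ) := by
    refine fun x => LinearMap.ext fun y => ?_
    change φ (D.comp P W Q i j d y (D.comp W R Q p d j x ω)) =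
      tr (D.comp P W S i p 0 y (D.comp W R S p 0 p x θ))
    rw [← D.comp_assoc P W R Q i p d 0 j d (by omega) (by omega), ← hθ,
      D.comp_assoc P W R _ i p 0 0 p 0 (by omega) (by omega)]
  constructor
  · intro h
    exact bijective_of_comm hS' h.bijective_right hω' fun x => (e x).symm
  · intro h
    refine LinearMap.IsPerfPair.flip (p := ((D.comp P W Q i j d).compr₂ φ).flip)
      (.of_bijective _ ?_)
    exact (Function.Bijective.of_comp_iff _ hω').1 ((funext e :
      (((D.comp P W Q i j d).compr₂ φ).flip ∘ fun x => D.comp W R Q p d j x ω) =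
      (((D.comp P W S i p 0).compr₂ tr).flip ∘ fun x => D.comp W R S p 0 p x θ)) ▸ hS'.comp h)

/-- Every functional on `Hom^d(P, Q)` gives rise to an element as in `isPerfPair_iff`. -/
lemma exists_trace_eq {Q R : D.Obj} (hR : C R) {d : ℤ} (ω : D.H R Q d) (φ : D.H P Q d →ₗ[k] k) :
    ∃ θ : D.H R S 0,
      ∀ y : D.H P R 0, tr (D.comp P R S 0 0 0 y θ) = φ (D.comp P R Q 0 d d y ω) := by
  obtain ⟨θ, hθ⟩ := (hS hR (add_zero 0)).bijective_right.surjective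
    (φ.comp ((D.comp P R Q 0 d d).flip ω))
  exact ⟨θ, fun y => LinearMap.congr_fun hθ y⟩

end IsSerreDual

end TriangulatedAInfCategory

namespace TriangulatedAInfCategory

open AInfPrecategory AInfCategory

variable {k : Type w} [Field k] {D : TriangulatedAInfCategory.{w, u, v} k}
  {C : ObjectProperty D.H0}

namespace IsSerreDual

variable {P S : D.Obj} {tr : D.H P S 0 →ₗ[k] k}

/-- The pairing of `Hom^*(P, W)` and `Hom^*(W, Q)` is perfect if and only if `θ` induces an isomorphism
`Hom^*(W, R) ≅ Hom^*(W, S)`. -/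
lemma postBij_iff_isPerfPair (hS : IsSerreDual C tr)
    {Q R W : D.Obj} (hW : C W) {d : ℤ} {ω : D.H R Q d} (hω : PostBij ω W)
    {φ : D.H P Q d →ₗ[k] k} {θ : D.H R S 0}
    (hθ : ∀ y : D.H P R 0, tr (D.comp P R S 0 0 0 y θ) = φ (D.comp P R Q 0 d d y ω))
    (hfin : ∀ i, Module.Finite k (D.H P W i)) :
    PostBij θ W ↔ ∀ j : ℤ, ((D.comp P W Q (d - j) j d).compr₂ φ).IsPerfPair := by
  constructor
  · intro h j
    exact (hS.isPerfPair_iff hW hω hθ (by omega) (show d - j + (j - d) = 0 by omega)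
      (hfin _)).2 (h (add_zero _))
  · intro h p n hn
    obtain rfl : n = p := by omega
    exact (hS.isPerfPair_iff hW hω hθ (by omega) (show d - (n + d) + n = 0 by omega)
      (hfin _)).1 (h (n + d))

/-- If `φ` is an isomorphism from `Hom^*(P, Q)`, concentrated in degree `d`, to `k`, then the
corresponding element `θ` of `Hom⁰(R, S)` induces an isomorphism on `Hom^*(P, -)`. -/
lemma postBij_self (hS : IsSerreDual C tr) (hP : C P)
    (hP₁ : Module.finrank k (D.H P P 0) = 1) (hP₀ : ∀ n ≠ 0, Subsingleton (D.H P P n))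
    {Q R : D.Obj} {d : ℤ} {ω : D.H R Q d} (hω : PostBij ω P)
    {φ : D.H P Q d ≃ₗ[k] k} (hd : ∀ n, n ≠ d → Subsingleton (D.H P Q n)) {θ : D.H R S 0}
    (hθ : ∀ y : D.H P R 0, tr (D.comp P R S 0 0 0 y θ) = φ (D.comp P R Q 0 d d y ω)) :
    PostBij θ P := by
  intro p n hn
  obtain rfl : n = p := by omega
  by_cases h0 : n = 0
  · subst h0
    exact bijective_of_comm (hS.bijective_trace hP hP₁) φ.bijective (hω (zero_add d)) hθ
  · have h₁ : Subsingleton (D.H P S n) := (hS.subsingleton_iff hP (neg_add_cancel n)).1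
      (hP₀ _ (by omega))
    have h₂ : Subsingleton (D.H P R n) :=
      have := hd (n + d) (by omega)
      (hω (show n + d = n + d from rfl)).injective.subsingleton
    exact ⟨fun _ _ _ => h₂.elim _ _, fun y => ⟨0, h₁.elim _ _⟩⟩

/-- The perfectness of the pairings on a family of objects which, together with `P`, generates `C`
implies the perfectness on all objects of `C`. -/
lemma isPerfPair_of_generators (hS : IsSerreDual C tr) (hP : C P)
    (hP₁ : Module.finrank k (D.H P P 0) = 1) (hP₀ : ∀ n ≠ 0, Subsingleton (D.H P P n))
    (hfin : ∀ W, C W → ∀ i, Module.Finite k (D.H P W i))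
    {Q R : D.Obj} (hR : C R) {d : ℤ} {ω : D.H R Q d} (hω : ∀ W, C W → PostBij ω W)
    {φ : D.H P Q d ≃ₗ[k] k} (hd : ∀ n, n ≠ d → Subsingleton (D.H P Q n))
    {ι : Type*} {E : ι → D.Obj} (hCE : C = D.Generated E)
    (h : ∀ i, E i = P ∨ ∀ j : ℤ, ((D.comp P (E i) Q (d - j) j d).compr₂ φ.toLinearMap).IsPerfPair)
    {W : D.Obj} (hW : C W) (j : ℤ) :
    ((D.comp P W Q (d - j) j d).compr₂ φ.toLinearMap).IsPerfPair := by
  have hCE' : ∀ i, C (E i) := fun i => hCE ▸ .of i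
  obtain ⟨θ, hθ⟩ := hS.exists_trace_eq hR ω φ.toLinearMap
  refine (hS.postBij_iff_isPerfPair hW (hω W hW) hθ (hfin W hW)).1 ?_ j
  refine Generated.postBij (fun i => ?_) (hCE ▸ hW : D.Generated E W)
  rcases h i with hi | hi
  · rw [hi]
    exact hS.postBij_self hP hP₁ hP₀ (hω P hP) hd hθ
  · exact (hS.postBij_iff_isPerfPair (hCE' i) (hω _ (hCE' i)) hθ (hfin _ (hCE' i))).2 hi

/-- If the pairings in degrees `0` and `d` are perfect for the objects of `C`, then so are the
pairings in all degrees. -/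
lemma isPerfPair_of_degree_zero (hC : ∀ (n : ℤ) (X Y : D.Obj), D.IsShift n X Y → C X → C Y)
    {Q : D.Obj} {d : ℤ} {φ : D.H P Q d →ₗ[k] k}
    (h : ∀ W, C W → ((D.comp P W Q 0 d d).compr₂ φ).IsPerfPair) {W : D.Obj} (hW : C W) (j : ℤ) :
    ((D.comp P W Q (d - j) j d).compr₂ φ).IsPerfPair := by
  obtain ⟨a, b, hab⟩ := (D.isShift_shift W (d - j)).exists_isInvPair
  exact isPerfPair_of_isInvPair hab.symm _ (by omega) (by omega) (by omega)
    (h _ (hC _ _ _ (D.isShift_shift W (d - j)) hW))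

/-- The pairings are perfect if and only if the object `R` that represents `Hom^d(-, Q)` on `C` is
isomorphic to the Serre dual `S` of `P`. -/
lemma isShift_of_isPerfPair (hS : IsSerreDual C tr) (hSC : C S)
    (hfin : ∀ W, C W → ∀ i, Module.Finite k (D.H P W i))
    {Q R : D.Obj} (hR : C R) {d : ℤ} {ω : D.H R Q d} (hω : ∀ W, C W → PostBij ω W)
    {φ : D.H P Q d →ₗ[k] k} (h : ∀ W, C W → ((D.comp P W Q 0 d d).compr₂ φ).IsPerfPair) :
    D.IsShift 0 R S := by
  obtain ⟨θ, hθ⟩ := hS.exists_trace_eq hR ω φ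
  have hb : ∀ W, C W → Function.Bijective fun x : D.H W R 0 => D.comp W R S 0 0 0 x θ :=
    fun W hW => (hS.isPerfPair_iff hW (hω W hW) hθ (zero_add d) (add_zero 0) (hfin W hW 0)).1 (h W hW)
  obtain ⟨_, hb⟩ := exists_isInvPair_of_bijective (add_zero 0) θ (hb R hR).1 (hb S hSC).2
  exact hb.isShift

lemma exists_isPerfPair_of_isShift (hS : IsSerreDual C tr) (hP : C P)
    (hP₁ : Module.finrank k (D.H P P 0) = 1) (hP₀ : ∀ n ≠ 0, Subsingleton (D.H P P n))
    (hfin : ∀ W, C W → ∀ i, Module.Finite k (D.H P W i))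
    {Q R : D.Obj} {d : ℤ} {ω : D.H R Q d} (hω : ∀ W, C W → PostBij ω W)
    (h : D.IsShift 0 R S) :
    (∀ n, n ≠ d → Subsingleton (D.H P Q n)) ∧ ∃ φ : D.H P Q d ≃ₗ[k] k,
      ∀ W, C W → ((D.comp P W Q 0 d d).compr₂ φ.toLinearMap).IsPerfPair := by
  have h := h.exists_isInvPair
  rw [neg_zero] at h
  obtain ⟨θ, θ', hθ⟩ := h
  have hθb : ∀ W, PostBij θ W := fun W => hθ.postBij
  constructor
  · intro n hn
    have h₁ : Subsingleton (D.H P S (n - d)) := (hS.subsingleton_iff hP (i := d - n) (by omega)).1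
      (hP₀ _ (by omega))
    have h₂ : Subsingleton (D.H P R (n - d)) := (hθb _ (add_zero _)).injective.subsingleton
    exact (hω P hP (by omega : n - d + d = n)).surjective.subsingleton
  · let e₁ : D.H P R 0 ≃ₗ[k] D.H P Q d := LinearEquiv.ofBijective ((D.comp P R Q 0 d d).flip ω)
      (hω P hP (zero_add d))
    let e₂ : D.H P R 0 ≃ₗ[k] D.H P S 0 := LinearEquiv.ofBijective ((D.comp P R S 0 0 0).flip θ)
      (hθb _ (add_zero 0))
    let e₃ : D.H P S 0 ≃ₗ[k] k := LinearEquiv.ofBijective tr (hS.bijective_trace hP hP₁)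
    refine ⟨e₁.symm.trans (e₂.trans e₃), fun W hW => ?_⟩
    refine (hS.isPerfPair_iff hW (hω W hW) (θ := θ) (fun y => ?_) (zero_add d) (add_zero 0)
      (hfin W hW 0)).2 (hθb _ (add_zero 0))
    change _ = tr (e₂ (e₁.symm (e₁ y)))
    rw [e₁.symm_apply_apply]
    rfl

/-- The pairings are perfect on an object `X` if and only if `Hom^*(L, Q)` vanishes for the left
mutation `L` of `X` through `P`. -/
lemma isPerfPair_iff_leftMutation (hS : IsSerreDual C tr) (hP : C P)
    (hP₁ : Module.finrank k (D.H P P 0) = 1) (hP₀ : ∀ n ≠ 0, Subsingleton (D.H P P n))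
    (hfin : ∀ W, C W → ∀ i, Module.Finite k (D.H P W i))
    {Q R : D.Obj} (hR : C R) {d : ℤ} {ω : D.H R Q d} (hω : ∀ W, C W → PostBij ω W)
    {φ : D.H P Q d ≃ₗ[k] k} (hd : ∀ n, n ≠ d → Subsingleton (D.H P Q n))
    {X L : D.Obj} (hX : C X) (hLC : C L)
    (hL : D.IsLeftMutation (D.Generated fun _ : Unit => P) X L) :
    (∀ j : ℤ, ((D.comp P X Q (d - j) j d).compr₂ φ.toLinearMap).IsPerfPair) ↔
      ∀ n, Subsingleton (D.H L Q n) := by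
  obtain ⟨θ, hθ⟩ := hS.exists_trace_eq hR ω φ.toLinearMap
  obtain ⟨K, hK, -⟩ := exists_cone_of_class θ
  have hPK := (hK P).1 (hS.postBij_self hP hP₁ hP₀ (hω P hP) hd hθ)
  obtain ⟨⟨B, hB, B', L', f, g, h, hB', hL', hx⟩, hL₀⟩ := hL
  have hB'K : ∀ n, Subsingleton (D.H B' K n) :=
    ((Generated.shift_iff hB').1 hB).subsingleton_left fun _ => hPK
  rw [← hS.postBij_iff_isPerfPair hX (hω X hX) hθ (hfin X hX), hK]
  have hLS : ∀ n, Subsingleton (D.H L S n) := fun n =>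
    (hS.subsingleton_iff hLC (neg_add_cancel n)).1 (hL₀ P (.of ()) _)
  trans ∀ n, Subsingleton (D.H L K n)
  · refine ⟨fun H n => hL'.symm.subsingleton_left (p := n - 1) (by omega)
      (hx.subsingleton_third' rfl (hB'K _) (H _)), fun H n =>
      hx.subsingleton_second' (p := n - 1) (by omega) rfl (hB'K _)
        (hL'.subsingleton_left (p := n) (by omega) (H _))⟩
  · rw [← hK]
    constructor
    · intro H n
      have := hLS (n - d)
      have h₂ : Subsingleton (D.H L R (n - d)) := (H (add_zero _)).injective.subsingleton
      exact (hω L hLC (by omega : n - d + d = n)).surjective.subsingleton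
    · intro H p n hn
      obtain rfl : n = p := by omega
      have := H (n + d)
      have h₂ : Subsingleton (D.H L R n) := (hω L hLC (rfl : n + d = n + d)).injective.subsingleton
      exact ⟨fun _ _ _ => h₂.elim _ _, fun y => ⟨0, (hLS n).elim _ _⟩⟩

end IsSerreDual

end TriangulatedAInfCategory

namespace AInfCategory

open AInfPrecategory

variable {k : Type w} [Field k] {A : AInfCategory.{w, u, v} k}

/-! ### Total dimensions of graded morphism spaces -/

/-- `Hom^n(X, Y)` vanishes for almost all `n`. -/
def BoundedHom (X Y : A.Obj) : Prop := ∃ N : ℤ, ∀ n, N < |n| → Subsingleton (A.H X Y n)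

/-- The total dimension of `Hom^*(X, Y)` is at most `N`. The sum is taken over a finite set of degrees,
which is allowed to be translated by an integer. -/
def HomDimLE (X Y : A.Obj) (N : ℕ) : Prop :=
  ∃ (c : ℤ) (s : Finset ℤ), (∀ n ∉ s, Subsingleton (A.H X Y (n + c))) ∧
    ∑ n ∈ s, Module.finrank k (A.H X Y (n + c)) ≤ N

lemma BoundedHom.exists_homDimLE {X Y : A.Obj} (h : BoundedHom X Y) : ∃ N, HomDimLE X Y N := by
  obtain ⟨N, hN⟩ := h
  refine ⟨_, 0, Finset.Icc (-N) N, fun n hn => ?_, le_rfl⟩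
  rw [add_zero]
  refine hN n ?_
  by_contra! h
  exact hn (Finset.mem_Icc.2 (abs_le.1 h))

lemma HomDimLE.subsingleton {X Y : A.Obj} (h : HomDimLE X Y 0)
    (hfin : ∀ n, Module.Finite k (A.H X Y n)) (n : ℤ) : Subsingleton (A.H X Y n) := by
  obtain ⟨c, s, hs, hs'⟩ := h
  obtain ⟨n, rfl⟩ : ∃ n', n = n' + c := ⟨n - c, by omega⟩
  by_cases hn : n ∈ s
  · exact Module.finrank_zero_iff.1 (Finset.sum_eq_zero_iff.1 (Nat.le_zero.1 hs') n hn)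
  · exact hs n hn

/-- Surjections `Hom^n(X, Y) → Hom^{n + c}(X', Y')`, at least one of which is not injective, decrease
the total dimension. -/
lemma HomDimLE.of_surjective {X Y X' Y' : A.Obj} {N : ℕ} (h : HomDimLE X Y (N + 1))
    (hfin : ∀ n, Module.Finite k (A.H X Y n)) {c : ℤ}
    (f : ∀ n, A.H X Y n →ₗ[k] A.H X' Y' (n + c)) (hf : ∀ n, Function.Surjective (f n)) {i : ℤ}
    {x : A.H X Y i} (hx : x ≠ 0) (hx' : f i x = 0) : HomDimLE X' Y' N := by
  obtain ⟨c', s, hs, hs'⟩ := h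
  obtain ⟨i, rfl⟩ : ∃ n', i = n' + c' := ⟨i - c', by omega⟩
  have hi : i ∈ s := by
    by_contra hi
    exact hx ((hs i hi).elim _ _)
  refine ⟨c' + c, s, fun n hn => ?_, Nat.lt_succ_iff.1 (lt_of_lt_of_le ?_ hs')⟩
  · have := hs n hn
    rw [← add_assoc]
    exact (hf _).subsingleton
  · refine Finset.sum_lt_sum (fun n _ => ?_) ⟨i, hi, ?_⟩
    · rw [← add_assoc]
      exact LinearMap.finrank_le_finrank_of_surjective (hf (n + c'))
    · rw [← add_assoc, ← (f (i + c')).finrank_range_add_finrank_ker,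
        LinearMap.range_eq_top.2 (hf _), finrank_top]
      refine Nat.lt_add_of_pos_right ?_
      rw [Module.finrank_pos_iff]
      exact ⟨⟨x, hx'⟩, 0, fun e => hx (congrArg Subtype.val e)⟩

end AInfCategory

namespace TriangulatedAInfCategory

open AInfPrecategory AInfCategory

variable {k : Type w} [Field k] {D : TriangulatedAInfCategory.{w, u, v} k}

namespace Generated

variable {ι : Type*} {E : ι → D.Obj}

/-- Boundedness of the morphisms from a fixed object is inherited by triangulated subcategories. -/
lemma boundedHom_right {W : D.Obj} (h : ∀ i, BoundedHom W (E i)) {X : D.Obj}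
    (hX : D.Generated E X) : BoundedHom W X := by
  refine induction (P := fun X => BoundedHom W X) h ?_ ?_ hX
  · rintro n X Y hXY ⟨N, hN⟩
    exact ⟨N + |n|, fun p hp => hXY.subsingleton_right (p := p + n) (by omega) (hN _ (by grind))⟩
  · intro X Y Z f g h hx
    refine ⟨?_, ?_, ?_⟩ <;> rintro ⟨N, hN⟩ ⟨N', hN'⟩
    · exact ⟨max N N' + 1, fun n hn => hx.subsingleton_first rfl (hN _ (by grind)) (hN' _ (by grind))⟩
    · exact ⟨max N N' + 1, fun n hn => hx.subsingleton_second (p := n - 1) (by omega) rfl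
        (hN _ (by grind)) (hN' _ (by grind))⟩
    · exact ⟨max N N' + 1, fun n hn => hx.subsingleton_third (p := n - 1) (by omega)
        (hN _ (by grind)) (hN' _ (by grind))⟩

/-- Boundedness of the morphisms to a fixed object is inherited by triangulated subcategories. -/
lemma boundedHom_left {W : D.Obj} (h : ∀ i, BoundedHom (E i) W) {X : D.Obj}
    (hX : D.Generated E X) : BoundedHom X W := by
  refine induction (P := fun X => BoundedHom X W) h ?_ ?_ hX
  · rintro n X Y hXY ⟨N, hN⟩
    exact ⟨N + |n|, fun p hp => hXY.subsingleton_left (p := p - n) (by omega) (hN _ (by grind))⟩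
  · intro X Y Z f g h hx
    refine ⟨?_, ?_, ?_⟩ <;> rintro ⟨N, hN⟩ ⟨N', hN'⟩
    · exact ⟨max N N' + 1, fun n hn => hx.subsingleton_first' (p := n - 1) (by omega)
        (hN _ (by grind)) (hN' _ (by grind))⟩
    · exact ⟨max N N' + 1, fun n hn => hx.subsingleton_second' (p := n - 1) (by omega) rfl
        (hN _ (by grind)) (hN' _ (by grind))⟩
    · exact ⟨max N N' + 1, fun n hn => hx.subsingleton_third' rfl
        (hN _ (by grind)) (hN' _ (by grind))⟩

/-- In a category which is generated by an exceptional collection and has Serre duals, the graded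
morphism spaces are bounded: for `i < j` one has `Hom^*(E j, E i) = 0`, and `Hom^*(E i, E j)` is dual
to `Hom^*(E j, S)`, where `S` is the Serre dual of `E i`. -/
lemma boundedHom {m : ℕ} {E : Fin m → D.Obj} (hE : D.IsExceptionalCollection E)
    (hS : ∀ i, ∃ (S : D.Obj) (tr : D.H (E i) S 0 →ₗ[k] k), D.Generated E S ∧
      IsSerreDual (D.Generated E) tr) {X Y : D.Obj} (hX : D.Generated E X) (hY : D.Generated E Y) :
    BoundedHom X Y := by
  refine hX.boundedHom_left fun j => ?_
  induction j using WellFoundedGT.induction generalizing Y with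
  | ind j ih =>
    refine hY.boundedHom_right fun i => ?_
    rcases lt_trichotomy i j with hij | rfl | hij
    · exact ⟨0, fun n _ => hE.eq_zero i j n hij⟩
    · exact ⟨0, fun n hn => hE.self_eq_zero i n (abs_pos.1 hn)⟩
    · obtain ⟨S, tr, hSC, hS⟩ := hS j
      obtain ⟨N, hN⟩ := ih i hij hSC
      exact ⟨N, fun n hn => (hS.subsingleton_iff (.of i) (add_neg_cancel n)).2
        (hN _ (by rwa [abs_neg]))⟩

end Generated

/-! ### Killing morphisms by exceptional objects -/

/-- The mapping cone of a nonzero element of `Hom^i(W, Y)`, with `W` exceptional, has a smaller space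
of morphisms from `W`. -/
lemma exists_isExact_homDimLE_left {W Y : D.Obj} (hW : Module.finrank k (D.H W W 0) = 1)
    (hW₀ : ∀ n ≠ 0, Subsingleton (D.H W W n)) {i : ℤ} {x : D.H W Y i} (hx₀ : x ≠ 0) {N : ℕ}
    (hN : HomDimLE W Y (N + 1)) (hfin : ∀ n, Module.Finite k (D.H W Y n)) :
    ∃ (X Z : D.Obj) (f : D.hom X Y 1) (g : D.hom Y Z 1) (h : D.hom X Z 1) (n : ℤ),
      D.IsExact f g h ∧ D.IsShift n W X ∧ HomDimLE W Z N := by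
  obtain ⟨X, Z, f, g, h, hx, a, b, hab, hfx⟩ := exists_isExact (j := i - 1) (by omega) x
  refine ⟨X, Z, f, g, h, _, hx, hab.isShift, ?_⟩
  have hinj : ∀ (n : ℤ) (y : D.H W X n),
      D.comp W X Y n 1 (n + 1) y (cls f hx.left_mem) = 0 → y = 0 := by
    intro n y hy
    obtain ⟨z, rfl⟩ := (hab.bijective_comp_right W (show n - (i - 1) + (i - 1) = n by omega)).2 y
    by_cases hn : n = i - 1
    · subst hn
      obtain ⟨e, he⟩ : ∃ e : ℤ, e = i - 1 - (i - 1) := ⟨_, rfl⟩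
      revert z
      rw [← he, show e = 0 by omega]
      intro z hy
      obtain ⟨c, rfl⟩ := (finrank_eq_one_iff_of_nonzero' _ (one_ne_zero_of_finrank hW)).1 hW z
      simp only [map_smul, LinearMap.smul_apply, one_comp] at hy ⊢
      rw [show i - 1 + 1 = i by omega, hfx, smul_eq_zero_iff_left hx₀] at hy
      rw [hy, zero_smul]
    · have := hW₀ (n - (i - 1)) (by omega)
      simp only [Subsingleton.elim z 0, map_zero, LinearMap.zero_apply]
  refine hN.of_surjective hfin (c := 1)
    (fun n => (D.comp W Y Z n 1 (n + 1)).flip (cls g hx.right_mem))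
    (fun n z => hx.exists_comp_right_eq rfl (hinj n) z) hx₀ ?_
  change D.comp W Y Z i 1 (i + 1) x (cls g hx.right_mem) = 0
  rw [← hfx, D.comp_assoc W X Y Z (i - 1) 1 1 i 2 (i + 1) (by omega) (by omega), hx.comp_eq_zero,
    map_zero]

/-- The mapping cone of a nonzero element of `Hom^i(Y, W)`, with `W` exceptional, has a smaller space
of morphisms to `W`. -/
lemma exists_isExact_homDimLE_right {W Y : D.Obj} (hW : Module.finrank k (D.H W W 0) = 1)
    (hW₀ : ∀ n ≠ 0, Subsingleton (D.H W W n)) {i : ℤ} {x : D.H Y W i} (hx₀ : x ≠ 0) {N : ℕ}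
    (hN : HomDimLE Y W (N + 1)) (hfin : ∀ n, Module.Finite k (D.H Y W n)) :
    ∃ (X Z : D.Obj) (f : D.hom X W 1) (g : D.hom W Z 1) (h : D.hom X Z 1) (n : ℤ),
      D.IsExact f g h ∧ D.IsShift n Y X ∧ HomDimLE Z W N := by
  obtain ⟨X, Z, f, g, h, hx, a, b, hab, hfx⟩ := exists_isExact (j := i - 1) (by omega) x
  refine ⟨X, Z, f, g, h, _, hx, hab.isShift, ?_⟩
  obtain ⟨κ, -, hκf, -, hκ⟩ := hx.exists_connecting
  have hf₀ : cls f hx.left_mem ≠ 0 := by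
    intro e
    rw [e, map_zero] at hfx
    exact hx₀ hfx.symm
  have hinj : ∀ (n : ℤ) (y : D.H W W n),
      D.comp X W W 1 n (1 + n) (cls f hx.left_mem) y = 0 → y = 0 := by
    intro n y hy
    by_cases hn : n = 0
    · subst hn
      obtain ⟨c, rfl⟩ := (finrank_eq_one_iff_of_nonzero' _ (one_ne_zero_of_finrank hW)).1 hW y
      rw [map_smul] at hy
      rw [show (1 : ℤ) + 0 = 1 by omega, comp_one, smul_eq_zero_iff_left hf₀] at hy
      rw [hy, zero_smul]
    · have := hW₀ n hn
      exact Subsingleton.elim _ _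
  have hker : ∀ q r, q = 1 → r = 0 →
      D.comp Z X W (-1) q r κ (D.comp X Y W (-(i - 1)) i q b x) = 0 := by
    rintro _ _ rfl rfl
    rw [← hfx, hab.symm.comp_comp_right (by omega)]
    exact hκf
  -- composition with the connecting element, after the identification of `Y` with a shift of `X`
  refine hN.of_surjective hfin (c := -i)
    (fun n => (D.comp Z X W (-1) (n + 1 - i) (n + -i) κ).comp
      (D.comp X Y W (-(i - 1)) n (n + 1 - i) b)) (fun n c => ?_) hx₀
    (hker _ _ (by omega) (by omega))
  obtain ⟨y, rfl⟩ := hκ (show n + 1 - i = n + -i + 1 by omega) c (hinj _ _ (by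
    rw [← D.comp_assoc X W Z W 1 1 (n + -i) 2 _ _ rfl (by omega), hx.comp_eq_zero, map_zero,
      LinearMap.zero_apply]))
  obtain ⟨z, rfl⟩ := (hab.symm.bijective_comp_left W (show -(i - 1) + n = n + 1 - i by omega)).2 y
  exact ⟨z, rfl⟩

/-- By successive mapping cones, all morphisms from an exceptional object `W` to an object `Y` can be
killed. -/
lemma exists_subsingleton_left {C : ObjectProperty D.H0} {κ : Type*} {G : κ → D.Obj}
    (hC : C = D.Generated G) {W : D.Obj} (hCW : C W)
    (hW : Module.finrank k (D.H W W 0) = 1) (hW₀ : ∀ n ≠ 0, Subsingleton (D.H W W n))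
    (hfin : ∀ Y, C Y → ∀ n, Module.Finite k (D.H W Y n)) {ι : Type*} {E : ι → D.Obj}
    (hE : D.Generated E W) {N : ℕ} {Y : D.Obj} (hY : C Y) (hN : HomDimLE W Y N) :
    ∃ Z : D.Obj, C Z ∧ (D.Generated E Z → D.Generated E Y) ∧ (∀ n, Subsingleton (D.H W Z n)) ∧
      ∀ V : D.Obj, (∀ n, Subsingleton (D.H V W n)) → (∀ n, Subsingleton (D.H V Y n)) →
        ∀ n, Subsingleton (D.H V Z n) := by
  induction N generalizing Y with
  | zero => exact ⟨Y, hY, id, hN.subsingleton (hfin Y hY), fun _ _ h => h⟩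
  | succ N ih =>
    by_cases h0 : ∀ n, Subsingleton (D.H W Y n)
    · exact ⟨Y, hY, id, h0, fun _ _ h => h⟩
    push Not at h0
    obtain ⟨i, hi⟩ := h0
    obtain ⟨x, hx₀⟩ := exists_ne (0 : D.H W Y i)
    obtain ⟨X, Z, f, g, h, l, hx, hWX, hN'⟩ :=
      exists_isExact_homDimLE_left hW hW₀ hx₀ hN (hfin Y hY)
    have hZ : C Z := by
      rw [hC] at hY hCW ⊢
      exact Generated.third hx ((Generated.shift_iff hWX).1 hCW) hY
    obtain ⟨Z', hZ', h₁, h₂, h₃⟩ := ih hZ hN'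
    refine ⟨Z', hZ', fun h => Generated.second hx ((Generated.shift_iff hWX).1 hE) (h₁ h), h₂,
      fun V hV hV' => h₃ V hV fun n => ?_⟩
    exact hx.subsingleton_third (p := n - 1) (by omega)
      (hWX.subsingleton_right (p := n - 1 + l) (by omega) (hV _)) (hV' _)

/-- By successive mapping cones, the morphisms from all but the first object of an exceptional
collection can be killed. -/
lemma exists_subsingleton_tail {C : ObjectProperty D.H0} {κ : Type*} {G : κ → D.Obj}
    (hC : C = D.Generated G) {m : ℕ} {E : Fin m → D.Obj} (hE : D.IsExceptionalCollection E)
    (hCE : ∀ i, C (E i)) (hfin : ∀ X Y, C X → C Y → ∀ n, Module.Finite k (D.H X Y n))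
    (hbdd : ∀ X Y, C X → C Y → BoundedHom X Y) {Y : D.Obj} (hY : C Y) :
    ∀ r ≤ m, ∃ Z : D.Obj, C Z ∧ (D.Generated E Z → D.Generated E Y) ∧
      ∀ i : Fin m, r ≤ i.1 → ∀ n, Subsingleton (D.H (E i) Z n) := by
  intro r hr
  induction hr using Nat.decreasingInduction with
  | self => exact ⟨Y, hY, id, fun i hi => absurd i.2 (by omega)⟩
  | of_succ r hr ih =>
    obtain ⟨Z, hZ, h₁, h₂⟩ := ih
    let i : Fin m := ⟨r, hr⟩
    obtain ⟨N, hN⟩ := (hbdd _ _ (hCE i) hZ).exists_homDimLE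
    obtain ⟨Z', hZ', h₁', h₂', h₃'⟩ := exists_subsingleton_left hC (hCE i) (hE.finrank_self i)
      (hE.self_eq_zero i) (fun Y hY => hfin _ _ (hCE i) hY) (.of i : D.Generated E (E i)) hZ hN
    refine ⟨Z', hZ', h₁ ∘ h₁', fun j hj => ?_⟩
    rcases hj.eq_or_lt with hj | hj
    · obtain rfl : i = j := Fin.ext hj
      exact h₂'
    · exact h₃' _ (fun n => hE.eq_zero i j n hj) (h₂ j hj)

/-- The canonical map from an object to its left mutation through an object `P`. -/
lemma IsLeftMutation.exists_map {P X L : D.Obj}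
    (hL : D.IsLeftMutation (D.Generated fun _ : Unit => P) X L) :
    ∃ γ : D.H X L 0, (∀ W, (∀ n, Subsingleton (D.H P W n)) → PreBij γ W) ∧
      ∀ W, (∀ n, Subsingleton (D.H W P n)) → PostBij γ W := by
  obtain ⟨⟨B, hB, B', L', f, g, h, hB', hL', hx⟩, -⟩ := hL
  have hB'' := (Generated.shift_iff hB').1 hB
  obtain ⟨a, b, hab⟩ := hL'.exists_isInvPair
  obtain ⟨κ, -, -, -, hκ⟩ := hx.exists_connecting
  refine ⟨D.comp X L' L 1 (-1) 0 (cls g hx.right_mem) b, fun W hW => ?_, fun W hW => ?_⟩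
  · refine PreBij.comp (fun p n hn => ⟨injective_comp_left_iff.2 fun c hc => ?_, fun c => ?_⟩)
      hab.symm.preBij (by omega)
    · obtain ⟨y, rfl⟩ := hκ rfl c (by obtain rfl : n = p + 1 := by omega
                                      exact hc)
      rw [(hB''.subsingleton_left (fun _ => hW) _).elim y 0, map_zero]
    · exact hx.exists_comp_right_eq' (by omega) rfl c
        ((hB''.subsingleton_left (fun _ => hW) _).elim _ _)
  · have hB₀ := hB''.subsingleton_right fun _ => hW
    refine PostBij.comp (fun p n hn => ⟨injective_comp_right_iff.2 fun c hc => ?_, fun c => ?_⟩)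
      hab.symm.postBij (by omega)
    · obtain ⟨y, rfl⟩ := hx.exists_comp_left_eq (p := p - 1) (by omega) hn.symm c hc
      rw [(hB₀ _).elim y 0, map_zero, LinearMap.zero_apply]
    · exact hx.exists_comp_right_eq hn.symm (fun y _ => (hB₀ _).elim _ _) c

end TriangulatedAInfCategory

namespace TriangulatedAInfCategory

open AInfPrecategory AInfCategory

variable {k : Type w} [Field k] {D : TriangulatedAInfCategory.{w, u, v} k}

/-! ### The exceptional collection starting with the Serre dual -/

/-- A subcategory generated by a nonempty family contains the zero objects: they are the cones of
units. -/
lemma Generated.of_one_eq_zero {ι : Type*} {E : ι → D.Obj} (i : ι) {Z : D.Obj} (hZ : D.one Z = 0) :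
    D.Generated E Z := by
  obtain ⟨X', Z₀, f, g, h, hx, a, b, hab, hf⟩ :=
    exists_isExact (j := -1) (by omega) (D.one (E i))
  have h₀ : D.one Z₀ = 0 := by
    have := hx.postBij_iff (W := Z₀).1 ((PostBij.comp_isInvPair_iff hab (by omega)).1
      (hf ▸ (isInvPair_one (E i)).postBij)) 0
    exact Subsingleton.elim _ _
  refine (shift_iff (n := 0) ?_).1 (third hx ((shift_iff hab.isShift).1 (.of i)) (.of i))
  exact ⟨0, 0, by rw [h₀, map_zero], by rw [hZ, map_zero]⟩

variable {m : ℕ} [NeZero m] {E L : Fin m → D.Obj} {S : D.Obj} {tr : D.H (E 0) S 0 →ₗ[k] k}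

/-- The left mutations of the objects of an exceptional collection through its first object `E 0`,
preceded by the Serre dual of `E 0`, form an exceptional collection. -/
lemma isExceptionalCollection_update (hE : D.IsExceptionalCollection E)
    (hL : ∀ i, i ≠ 0 → D.IsLeftMutation (D.Generated fun _ : Unit => E 0) (E i) (L i))
    (hLC : ∀ i, i ≠ 0 → D.Generated E (L i)) (hSC : D.Generated E S)
    (hS : IsSerreDual (D.Generated E) tr) :
    D.IsExceptionalCollection (Function.update L 0 S) := by
  have hPL : ∀ i, i ≠ 0 → ∀ n, Subsingleton (D.H (E 0) (L i) n) :=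
    fun i hi n => (hL i hi).2 _ (.of ()) n
  have e : ∀ i j (hi : i ≠ 0) (hj : j ≠ 0) n, Nonempty (D.H (E i) (E j) n ≃ₗ[k] D.H (L i) (L j) n) := by
    intro i j hi hj n
    obtain ⟨γ, hγ, -⟩ := (hL i hi).exists_map
    obtain ⟨γ', -, hγ'⟩ := (hL j hj).exists_map
    exact ⟨(LinearEquiv.ofBijective ((D.comp (E i) (E j) (L j) n 0 n).flip γ') (hγ' _
      (fun n => hE.eq_zero 0 i n (Fin.pos_iff_ne_zero.2 hi)) (add_zero n))).trans
      (LinearEquiv.ofBijective (D.comp (E i) (L i) (L j) 0 n n γ)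
        (hγ _ (hPL j hj) (zero_add n))).symm⟩
  refine ⟨fun i => ?_, fun i n hn => ?_, fun i j n hij => ?_⟩
  · rcases eq_or_ne i 0 with rfl | hi
    · rw [Function.update_self, hS.finrank_eq hSC (add_zero 0),
        hS.finrank_eq (.of 0) (add_zero 0), hE.finrank_self]
    · obtain ⟨e⟩ := e i i hi hi 0
      rw [Function.update_of_ne hi, ← e.finrank_eq, hE.finrank_self]
  · rcases eq_or_ne i 0 with rfl | hi
    · rw [Function.update_self, ← hS.subsingleton_iff hSC (neg_add_cancel n),
        ← hS.subsingleton_iff (.of 0) (add_neg_cancel n)]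
      exact hE.self_eq_zero 0 n hn
    · obtain ⟨e⟩ := e i i hi hi n
      rw [Function.update_of_ne hi, ← e.toEquiv.subsingleton_congr]
      exact hE.self_eq_zero i n hn
  · have hj : j ≠ 0 := by
      rintro rfl
      exact absurd hij (Fin.not_lt_zero i)
    rw [Function.update_of_ne hj]
    rcases eq_or_ne i 0 with rfl | hi
    · rw [Function.update_self, ← hS.subsingleton_iff (hLC j hj) (neg_add_cancel n)]
      exact hPL j hj _
    · obtain ⟨e⟩ := e j i hj hi n
      rw [Function.update_of_ne hi, ← e.toEquiv.subsingleton_congr]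
      exact hE.eq_zero i j n hij

/-- An object which is right orthogonal to all the left mutations `L i` is in the subcategory generated
by the Serre dual `S` of `E 0`: the morphisms to `S` can be killed by mapping cones, and an
object that is right orthogonal to the `L i` and to `E 0` vanishes. -/
lemma generated_of_subsingleton_mutations
    (hL : ∀ i, i ≠ 0 → D.IsLeftMutation (D.Generated fun _ : Unit => E 0) (E i) (L i))
    (hSC : D.Generated E S) (hS : IsSerreDual (D.Generated E) tr)
    (hfin : ∀ X Y, D.Generated E X → D.Generated E Y → ∀ n, Module.Finite k (D.H X Y n))
    (hE' : D.IsExceptionalCollection (Function.update L 0 S)) {N : ℕ} {Z : D.Obj}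
    (hZ : D.Generated E Z) (hN : HomDimLE Z S N)
    (hLZ : ∀ i, i ≠ 0 → ∀ n, Subsingleton (D.H (L i) Z n)) :
    D.Generated (Function.update L 0 S) Z := by
  have hS₁ := hE'.finrank_self 0
  have hS₀ := hE'.self_eq_zero 0
  have hLS : ∀ i, i ≠ 0 → ∀ n, Subsingleton (D.H (L i) S n) := fun i hi n => by
    have := hE'.eq_zero 0 i n (Fin.pos_iff_ne_zero.2 hi)
    rwa [Function.update_self, Function.update_of_ne hi] at this
  rw [Function.update_self] at hS₁ hS₀
  have hgS : D.Generated (Function.update L 0 S) S := by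
    have : D.Generated (Function.update L 0 S) (Function.update L 0 S 0) := .of 0
    rwa [Function.update_self] at this
  have base : ∀ Z, D.Generated E Z → (∀ i, i ≠ 0 → ∀ n, Subsingleton (D.H (L i) Z n)) →
      (∀ n, Subsingleton (D.H Z S n)) → D.Generated (Function.update L 0 S) Z := by
    intro Z hZ hLZ h0
    have hPZ : ∀ n, Subsingleton (D.H (E 0) Z n) := fun n =>
      (hS.subsingleton_iff hZ (add_neg_cancel n)).2 (h0 _)
    refine .of_one_eq_zero 0 ((hZ.subsingleton_left (fun i => ?_) 0).elim _ _)
    rcases eq_or_ne i 0 with rfl | hi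
    · exact hPZ
    · obtain ⟨γ, hγ, -⟩ := (hL i hi).exists_map
      intro n
      have := hLZ i hi n
      exact (hγ Z hPZ (zero_add n)).surjective.subsingleton
  induction N generalizing Z with
  | zero => exact base Z hZ hLZ (hN.subsingleton (hfin Z S hZ hSC))
  | succ N ih =>
    by_cases h0 : ∀ n, Subsingleton (D.H Z S n)
    · exact base Z hZ hLZ h0
    push Not at h0
    obtain ⟨i, hi⟩ := h0
    obtain ⟨x, hx₀⟩ := exists_ne (0 : D.H Z S i)
    obtain ⟨X, K, f, g, h, l, hx, hZX, hN'⟩ :=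
      exists_isExact_homDimLE_right hS₁ hS₀ hx₀ hN (hfin Z S hZ hSC)
    have hK : D.Generated E K := .third hx ((Generated.shift_iff hZX).1 hZ) hSC
    refine (Generated.shift_iff hZX).2 (.first hx hgS (ih hK hN' fun i hi n => ?_))
    exact hx.subsingleton_third (p := n - 1) (by omega)
      (hZX.subsingleton_right (p := n - 1 + l) (by omega) (hLZ i hi _)) (hLS i hi _)

/-- The left mutations of the objects of an exceptional collection through its first object `E 0`,
preceded by the Serre dual of `E 0`, generate the same subcategory as the given collection. -/
lemma generated_update_eq (hE : D.IsExceptionalCollection E)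
    (hL : ∀ i, i ≠ 0 → D.IsLeftMutation (D.Generated fun _ : Unit => E 0) (E i) (L i))
    (hLC : ∀ i, i ≠ 0 → D.Generated E (L i)) (hSC : D.Generated E S)
    (hS : IsSerreDual (D.Generated E) tr)
    (hfin : ∀ X Y, D.Generated E X → D.Generated E Y → ∀ n, Module.Finite k (D.H X Y n))
    (hbdd : ∀ X Y, D.Generated E X → D.Generated E Y → BoundedHom X Y) :
    D.Generated (Function.update L 0 S) = D.Generated E := by
  have hE' := isExceptionalCollection_update hE hL hLC hSC hS
  have hCE' : ∀ i, D.Generated E (Function.update L 0 S i) := by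
    intro i
    rcases eq_or_ne i 0 with rfl | hi
    · rwa [Function.update_self]
    · rw [Function.update_of_ne hi]
      exact hLC i hi
  funext Y
  refine propext ⟨fun hY => hY.of_forall hCE', fun hY => ?_⟩
  obtain ⟨Z, hZ, h₁, h₂⟩ := exists_subsingleton_tail rfl hE' hCE' hfin hbdd hY 1 (NeZero.one_le)
  obtain ⟨N, hN⟩ := (hbdd Z S hZ hSC).exists_homDimLE
  refine h₁ (generated_of_subsingleton_mutations hL hSC hS hfin hE' hZ hN fun i hi n => ?_)
  have := h₂ i (Nat.one_le_iff_ne_zero.2 fun e => hi (Fin.ext (by simpa using e))) n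
  rwa [Function.update_of_ne hi] at this

end TriangulatedAInfCategory

/-! ### Sums over the decompositions of a string -/

namespace Chain

variable {Obj : Type u} {hom : Obj → Obj → ℤ → Type v} {M : Type*} [AddCommMonoid M]

/-- A sum over the cuts of a string whose terms vanish unless the second part is empty. -/
lemma sum_splits_eq_right {X Y : Obj} (c : Chain hom X Y)
    (G : ∀ Z : Obj, Chain hom X Z → Chain hom Z Y → M)
    (hG : ∀ (Z W : Obj) (p : Chain hom X Z) (d : ℤ) (a : hom Z W d) (r : Chain hom W Y),
      G Z p (cons d a r) = 0) :
    (c.splits.map fun s => G s.1 s.2.1 s.2.2).sum = G Y c (nil Y) := by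
  induction c with
  | nil X => simp [splits]
  | cons d a c ih =>
    simp only [splits, List.map_cons, List.map_map, List.sum_cons, hG, zero_add, Function.comp_def]
    exact ih (fun Z p r => G Z (cons d a p) r) fun Z W p d' a' r => hG _ _ _ _ _ _

/-- A sum over the cuts of a string whose terms vanish unless the first part is empty. -/
lemma sum_splits_eq_left {X Y : Obj} (c : Chain hom X Y)
    (G : ∀ Z : Obj, Chain hom X Z → Chain hom Z Y → M)
    (hG : ∀ (Z W : Obj) (d : ℤ) (a : hom X Z d) (p : Chain hom Z W) (r : Chain hom W Y),
      G W (cons d a p) r = 0) :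
    (c.splits.map fun s => G s.1 s.2.1 s.2.2).sum = G X (nil X) c := by
  cases c with
  | nil X => simp [splits]
  | cons d a c => simp [splits, Function.comp_def, hG]

lemma append_nil {X Y : Obj} (c : Chain hom X Y) : c.append (nil Y) = c := by
  induction c with
  | nil X => rfl
  | cons d a c ih => exact congrArg (cons d a) ih

lemma length_append {X Y Z : Obj} (c : Chain hom X Y) (c' : Chain hom Y Z) :
    (c.append c').length = c.length + c'.length := by
  induction c with
  | nil X => exact (zero_add _).symm
  | cons d a c ih => simp only [append, length, ih]; omega

section blocks

variable {Obj' : Type*} {hom' : Obj' → Obj' → ℤ → Type*} (φ : Obj → Obj')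
  (F : ∀ {X Y : Obj}, Chain hom X Y → ∀ n : ℤ, hom' (φ X) (φ Y) n)

lemma blocks_nil {X Y : Obj} (acc : Chain hom X Y) :
    blocks φ F acc (nil Y) = [single (acc.rdeg + 1) (F acc (acc.rdeg + 1))] := rfl

lemma blocks_cons {X Y Z W : Obj} (acc : Chain hom X Y) (d : ℤ) (a : hom Y Z d)
    (c : Chain hom Z W) : blocks φ F acc (cons d a c) =
      blocks φ F (acc.append (single d a)) c ++
        (blocks φ F (single d a) c).map (cons (acc.rdeg + 1) (F acc (acc.rdeg + 1))) := rfl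

end blocks

/-- In a string `a, c`, an operation is applied either to an initial part, or inside of `c`. -/
lemma insertions_cons (μ : ∀ {X Y : Obj}, Chain hom X Y → ∀ n : ℤ, hom X Y n) {X Y Z : Obj}
    (d : ℤ) (a : hom X Y d) (c : Chain hom Y Z) :
    (cons d a c).insertions μ =
      ((cons d a c).splits.map fun t =>
        (1, cons (t.2.1.rdeg + 2) (μ t.2.1 (t.2.1.rdeg + 2)) t.2.2)) ++
      (c.insertions μ).map fun s => ((d - 1).negOnePow * s.1, cons d a s.2) := by
  simp only [insertions, splits, List.flatMap_cons, List.flatMap_map, List.map_flatMap, List.map_map,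
    Function.comp_def, rdeg, append, Int.negOnePow_add, Int.negOnePow_zero]

lemma sum_insertions (μ : ∀ {X Y : Obj}, Chain hom X Y → ∀ n : ℤ, hom X Y n) {X Y : Obj}
    (c : Chain hom X Y) (g : ℤˣ → Chain hom X Y → M) :
    ((c.insertions μ).map fun s => g s.1 s.2).sum =
      (c.splits.map fun s => (s.2.2.splits.map fun t => g s.2.1.rdeg.negOnePow
        (s.2.1.append (cons (t.2.1.rdeg + 2) (μ t.2.1 (t.2.1.rdeg + 2)) t.2.2))).sum).sum := by
  simp only [insertions, List.flatMap_def, List.map_flatten, List.sum_flatten, List.map_map,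
    Function.comp_def]

end Chain

namespace AInfPrecategory

variable {k : Type w} [Field k] (A : AInfPrecategory.{w, u, v} k)

/-! ### The functor of directed categories given by a closed morphism -/

/-- Strings of composable elements of a directed category. -/
abbrev UpperChain {N : ℕ} (X : Fin N → A.Obj) (i j : Fin N) : Type v :=
  Chain (fun i j n => A.upper X i j n) i j

/-- The string in the ambient category underlying a string in a directed category. -/
abbrev ambient {N : ℕ} (X : Fin N → A.Obj) {i j : Fin N} (c : A.UpperChain X i j) :
    Chain A.hom (X i) (X j) :=
  c.map X fun a => a.1

variable {A} {m : ℕ} {S T : A.Obj} {E : Fin m → A.Obj}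

lemma upper_zero_eq {X : Fin (m + 1) → A.Obj} {i : Fin (m + 1)} {n : ℤ} (a b : A.upper X i 0 n) :
    a = b :=
  Subtype.ext ((a.2 (Fin.not_lt_zero i)).trans (b.2 (Fin.not_lt_zero i)).symm)

variable (S T E) in
/-- The identity on the morphism spaces between the last `m` objects, and zero on the others. -/
def idPart : ∀ (i j : Fin (m + 1)) (n : ℤ),
    A.upper (Fin.cons S E : Fin (m + 1) → A.Obj) i j n →
      A.upper (Fin.cons T E : Fin (m + 1) → A.Obj) i j n :=
  fun i j n => Fin.cases
    (motive := fun i => A.upper (Fin.cons S E : Fin (m + 1) → A.Obj) i j n →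
      A.upper (Fin.cons T E : Fin (m + 1) → A.Obj) i j n)
    (fun _ => 0)
    (fun i' => Fin.cases
      (motive := fun j => A.upper (Fin.cons S E : Fin (m + 1) → A.Obj) i'.succ j n →
        A.upper (Fin.cons T E : Fin (m + 1) → A.Obj) i'.succ j n)
      (fun _ => 0) (fun _ a => ⟨a.1, a.2⟩) j) i

variable (S T E) in
/-- The component of the functor on strings between the last `m` objects: the identity on strings
with one element, and zero otherwise. -/
def linPart : ∀ {i j : Fin (m + 1)},
    A.UpperChain (Fin.cons S E : Fin (m + 1) → A.Obj) i j → ∀ n : ℤ,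
      A.upper (Fin.cons T E : Fin (m + 1) → A.Obj) i j n
  | _, _, .nil _, _ => 0
  | _, _, .cons d a (.nil _), n => if h : d = n then idPart S T E _ _ n (h ▸ a) else 0
  | _, _, .cons _ _ (.cons _ _ _), _ => 0

/-- The components of the functor `end→(S, E) → end→(T, E)` given by an element `f` of `hom⁰(T, S)`: the
operations `(a₁, …, a_s) ↦ μ(a_s, …, a₁, f)` on strings starting at `S`, and the identity on the last
`m` objects. -/
def precompF (f : A.hom T S 0) {i j : Fin (m + 1)}
    (c : A.UpperChain (Fin.cons S E : Fin (m + 1) → A.Obj) i j) (n : ℤ) :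
    A.upper (Fin.cons T E : Fin (m + 1) → A.Obj) i j n :=
  Fin.cases
    (motive := fun i => ∀ j, A.UpperChain (Fin.cons S E : Fin (m + 1) → A.Obj) i j →
      A.upper (Fin.cons T E : Fin (m + 1) → A.Obj) i j n)
    (fun j => Fin.cases
      (motive := fun j => A.UpperChain (Fin.cons S E : Fin (m + 1) → A.Obj) (0 : Fin (m + 1)) j →
        A.upper (Fin.cons T E : Fin (m + 1) → A.Obj) 0 j n)
      (fun _ => 0)
      (fun j' c => ⟨A.m (.cons 0 f (A.ambient (Fin.cons S E) c) : Chain A.hom T (E j')) n,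
        fun h => absurd (Fin.succ_pos j') h⟩) j)
    (fun _ _ c => linPart S T E c n) i j c

variable {f : A.hom T S 0}

lemma idPart_add (i j : Fin (m + 1)) (n : ℤ)
    (a b : A.upper (Fin.cons S E : Fin (m + 1) → A.Obj) i j n) :
    idPart S T E i j n (a + b) = idPart S T E i j n a + idPart S T E i j n b := by
  cases i using Fin.cases with
  | zero => exact (add_zero _).symm
  | succ i =>
    cases j using Fin.cases with
    | zero => exact (add_zero _).symm
    | succ j => rfl

lemma idPart_smul (i j : Fin (m + 1)) (n : ℤ) (t : k)
    (a : A.upper (Fin.cons S E : Fin (m + 1) → A.Obj) i j n) :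
    idPart S T E i j n (t • a) = t • idPart S T E i j n a := by
  cases i using Fin.cases with
  | zero => exact (smul_zero _).symm
  | succ i =>
    cases j using Fin.cases with
    | zero => exact (smul_zero _).symm
    | succ j => rfl

lemma linPart_single {i j : Fin (m + 1)} {n : ℤ}
    (a : A.upper (Fin.cons S E : Fin (m + 1) → A.Obj) i j n) :
    linPart S T E (.single n a) n = idPart S T E i j n a := dif_pos rfl

lemma linPart_single_of_ne {i j : Fin (m + 1)} {d n : ℤ} (h : d ≠ n)
    (a : A.upper (Fin.cons S E : Fin (m + 1) → A.Obj) i j d) :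
    linPart S T E (.single d a) n = 0 := dif_neg h

lemma linPart_eq_zero : ∀ {i j : Fin (m + 1)}
    (c : A.UpperChain (Fin.cons S E : Fin (m + 1) → A.Obj) i j) (n : ℤ),
    c.length ≠ 1 → linPart S T E c n = 0
  | _, _, .nil _, _, _ => rfl
  | _, _, .cons _ _ (.nil _), _, h => absurd rfl h
  | _, _, .cons _ _ (.cons _ _ _), _, _ => rfl

lemma linPart_degree : ∀ {i j : Fin (m + 1)}
    (c : A.UpperChain (Fin.cons S E : Fin (m + 1) → A.Obj) i j) (n : ℤ),
    n ≠ c.rdeg + 1 → linPart S T E c n = 0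
  | _, _, .nil _, _, _ => rfl
  | _, _, .cons d a (.nil _), n, h => linPart_single_of_ne (by
      rintro rfl
      simp [Chain.rdeg] at h) a
  | _, _, .cons _ _ (.cons _ _ _), _, _ => rfl


lemma linPart_add : ∀ {i₁ i₂ i₃ i₄ : Fin (m + 1)}
    (p : A.UpperChain (Fin.cons S E : Fin (m + 1) → A.Obj) i₁ i₂) (d : ℤ)
    (a b : A.upper (Fin.cons S E : Fin (m + 1) → A.Obj) i₂ i₃ d)
    (q : A.UpperChain (Fin.cons S E : Fin (m + 1) → A.Obj) i₃ i₄) (n : ℤ),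
    linPart S T E (p.append (.cons d (a + b) q)) n =
      linPart S T E (p.append (.cons d a q)) n + linPart S T E (p.append (.cons d b q)) n
  | _, _, _, _, .nil _, d, a, b, .nil _, n => by
      by_cases h : d = n
      · subst h
        exact (linPart_single _).trans ((idPart_add _ _ _ a b).trans
          (congrArg₂ _ (linPart_single a).symm (linPart_single b).symm))
      · exact (linPart_single_of_ne h _).trans ((add_zero _).symm.trans
          (congrArg₂ _ (linPart_single_of_ne h a).symm (linPart_single_of_ne h b).symm))
  | _, _, _, _, .nil _, _, _, _, .cons _ _ _, _ => (add_zero _).symm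
  | _, _, _, _, .cons _ _ (.nil _), _, _, _, _, _ => (add_zero _).symm
  | _, _, _, _, .cons _ _ (.cons _ _ _), _, _, _, _, _ => (add_zero _).symm

lemma linPart_smul : ∀ {i₁ i₂ i₃ i₄ : Fin (m + 1)}
    (p : A.UpperChain (Fin.cons S E : Fin (m + 1) → A.Obj) i₁ i₂) (d : ℤ) (t : k)
    (a : A.upper (Fin.cons S E : Fin (m + 1) → A.Obj) i₂ i₃ d)
    (q : A.UpperChain (Fin.cons S E : Fin (m + 1) → A.Obj) i₃ i₄) (n : ℤ),
    linPart S T E (p.append (.cons d (t • a) q)) n =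
      t • linPart S T E (p.append (.cons d a q)) n
  | _, _, _, _, .nil _, d, t, a, .nil _, n => by
      by_cases h : d = n
      · subst h
        exact (linPart_single _).trans ((idPart_smul _ _ _ t a).trans
          (congrArg _ (linPart_single a).symm))
      · exact (linPart_single_of_ne h _).trans ((smul_zero _).symm.trans
          (congrArg _ (linPart_single_of_ne h a).symm))
  | _, _, _, _, .nil _, _, _, _, .cons _ _ _, _ => (smul_zero _).symm
  | _, _, _, _, .cons _ _ (.nil _), _, _, _, _, _ => (smul_zero _).symm
  | _, _, _, _, .cons _ _ (.cons _ _ _), _, _, _, _, _ => (smul_zero _).symm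

/-- Strings of length at least two between the last `m` objects do not contribute to the blocks. -/
lemma sum_blocks_eq_zero (f : A.hom T S 0) {i : Fin m} {i' j : Fin (m + 1)}
    (acc : A.UpperChain (Fin.cons S E : Fin (m + 1) → A.Obj) i.succ i') (hacc : 2 ≤ acc.length)
    (c : A.UpperChain (Fin.cons S E : Fin (m + 1) → A.Obj) i' j) {W : A.Obj}
    (p : Chain A.hom W ((Fin.cons T E : Fin (m + 1) → A.Obj) i.succ)) (n : ℤ) :
    ((Chain.blocks (fun i : Fin (m + 1) => i) (precompF f) acc c).map fun s =>
      A.m (p.append (A.ambient (Fin.cons T E : Fin (m + 1) → A.Obj) s)) n).sum = 0 := by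
  have hF : ∀ e, precompF f acc e = 0 := fun e => linPart_eq_zero acc e (by omega)
  induction c with
  | nil =>
    rw [Chain.blocks_nil]
    simp only [List.map_cons, List.map_nil, List.sum_cons, List.sum_nil, add_zero]
    rw [hF]
    exact A.m_cons_zero p _ _ n
  | cons d a c ih =>
    have h2 : 2 ≤ (acc.append (.single d a)).length := by
      rw [Chain.length_append]
      omega
    rw [Chain.blocks_cons, List.map_append, List.sum_append,
      ih _ h2 (fun e => linPart_eq_zero _ e (by omega)), zero_add, List.map_map]
    refine List.sum_eq_zero fun x hx => ?_
    obtain ⟨s, -, rfl⟩ := List.mem_map.1 hx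
    simp only [Function.comp_def]
    rw [hF]
    exact A.m_cons_zero p _ _ n

/-- On a string with one element between the last `m` objects, the functor is the identity. The degree
`e` is a variable since `Chain.blocks` produces it in the form `rdeg + 1`. -/
lemma m_append_cons_precompF_single (f : A.hom T S 0) {i : Fin m} {i' j : Fin (m + 1)} {d : ℤ}
    (a : A.upper (Fin.cons S E : Fin (m + 1) → A.Obj) i.succ i' d) {W : A.Obj}
    (p : Chain A.hom W ((Fin.cons T E : Fin (m + 1) → A.Obj) i.succ)) {e : ℤ} (he : e = d)
    (s : A.UpperChain (Fin.cons T E : Fin (m + 1) → A.Obj) i' j) (n : ℤ) :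
    A.m (p.append (A.ambient (Fin.cons T E : Fin (m + 1) → A.Obj)
      (.cons e (precompF f (.cons d a (.nil _)) e) s))) n =
    A.m (p.append (.cons d (idPart S T E i.succ i' d a).1
      (A.ambient (Fin.cons T E : Fin (m + 1) → A.Obj) s))) n := by
  subst he
  exact congrArg (fun b : A.upper (Fin.cons T E : Fin (m + 1) → A.Obj) i.succ i' e =>
    A.m (p.append (.cons e b.1 (A.ambient (Fin.cons T E : Fin (m + 1) → A.Obj) s))) n)
    (linPart_single a)

/-- On strings between the last `m` objects, only the decomposition into strings with one element
contributes to the blocks. -/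
lemma sum_blocks_single (f : A.hom T S 0) {j : Fin m} : ∀ {i : Fin m} {i' : Fin (m + 1)} (d : ℤ)
    (a : A.upper (Fin.cons S E : Fin (m + 1) → A.Obj) i.succ i' d)
    (c : A.UpperChain (Fin.cons S E : Fin (m + 1) → A.Obj) i' j.succ) {W : A.Obj}
    (p : Chain A.hom W ((Fin.cons T E : Fin (m + 1) → A.Obj) i.succ)) (n : ℤ),
    ((Chain.blocks (fun i : Fin (m + 1) => i) (precompF f) (.single d a) c).map fun s =>
      A.m (p.append (A.ambient (Fin.cons T E : Fin (m + 1) → A.Obj) s)) n).sum =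
      A.m (Chain.append (Y := (Fin.cons S E : Fin (m + 1) → A.Obj) i.succ) p
        (A.ambient (Fin.cons S E : Fin (m + 1) → A.Obj) (.cons d a c))) n
  | i, _, d, a, .nil _, W, p, n => by
    rw [Chain.blocks_nil]
    simp only [List.map_cons, List.map_nil, List.sum_cons, List.sum_nil, add_zero]
    exact m_append_cons_precompF_single f a p (by simp [Chain.single, Chain.rdeg]) (.nil _) n
  | i, i', d, a, .cons d' a' c, W, p, n => by
    rw [Chain.blocks_cons, List.map_append, List.sum_append, sum_blocks_eq_zero f _ le_rfl c p n,
      zero_add, List.map_map]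
    have he : (Chain.single (hom := fun i j n =>
        A.upper (Fin.cons S E : Fin (m + 1) → A.Obj) i j n) d a).rdeg + 1 = d := by
      simp [Chain.single, Chain.rdeg]
    refine (congrArg List.sum (List.map_congr_left fun s _ =>
      m_append_cons_precompF_single f a p he s n)).trans ?_
    cases i' using Fin.cases with
    | zero =>
      refine (List.sum_eq_zero fun x hx => ?_).trans ?_
      · obtain ⟨s, -, rfl⟩ := List.mem_map.1 hx
        exact A.m_cons_zero p d _ n
      · have ha : a = 0 := upper_zero_eq _ _
        subst ha
        exact (A.m_cons_zero (Y := E i) p d _ n).symm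
    | succ i' =>
      have h := sum_blocks_single f d' a' c (p.append (.single d a.1)) n
      simp only [Chain.append_assoc] at h
      refine h.trans ?_
      exact congrArg (fun c => A.m c n) (Chain.append_assoc (Y := E i) (Z := E i') p _ _)

/-- The left hand side of the functor equation for strings between the last `m` objects. The first
object of the string is a variable `i'`, so that the string can be decomposed. -/
lemma sum_blocks_succ (f : A.hom T S 0) {j : Fin m} : ∀ {i' : Fin (m + 1)}
    (c : A.UpperChain (Fin.cons S E : Fin (m + 1) → A.Obj) i' j.succ) (i : Fin m) (h : i' = i.succ)
    (n : ℤ),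
    ((Chain.blocks (fun i : Fin (m + 1) => i) (precompF f) (.nil i.succ) (h ▸ c)).map fun s =>
      A.m (A.ambient (i := i.succ) (j := j.succ) (Fin.cons T E : Fin (m + 1) → A.Obj) s) n).sum =
      A.m (A.ambient (i := i.succ) (j := j.succ) (Fin.cons S E : Fin (m + 1) → A.Obj) (h ▸ c)) n
  | _, .nil _, i, h, n => by
    obtain rfl := Fin.succ_injective _ h
    rw [Chain.blocks_nil]
    simp only [List.map_cons, List.map_nil, List.sum_cons, List.sum_nil, add_zero]
    exact (A.m_zero₀ _ _ n).trans (A.m_nil _ n).symm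
  | _, .cons d a c, i, h, n => by
    subst h
    rw [Chain.blocks_cons, List.map_append, List.sum_append, List.map_map]
    refine (congrArg₂ _ (sum_blocks_single f d a c (.nil _) n)
      (List.sum_eq_zero fun x hx => ?_)).trans (add_zero _)
    obtain ⟨s, -, rfl⟩ := List.mem_map.1 hx
    exact A.m_zero₀ _ _ n

/-- The element `μ(r, μ(q, f))` for a composable pair of strings `q` and `r`. -/
def compM (f : A.hom T S 0) {Z W : A.Obj} (q : Chain A.hom S Z) (r : Chain A.hom Z W) (n : ℤ) :
    A.hom T W n :=
  A.m (.cons (q.rdeg + 1) (A.m (.cons 0 f q) (q.rdeg + 1)) r) n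

lemma compM_eq (f : A.hom T S 0) {Z W : A.Obj} (q : Chain A.hom S Z) (r : Chain A.hom Z W) {e : ℤ}
    (he : e = q.rdeg + 1) (n : ℤ) : A.m (.cons e (A.m (.cons 0 f q) e) r) n = compM f q r n := by
  subst he
  rfl

/-- On strings starting at `S`, the blocks correspond to the ways of applying `f` and an initial part
of the string first. -/
lemma sum_blocks_zero (hf : f ∈ A.cocycles T S 0) {j : Fin m} :
    ∀ {i : Fin (m + 1)} (acc : A.UpperChain (Fin.cons S E : Fin (m + 1) → A.Obj) 0 i)
    (c : A.UpperChain (Fin.cons S E : Fin (m + 1) → A.Obj) i j.succ) (n : ℤ),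
    ((Chain.blocks (fun i : Fin (m + 1) => i) (precompF f) acc c).map fun s =>
      A.m (A.ambient (i := 0) (j := j.succ) (Fin.cons T E : Fin (m + 1) → A.Obj) s) n).sum =
    ((A.ambient (Fin.cons S E : Fin (m + 1) → A.Obj) c).splits.map fun t =>
      compM (S := (Fin.cons S E : Fin (m + 1) → A.Obj) 0) f
        (Chain.append (A.ambient (Fin.cons S E : Fin (m + 1) → A.Obj) acc) t.2.1) t.2.2 n).sum
  | _, acc, .nil _, n => by
    rw [Chain.blocks_nil]
    simp only [List.map_cons, List.map_nil, List.sum_cons, List.sum_nil, add_zero, ambient, Chain.map,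
      Chain.splits, Chain.append_nil]
    exact compM_eq f (A.ambient (Fin.cons S E : Fin (m + 1) → A.Obj) acc) (.nil _)
      (congrArg (· + 1) (Chain.rdeg_map _ _ acc).symm) n
  | i, acc, .cons d a c, n => by
    rw [Chain.blocks_cons, List.map_append, List.sum_append,
      sum_blocks_zero hf (acc.append (.single d a)) c n]
    refine (add_comm _ _).trans ?_
    simp only [ambient, Chain.map, Chain.splits, List.map_cons, List.sum_cons, List.map_map,
      Function.comp_def, Chain.map_append, Chain.append_assoc, Chain.append_nil]
    refine congrArg₂ _ ?_ rfl
    have he : acc.rdeg + 1 = (A.ambient (Fin.cons S E : Fin (m + 1) → A.Obj) acc).rdeg + 1 :=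
      congrArg (· + 1) (Chain.rdeg_map _ _ acc).symm
    refine Eq.trans ?_ (compM_eq (S := (Fin.cons S E : Fin (m + 1) → A.Obj) 0) f
      (A.ambient (Fin.cons S E : Fin (m + 1) → A.Obj) acc) _ he n)
    cases i using Fin.cases with
    | zero =>
      refine (List.sum_eq_zero fun x hx => ?_).trans ?_
      · obtain ⟨s, -, rfl⟩ := List.mem_map.1 hx
        rw [upper_zero_eq (precompF f acc (acc.rdeg + 1)) 0]
        exact A.m_zero₀ _ _ n
      · have h : A.m (.cons 0 f (A.ambient (Fin.cons S E : Fin (m + 1) → A.Obj) acc))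
            (acc.rdeg + 1) = 0 := by
          cases hacc : acc with
          | nil => exact A.cocycle_m1 ⟨f, hf⟩ _
          | cons d a c =>
            exact A.m_map_upper_aux (Fin.cons S E : Fin (m + 1) → A.Obj) (.cons d a c)
              (lt_irrefl _) (Nat.succ_pos _) (.single 0 f) _
        exact ((congrArg (fun x : A.hom T S (acc.rdeg + 1) => A.m (.cons (acc.rdeg + 1) x
          (A.ambient (Fin.cons S E : Fin (m + 1) → A.Obj) (.cons d a c))) n) h).trans
          (A.m_zero₀ _ _ n)).symm
    | succ i =>
      exact sum_blocks_single f d a c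
        (.single (acc.rdeg + 1) (precompF f acc (acc.rdeg + 1)).1) n

/-- The `A∞`-relation for the string `f, c`: as `f` has degree `0`, the terms in which `f` is not an
argument of the inner operation have a sign opposite to the one in the insertions into `c`. -/
lemma sum_compM_eq (f : A.hom T S 0) {Y : A.Obj} (c : Chain A.hom S Y) (n : ℤ) :
    (c.splits.map fun t => compM f t.2.1 t.2.2 n).sum =
      ((c.insertions A.m).map fun s => s.1 • A.m (.cons 0 f s.2) n).sum := by
  have h := A.relation (.cons 0 f c) n
  rw [Chain.insertions_cons, List.map_append, List.sum_append, List.map_map, List.map_map] at h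
  simp only [Chain.splits, List.map_cons, List.map_map, List.sum_cons, Function.comp_def, A.m_nil,
    A.m_zero₀, zero_add, one_smul, Chain.rdeg, zero_sub, Int.negOnePow_neg, Int.negOnePow_one,
    neg_mul, one_mul, Units.neg_smul] at h
  have hn := List.sum_neg ((c.insertions A.m).map fun s => s.1 • A.m (.cons 0 f s.2) n)
  rw [List.map_map] at hn
  refine Eq.trans ?_ (eq_of_sub_eq_zero ((sub_eq_add_neg _ _).trans
    ((congrArg _ hn).trans h)))
  exact congrArg List.sum (List.map_congr_left fun t _ =>
    (compM_eq f t.2.1 t.2.2 (by ring) n).symm)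

/-- The right hand side of the functor equation for strings between the last `m` objects: only the
insertion of the whole string has length one. -/
lemma sum_insertions_linPart {i j : Fin m}
    (c : A.UpperChain (Fin.cons S E : Fin (m + 1) → A.Obj) i.succ j.succ) (n : ℤ) :
    ((c.insertions (A.directed (Fin.cons S E : Fin (m + 1) → A.Obj)).m).map fun s =>
      s.1 • linPart S T E s.2 n).sum =
      ⟨A.m (A.ambient (Fin.cons S E : Fin (m + 1) → A.Obj) c) n,
        A.m_map_upper (Fin.cons S E : Fin (m + 1) → A.Obj) c n⟩ := by
  refine (Chain.sum_insertions _ c fun e s => e • linPart S T E s n).trans ?_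
  refine (Chain.sum_splits_eq_left c (fun l p c' => (c'.splits.map fun t =>
    p.rdeg.negOnePow • linPart S T E (p.append (.cons (t.2.1.rdeg + 2)
      ((A.directed (Fin.cons S E : Fin (m + 1) → A.Obj)).m t.2.1 (t.2.1.rdeg + 2)) t.2.2)) n).sum)
    fun Z W d a p r => List.sum_eq_zero fun x hx => ?_).trans ?_
  · obtain ⟨t, -, rfl⟩ := List.mem_map.1 hx
    rw [linPart_eq_zero _ n (by rw [Chain.length_append]; simp only [Chain.length]; omega), smul_zero]
  refine (Chain.sum_splits_eq_right c (fun l q r => (0 : ℤ).negOnePow • linPart S T E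
    (.cons (q.rdeg + 2)
      ((A.directed (Fin.cons S E : Fin (m + 1) → A.Obj)).m q (q.rdeg + 2)) r) n)
    fun Z W p d a r => smul_zero _).trans ?_
  rw [Int.negOnePow_zero, one_smul]
  by_cases h : c.rdeg + 2 = n
  · subst h
    exact linPart_single _
  · refine (linPart_single_of_ne h _).trans (Subtype.ext ?_)
    exact (A.m_degree _ n fun hn => h ((congrArg (· + 2) (Chain.rdeg_map (Fin.cons S E :
      Fin (m + 1) → A.Obj) _ c)).symm.trans hn.symm)).symm

lemma coe_sum_map {M ι : Type*} [AddCommGroup M] [Module k M] {P : Submodule k M} (g : ι → P)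
    (l : List ι) : ((l.map g).sum : P).1 = (l.map fun s => (g s).1).sum :=
  (map_list_sum P.subtype _).trans (by rw [List.map_map]; rfl)

/-- The functor `end→(S, E) → end→(T, E)` given by a closed element `f` of `hom⁰(T, S)`. -/
def precompFunctor (S T : A.Obj) (E : Fin m → A.Obj) (f : A.hom T S 0) (hf : f ∈ A.cocycles T S 0) :
    AInfFunctor (A.directed (Fin.cons S E : Fin (m + 1) → A.Obj))
      (A.directed (Fin.cons T E : Fin (m + 1) → A.Obj)) (fun i => i) where
  F c n := precompF f c n
  F_nil i n := by
    cases i using Fin.cases with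
    | zero => exact upper_zero_eq _ _
    | succ i => rfl
  F_degree {i j} c n h := by
    cases j using Fin.cases with
    | zero => exact upper_zero_eq _ _
    | succ j =>
      cases i using Fin.cases with
      | zero =>
        refine Subtype.ext (A.m_degree _ n ?_)
        have hd : ∀ x : ℤ, 0 - 1 + x + 2 = x + 1 := fun x => by ring
        have hc := Chain.rdeg_map (Fin.cons S E : Fin (m + 1) → A.Obj)
          (fun {_ _ _} (a : A.upper (Fin.cons S E : Fin (m + 1) → A.Obj) _ _ _) => a.1) c
        exact fun hn => h (hn.trans
          ((congrArg (fun x : ℤ => 0 - 1 + x + 2) hc).trans (hd _)))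
      | succ i => exact linPart_degree c n h
  F_add {i _ _ j} p d a b q n := by
    cases j using Fin.cases with
    | zero => exact upper_zero_eq _ _
    | succ j =>
      cases i using Fin.cases with
      | zero =>
        refine Subtype.ext ?_
        have h : ∀ x, (precompF f (p.append (.cons d x q)) n).1 =
            A.m (.cons 0 f ((A.ambient (Fin.cons S E : Fin (m + 1) → A.Obj) p).append
              (.cons d x.1 (A.ambient (Fin.cons S E : Fin (m + 1) → A.Obj) q)))) n := fun x =>
          congrArg (fun c : Chain A.hom S (E j) => A.m (.cons 0 f c) n)
            (Chain.map_append (Fin.cons S E : Fin (m + 1) → A.Obj) _ p (.cons d x q))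
        refine (h _).trans (Eq.trans ?_ (congrArg₂ _ (h a).symm (h b).symm))
        exact A.m_add (.cons 0 f (A.ambient (Fin.cons S E : Fin (m + 1) → A.Obj) p)) d a.1 b.1
          (A.ambient (Fin.cons S E : Fin (m + 1) → A.Obj) q) n
      | succ i => exact linPart_add p d a b q n
  F_smul {i _ _ j} p d t a q n := by
    cases j using Fin.cases with
    | zero => exact upper_zero_eq _ _
    | succ j =>
      cases i using Fin.cases with
      | zero =>
        refine Subtype.ext ?_
        have h : ∀ x, (precompF f (p.append (.cons d x q)) n).1 =
            A.m (.cons 0 f ((A.ambient (Fin.cons S E : Fin (m + 1) → A.Obj) p).append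
              (.cons d x.1 (A.ambient (Fin.cons S E : Fin (m + 1) → A.Obj) q)))) n := fun x =>
          congrArg (fun c : Chain A.hom S (E j) => A.m (.cons 0 f c) n)
            (Chain.map_append (Fin.cons S E : Fin (m + 1) → A.Obj) _ p (.cons d x q))
        refine (h _).trans (Eq.trans ?_ (congrArg (t • ·) (h a).symm))
        exact A.m_smul (.cons 0 f (A.ambient (Fin.cons S E : Fin (m + 1) → A.Obj) p)) d t a.1
          (A.ambient (Fin.cons S E : Fin (m + 1) → A.Obj) q) n
      | succ i => exact linPart_smul p d t a q n
  relation {i j} c n := by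
    cases j using Fin.cases with
    | zero => exact upper_zero_eq _ _
    | succ j =>
      refine Subtype.ext ((coe_sum_map _ _).trans ?_)
      cases i using Fin.cases with
      | zero =>
        have h := sum_blocks_zero hf (.nil _) c n
        refine h.trans ((sum_compM_eq f _ n).trans ((?_ : _ = _).trans (coe_sum_map _ _).symm))
        have hi := Chain.insertions_map (hom := fun i j n =>
            A.upper (Fin.cons S E : Fin (m + 1) → A.Obj) i j n) (hom' := A.hom)
          (Fin.cons S E : Fin (m + 1) → A.Obj) (fun a => a.1)
          (A.directed (Fin.cons S E : Fin (m + 1) → A.Obj)).m A.m (fun _ _ => rfl) c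
        refine (congrArg (fun l => List.sum (List.map (fun s => s.1 • A.m (.cons 0 f s.2) n) l))
          hi).trans ?_
        rw [List.map_map]
        rfl
      | succ i =>
        refine Eq.trans ?_ (congrArg Subtype.val (sum_insertions_linPart c n)).symm
        exact sum_blocks_succ f c i rfl n

end AInfPrecategory

/-! ### The linear part of a functor, and equivalences of directed categories -/

namespace AInfFunctor

variable {k : Type w} [Field k] {A B : AInfPrecategory.{w, u, v} k} {φ : A.Obj → B.Obj}
  (F : AInfFunctor A B φ)

lemma F_cons_zero {X Y Z W : A.Obj} (p : Chain A.hom X Y) (d : ℤ) (q : Chain A.hom Z W) (n : ℤ) :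
    F.F (p.append (.cons d (0 : A.hom Y Z d) q)) n = 0 := by
  have h := F.F_smul p d (0 : k) (0 : A.hom Y Z d) q n
  rwa [zero_smul, zero_smul] at h

lemma F_zero₀ {X Y Z : A.Obj} (d : ℤ) (q : Chain A.hom Y Z) (n : ℤ) :
    F.F (.cons d (0 : A.hom X Y d) q) n = 0 :=
  F.F_cons_zero (.nil X) d q n

lemma F_zero₁ {X Y Z W : A.Obj} (d e : ℤ) (a : A.hom X Y d) (q : Chain A.hom Z W) (n : ℤ) :
    F.F (.cons d a (.cons e (0 : A.hom Y Z e) q)) n = 0 :=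
  F.F_cons_zero (.single d a) e q n

lemma F_zero₂ {X Y Z W V : A.Obj} (d e f : ℤ) (a : A.hom X Y d) (b : A.hom Y Z e)
    (q : Chain A.hom W V) (n : ℤ) :
    F.F (.cons d a (.cons e b (.cons f (0 : A.hom Z W f) q))) n = 0 :=
  F.F_cons_zero (.pair d e a b) f q n

/-- The linear part of an `A∞`-functor. -/
def linear (X Y : A.Obj) (n : ℤ) : A.hom X Y n →ₗ[k] B.hom (φ X) (φ Y) n where
  toFun a := F.F (.single n a) n
  map_add' a b := F.F_add (.nil X) n a b (.nil Y) n
  map_smul' t a := F.F_smul (.nil X) n t a (.nil Y) n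

/-- The linear part of an `A∞`-functor commutes with the differentials. -/
lemma m1_linear {X Y : A.Obj} {n n' : ℤ} (h : n' = n + 1) (a : A.hom X Y n) :
    B.m1 _ _ n n' (F.linear X Y n a) = F.linear X Y n' (A.m1 X Y n n' a) := by
  subst h
  have h := F.relation (.single n a) (n + 1)
  simp only [Chain.insertions, Chain.splits, Chain.single, Chain.append, Chain.rdeg, A.m_nil,
    Chain.blocks, F.F_nil, B.m_zero₀, F.F_zero₀, F.F_zero₁,
    List.map_cons, List.map_nil, List.flatMap_cons, List.flatMap_nil, List.cons_append,
    List.nil_append, List.sum_cons, List.sum_nil, smul_zero, zero_add, add_zero,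
    Int.negOnePow_zero, one_smul] at h
  rw [show n - 1 + 0 + 2 = n + 1 by ring, show n - 1 + 0 + 1 = n by ring] at h
  exact h

/-- The linear part of an `A∞`-functor is compatible with products of closed elements, up to a
boundary. -/
lemma exists_m1_eq_linear_m2 {X Y Z : A.Obj} {i j l : ℤ} (hl : l = i + j) {a : A.hom X Y i}
    {b : A.hom Y Z j} (ha : a ∈ A.cocycles X Y i) (hb : b ∈ A.cocycles Y Z j) :
    ∃ x, B.m1 _ _ (l - 1) l x = F.linear X Z l (A.m2 X Y Z i j l a b) -
      B.m2 _ _ _ i j l (F.linear X Y i a) (F.linear Y Z j b) := by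
  have h := F.relation (.pair i j a b) l
  simp only [Chain.insertions, Chain.splits, Chain.single, Chain.pair, Chain.append, Chain.rdeg,
    A.m_nil,
    Chain.blocks, F.F_nil, B.m_zero₀, F.F_zero₀, F.F_zero₁, F.F_zero₂,
    List.map_cons, List.map_nil, List.flatMap_cons, List.flatMap_nil, List.cons_append,
    List.nil_append, List.sum_cons, List.sum_nil, smul_zero, zero_add, add_zero,
    Int.negOnePow_zero, one_smul] at h
  rw [show i - 1 + 0 + 2 = i + 1 by ring, show i - 1 + 0 + 1 = i by ring,
    show j - 1 + 0 + 2 = j + 1 by ring, show j - 1 + 0 + 1 = j by ring,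
    show i - 1 + (j - 1 + 0) + 2 = l by omega, show i - 1 + (j - 1 + 0) + 1 = l - 1 by omega] at h
  change A.m (Chain.single i a) (i + 1) = 0 at ha
  change A.m (Chain.single j b) (j + 1) = 0 at hb
  simp only [Chain.single] at ha hb
  rw [ha, hb, F.F_zero₀, F.F_zero₁, smul_zero, add_zero, zero_add] at h
  exact ⟨_, eq_sub_of_add_eq h⟩

end AInfFunctor

namespace AInfCategory

open AInfPrecategory

variable {k : Type w} [Field k] {A : AInfCategory.{w, u, v} k} {m : ℕ} {S T : A.Obj}
  {E : Fin m → A.Obj} {f : A.hom T S 0}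

lemma precompFunctor_isQuasiIso {hf : f ∈ A.cocycles T S 0} (h : ∀ j, PreBij (cls f hf) (E j)) :
    (precompFunctor S T E f hf).IsQuasiIso := by
  intro i j n
  cases j using Fin.cases with
  | zero => exact ⟨fun a _ _ => ⟨(0 : A.upper _ _ _ _), upper_zero_eq _ _⟩, fun b _ => ⟨(0 : A.upper _ _ _ _), (0 : A.upper _ _ _ _), upper_zero_eq _ _,
      upper_zero_eq _ _⟩⟩
  | succ j =>
    cases i using Fin.cases with
    | zero =>
      obtain ⟨hinj, hsurj⟩ := h j (zero_add n)
      refine ⟨fun a ha ⟨b, hb⟩ => ?_, fun b hb => ?_⟩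
      · have ha' : a.1 ∈ A.cocycles S (E j) n := congrArg Subtype.val ha
        have hab : A.m2 T S (E j) 0 n n f a.1 = A.m1 T (E j) (n - 1) n b.1 :=
          congrArg Subtype.val hb
        have h0 : cls (A := A.toAInfPrecategory) a.1 ha' = 0 := hinj <| Eq.trans
          ((comp_cls_eq_zero_iff (sub_add_cancel n 1).symm hf ha').2 ⟨b.1, hab.symm⟩)
          (map_zero _).symm
        obtain ⟨x, hx⟩ := (cls_eq_zero_iff (sub_add_cancel n 1).symm).1 h0
        exact ⟨⟨x, fun h => absurd (Fin.succ_pos j) h⟩, Subtype.ext hx.symm⟩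
      · have hb' : b.1 ∈ A.cocycles T (E j) n := congrArg Subtype.val hb
        obtain ⟨y, hy⟩ := hsurj (cls (A := A.toAInfPrecategory) b.1 hb')
        obtain ⟨a, ha, rfl⟩ := exists_cls y
        change A.comp T S (E j) 0 n n (cls f hf) (cls a ha) = _ at hy
        rw [comp_cls, Int.negOnePow_zero, one_smul] at hy
        obtain ⟨x, hx⟩ := (cls_eq_cls_iff (sub_add_cancel n 1).symm).1 hy.symm
        refine ⟨⟨a, fun h => absurd (Fin.succ_pos j) h⟩, ⟨x, fun h => absurd (Fin.succ_pos j) h⟩,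
          Subtype.ext ha, Subtype.ext ?_⟩
        exact (sub_eq_iff_eq_add'.1 hx.symm)
    | succ i =>
      have hF : ∀ a, (precompFunctor S T E f hf).F (.single n a) n = idPart S T E i.succ j.succ n a :=
        linPart_single
      refine ⟨fun a _ ⟨b, hb⟩ => ⟨⟨b.1, b.2⟩, Subtype.ext ?_⟩,
        fun b hb => ⟨⟨b.1, b.2⟩, (0 : A.upper _ _ _ _), Subtype.ext (congrArg Subtype.val hb), ?_⟩⟩
      · exact congrArg Subtype.val ((hF a).symm.trans hb)
      · refine Subtype.ext (Eq.symm ((congrArg₂ (fun x y : A.hom (E i) (E j) n => x + y)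
          (congrArg Subtype.val (hF ⟨b.1, b.2⟩)) (map_zero (A.m1 (E i) (E j) (n - 1) n))).trans ?_))
        exact add_zero b.1

/-- A closed morphism `f : T → S` inducing bijections `Hom*(S, E j) → Hom*(T, E j)` gives an
equivalence of directed categories. -/
theorem directedEquivExtendingId_of_preBij {x : A.H T S 0} (h : ∀ j, PreBij x (E j)) :
    A.DirectedEquivExtendingId S T E := by
  obtain ⟨f, hf, rfl⟩ := exists_cls x
  refine ⟨precompFunctor S T E f hf, precompFunctor_isQuasiIso h, fun i j n a => ?_,
    fun i j c n hc => ?_⟩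
  · exact congrArg Subtype.val (linPart_single a)
  · exact congrArg Subtype.val (linPart_eq_zero c n (Nat.ne_of_gt hc))

/-- If an equivalence of directed categories as in the definition of `DirectedEquivExtendingId` exists
for `S = E 0`, then the element of `Hom⁰(T, E 0)` that is the image of the unit of `E 0`, viewed as a
morphism from the first to the second object, induces bijections `Hom*(E 0, E j) → Hom*(T, E j)`. -/
theorem exists_preBij_of_directedEquivExtendingId [NeZero m]
    (h1 : Module.finrank k (A.H (E 0) (E 0) 0) = 1)
    (h0 : ∀ n : ℤ, n ≠ 0 → Subsingleton (A.H (E 0) (E 0) n))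
    (h : A.DirectedEquivExtendingId (E 0) T E) : ∃ t : A.H T (E 0) 0, ∀ j, PreBij t (E j) := by
  obtain ⟨F, hq, hid, -⟩ := h
  have hlt : ∀ {p : Prop} (j : Fin m), ¬ (0 : Fin (m + 1)) < j.succ → p := fun j h =>
    absurd (Fin.succ_pos j) h
  let X : Fin (m + 1) → A.Obj := Fin.cons (E 0) E
  let inc (j : Fin m) (n : ℤ) (a : A.hom (E 0) (E j) n) :
      (A.directed X).hom (0 : Fin (m + 1)) j.succ n := (⟨a, hlt j⟩ : A.upper X 0 j.succ n)
  -- The linear part of `F` on the morphisms out of the first object.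
  let G (j : Fin m) (n : ℤ) : A.hom (E 0) (E j) n →ₗ[k] A.hom T (E j) n :=
    { toFun a := (F.F (.single n (inc j n a)) n).1
      map_add' a b := congrArg Subtype.val
        (F.F_add (.nil (0 : Fin (m + 1))) n (inc j n a) (inc j n b) (.nil j.succ) n)
      map_smul' t a := congrArg Subtype.val
        (F.F_smul (.nil (0 : Fin (m + 1))) n t (inc j n a) (.nil j.succ) n) }
  have hG : ∀ j {n n' : ℤ} (_ : n' = n + 1) (a : A.hom (E 0) (E j) n),
      A.m1 T (E j) n n' (G j n a) = G j n' (A.m1 (E 0) (E j) n n' a) := fun j n n' hn a =>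
    congrArg Subtype.val (F.m1_linear hn (inc j n a))
  have hGc : ∀ j {n : ℤ} {a : A.hom (E 0) (E j) n}, a ∈ A.cocycles _ _ n →
      G j n a ∈ A.cocycles _ _ n := fun j n a ha =>
    (hG j rfl a).trans ((congrArg (G j (n + 1)) ha).trans (map_zero _))
  have hGm : ∀ j, 0 < j → ∀ {n : ℤ} {e : A.hom (E 0) (E 0) 0} {a : A.hom (E 0) (E j) n},
      e ∈ A.cocycles _ _ 0 → a ∈ A.cocycles _ _ n → ∃ x, A.m1 T (E j) (n - 1) n x =
        G j n (A.m2 (E 0) (E 0) (E j) 0 n n e a) - A.m2 T (E 0) (E j) 0 n n (G 0 0 e) a := by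
    intro j hj n e a he ha
    obtain ⟨x, hx⟩ := F.exists_m1_eq_linear_m2 (X := (0 : Fin (m + 1))) (Y := (0 : Fin m).succ) (Z := j.succ)
      (zero_add n).symm (a := inc 0 0 e)
      (b := ⟨a, fun h => absurd (Fin.succ_lt_succ_iff.2 hj) h⟩) (Subtype.ext he) (Subtype.ext ha)
    refine ⟨x.1, ?_⟩
    have hx' : A.m1 T (E j) (n - 1) n x.1 = G j n (A.m2 (E 0) (E 0) (E j) 0 n n e a) -
        A.m2 T (E 0) (E j) 0 n n (G 0 0 e) _ := congrArg Subtype.val hx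
    refine hx'.trans ?_
    have := hid 0 j n ⟨a, fun h => absurd (Fin.succ_lt_succ_iff.2 hj) h⟩
    exact congrArg (fun b => G j n (A.m2 (E 0) (E 0) (E j) 0 n n e a) -
      A.m2 T (E 0) (E j) 0 n n (G 0 0 e) b) this
  obtain ⟨e, he, hee⟩ := exists_cls (A.one (E 0))
  have hs : ∀ n : ℤ, n = n - 1 + 1 := fun n => (sub_add_cancel n 1).symm
  have key : ∀ j (n : ℤ) (a : A.hom (E 0) (E j) n) (ha : a ∈ A.cocycles _ _ n),
      A.comp T (E 0) (E j) 0 n n (cls (G 0 0 e) (hGc 0 he)) (cls a ha) =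
        cls (G j n a) (hGc j ha) := by
    intro j n a ha
    rcases (Fin.zero_le j).eq_or_lt with rfl | hj
    · by_cases hn : n = 0
      · subst hn
        obtain ⟨c, hc⟩ := exists_smul_eq_of_finrank_eq_one h1 (one_ne_zero_of_finrank h1) (cls a ha)
        rw [← hc, map_smul, comp_one, ← cls_smul]
        rw [← hee, ← cls_smul] at hc
        obtain ⟨y, hy⟩ := (cls_eq_cls_iff (hs 0)).1 hc
        refine (cls_eq_cls_iff (hs 0)).2 ⟨G 0 (0 - 1) y, ?_⟩
        rw [hG 0 (hs 0), hy, map_sub, map_smul]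
      · have := h0 n hn
        rw [Subsingleton.elim (cls a ha) 0, map_zero]
        obtain ⟨y, hy⟩ := (cls_eq_zero_iff (hs n)).1 (Subsingleton.elim (cls a ha) 0)
        exact ((cls_eq_zero_iff (hs n)).2 ⟨G 0 (n - 1) y, by rw [hG 0 (hs n), hy]⟩).symm
    · rw [comp_cls, Int.negOnePow_zero, one_smul]
      have h := A.one_comp (cls a ha)
      rw [← hee, comp_cls, Int.negOnePow_zero, one_smul] at h
      obtain ⟨y, hy⟩ := (cls_eq_cls_iff (hs n)).1 h
      obtain ⟨x, hx⟩ := hGm j hj he ha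
      refine (cls_eq_cls_iff (hs n)).2 ⟨G j (n - 1) y - x, ?_⟩
      rw [map_sub, hG j (hs n), hy, hx, map_sub]
      abel
  refine ⟨cls (G 0 0 e) (hGc 0 he), fun j p n hn => ?_⟩
  obtain rfl : p = n := by omega
  obtain ⟨hinj, hsurj⟩ := hq (0 : Fin (m + 1)) j.succ p
  refine ⟨injective_comp_left_iff.2 fun x hx => ?_, fun y => ?_⟩
  · obtain ⟨a, ha, rfl⟩ := exists_cls x
    rw [key j p a ha] at hx
    obtain ⟨b, hb⟩ := (cls_eq_zero_iff (hs p)).1 hx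
    obtain ⟨a', ha'⟩ := hinj (inc j p a) (Subtype.ext ha) ⟨⟨b, hlt j⟩, Subtype.ext hb.symm⟩
    exact (cls_eq_zero_iff (hs p)).2 ⟨a'.1, (congrArg Subtype.val ha').symm⟩
  · obtain ⟨b, hb, rfl⟩ := exists_cls y
    obtain ⟨a, b', ha, hab⟩ := hsurj ⟨b, hlt j⟩ (Subtype.ext hb)
    have ha' : a.1 ∈ A.cocycles (E 0) (E j) p := congrArg Subtype.val ha
    obtain ⟨c, hc⟩ : ∃ c, b = G j p a.1 + A.m1 T (E j) (p - 1) p c :=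
      ⟨b'.1, congrArg Subtype.val hab⟩
    refine ⟨cls (A := A.toAInfPrecategory) a.1 ha', (key j p a.1 ha').trans
      ((cls_eq_cls_iff (hs p)).2 ⟨-c, ?_⟩)⟩
    rw [map_neg, hc, sub_add_cancel_left]

end AInfCategory

end AInf

open AInf AInfPrecategory AInfCategory TriangulatedAInfCategory in
theorem mainTheorem5 {k : Type w} [Field k] (D : AInf.TriangulatedAInfCategory.{w, u, v} k)
    (m : ℕ) [NeZero m] (E : Fin (m + 1) → D.Obj) (hE : D.IsExceptionalCollection E)
    (C : ObjectProperty D.H0) (hC : C = D.Generated fun i : Fin m => E i.castSucc)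
    (E₁ E_last : D.Obj) (hE₁ : E₁ = E (Fin.castSucc 0)) (hE_last : E_last = E (Fin.last m))
    (C₁ : C.FullSubcategory) (hC₁ : C₁.obj = E₁)
    (lam rho : D.H0 ⥤ C.FullSubcategory) (adj_lam : lam ⊣ C.ι) (adj_rho : C.ι ⊣ rho)
    (serre : AInf.SerreFunctor k C.FullSubcategory)
    (LC : D.Obj) (hLC : D.IsLeftMutation C E_last LC)
    (L : Fin m → D.Obj) (hL : ∀ i : Fin m, i ≠ 0 →
      D.IsLeftMutation (D.Generated fun _ : Unit => E₁) (E i.castSucc) (L i))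
    (d : ℤ) :
    List.TFAE [
      (∀ n : ℤ, n ≠ d → Subsingleton (D.H E₁ E_last n)) ∧
        ∃ φ : D.H E₁ E_last d ≃ₗ[k] k, ∀ i : Fin m, i ≠ 0 → ∀ j : ℤ,
          ((D.comp E₁ (E i.castSucc) E_last (d - j) j d).compr₂ φ.toLinearMap).IsPerfPair,
      (∀ n : ℤ, n ≠ d → Subsingleton (D.H E₁ E_last n)) ∧
        ∃ φ : D.H E₁ E_last d ≃ₗ[k] k, ∀ X : D.Obj, C X →
          ((D.comp E₁ X E_last 0 d d).compr₂ φ.toLinearMap).IsPerfPair,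
      (∀ n : ℤ, n ≠ d → Subsingleton (D.H E₁ E_last n)) ∧
        Nonempty (D.H E₁ E_last d ≃ₗ[k] k) ∧
        ∀ i : Fin m, i ≠ 0 → ∀ n : ℤ, Subsingleton (D.H (L i) E_last n),
      Nonempty (Iso (C := D.H0) (D.shift (rho.obj E_last).obj d) (serre.S.obj C₁).obj),
      Nonempty (Iso (C := D.H0) (D.shift (lam.obj LC).obj (d - 1)) (serre.S.obj C₁).obj),
      ∀ E' : Fin m → D.Obj, D.IsExceptionalCollection E' → D.Generated E' = C →
        D.DirectedEquivExtendingId (serre.S.obj C₁).obj (D.shift LC (d - 1)) E'] := by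
  obtain ⟨P, hP⟩ := C₁
  obtain rfl : P = E₁ := hC₁
  subst hE_last
  subst hE₁
  let G : Fin m → D.Obj := fun i => E i.castSucc
  have hG : D.IsExceptionalCollection G :=
    ⟨fun i => hE.finrank_self _, fun i => hE.self_eq_zero _,
      fun i j n h => hE.eq_zero _ _ n (Fin.castSucc_lt_castSucc_iff.2 h)⟩
  have hCG : ∀ i, C (G i) := fun i => hC ▸ .of i
  have hCs : ∀ (n : ℤ) (X Y : D.Obj), D.IsShift n X Y → C X → C Y := fun n X Y h hX => by
    subst hC
    exact .shift n X Y h hX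
  have hX : ∀ W : D.Obj, C W → ∀ n, Subsingleton (D.H (E (Fin.last m)) W n) := fun W hW n => by
    subst hC
    exact Generated.subsingleton_right (fun i n => hE.eq_zero _ _ n (Fin.castSucc_lt_last i)) hW n
  have hS := isSerreDual_serreTrace serre hCs ⟨G 0, hP⟩
  have hSC : C (serre.S.obj ⟨G 0, hP⟩).obj := (serre.S.obj ⟨G 0, hP⟩).property
  have hfin : ∀ X Y : D.Obj, C X → C Y → ∀ n, Module.Finite k (D.H X Y n) := fun X Y hX hY n =>
    finite_hom hCs serre hX hY n
  have hfin₁ := fun W hW => hfin (G 0) W hP hW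
  have hLC' : ∀ i, i ≠ 0 → C (L i) := fun i hi => by
    obtain ⟨⟨C', hC', hT⟩, -⟩ := hL i hi
    subst hC
    exact .tri₃ _ _ _ hT (Generated.of_forall (fun _ => .of 0) hC') (.of i)
  -- The counit of the right adjoint, as a universal element of `Hom^d(ρ(E_last)[d], E_last)`.
  obtain ⟨ε, hε⟩ := exists_postBij_rightAdjoint hCs adj_rho (E (Fin.last m))
  obtain ⟨a, b, hab⟩ := (D.isShift_shift (rho.obj (E (Fin.last m))).obj d).exists_isInvPair
  have hω : ∀ W : D.Obj, C W → PostBij (D.comp _ _ _ d 0 d b ε) W := fun W hW =>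
    hab.symm.postBij.comp (hε W hW) (by omega)
  have hR : C (D.shift (rho.obj (E (Fin.last m))).obj d) :=
    hCs _ _ _ (D.isShift_shift _ d) (rho.obj (E (Fin.last m))).property
  have hP₁ := hG.finrank_self 0
  have hP₀ := hG.self_eq_zero 0
  tfae_have 1 → 2 := by
    rintro ⟨hd, φ, hφ⟩
    refine ⟨hd, φ, fun W hW => ?_⟩
    have h := hS.isPerfPair_of_generators hP hP₁ hP₀ hfin₁ hR hω hd hC (φ := φ)
      (fun i => or_iff_not_imp_left.2 fun hi => hφ i fun h => hi (by rw [h])) hW d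
    rwa [sub_self] at h
  tfae_have 2 → 1 := by
    rintro ⟨hd, φ, hφ⟩
    exact ⟨hd, φ, fun i _ j => IsSerreDual.isPerfPair_of_degree_zero hCs hφ (hCG i) j⟩
  tfae_have 1 → 3 := by
    rintro ⟨hd, φ, hφ⟩
    exact ⟨hd, ⟨φ⟩, fun i hi => (hS.isPerfPair_iff_leftMutation hP hP₁ hP₀ hfin₁ hR hω hd (hCG i)
      (hLC' i hi) (hL i hi)).1 (hφ i hi)⟩
  tfae_have 3 → 1 := by
    rintro ⟨hd, ⟨φ⟩, h⟩
    exact ⟨hd, φ, fun i hi => (hS.isPerfPair_iff_leftMutation hP hP₁ hP₀ hfin₁ hR hω hd (hCG i)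
      (hLC' i hi) (hL i hi)).2 (h i hi)⟩
  tfae_have 2 → 4 := by
    rintro ⟨hd, φ, hφ⟩
    exact nonempty_iso_iff.2 (hS.isShift_of_isPerfPair hSC hfin₁ hR hω hφ)
  tfae_have 4 → 2 := fun h =>
    hS.exists_isPerfPair_of_isShift hP hP₁ hP₀ hfin₁ hω (nonempty_iso_iff.1 h)
  have h_adj := isShift_rightAdjoint_leftAdjoint hCs adj_lam adj_rho hX hLC
  tfae_have 4 ↔ 5 := by
    refine nonempty_iso_iff.trans (isShift_shift_iff.trans (Iff.trans ?_
      (nonempty_iso_iff.trans isShift_shift_iff).symm))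
    exact ⟨fun h => h_adj.symm.trans h (by omega), fun h => h_adj.trans h (by omega)⟩
  have h₅ : Nonempty (Iso (C := D.H0) (D.shift (lam.obj LC).obj (d - 1))
      (serre.S.obj ⟨G 0, hP⟩).obj) ↔ ∃ t : D.H (D.shift LC (d - 1)) (serre.S.obj ⟨G 0, hP⟩).obj 0,
        ∀ W : D.Obj, C W → PreBij t W :=
    nonempty_iso_iff.trans (isShift_shift_iff.trans (isShift_leftAdjoint_iff hCs adj_lam hSC _))
  tfae_have 5 → 6 := by
    intro h E' _ hgen
    obtain ⟨t, ht⟩ := h₅.1 h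
    exact directedEquivExtendingId_of_preBij fun j => ht _ (hgen ▸ .of j)
  tfae_have 6 → 5 := by
    intro h
    refine h₅.2 ?_
    -- The condition is applied to the mutated collection that starts with the Serre dual of `E₁`.
    obtain ⟨E', hE'₀, hE', hgen⟩ : ∃ E' : Fin m → D.Obj, E' 0 = (serre.S.obj ⟨G 0, hP⟩).obj ∧
        D.IsExceptionalCollection E' ∧ D.Generated E' = C := by
      subst hC
      refine ⟨Function.update L 0 (serre.S.obj ⟨G 0, hP⟩).obj, Function.update_self _ _ _,
        isExceptionalCollection_update hG hL hLC' hSC hS,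
        generated_update_eq hG hL hLC' hSC hS hfin fun X Y hX hY =>
          Generated.boundedHom hG (fun i => ⟨_, serreTrace serre ⟨G i, .of i⟩,
            (serre.S.obj ⟨G i, .of i⟩).property,
            isSerreDual_serreTrace serre hCs ⟨G i, .of i⟩⟩) hX hY⟩
    have key : ∀ S : D.Obj, E' 0 = S → D.DirectedEquivExtendingId S (D.shift LC (d - 1)) E' →
        ∃ t : D.H (D.shift LC (d - 1)) S 0, ∀ j, PreBij t (E' j) := by
      rintro _ rfl h
      exact exists_preBij_of_directedEquivExtendingId (hE'.finrank_self 0) (hE'.self_eq_zero 0) h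
    obtain ⟨t, ht⟩ := key _ hE'₀ (h E' hE' hgen)
    exact ⟨t, fun W hW => Generated.preBij ht (hgen ▸ hW)⟩
  tfae_finish
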